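/- Let $K$ be a field. A directed graph $E$ consists of a set of vertices $E^0$, a set of edges $E^1$ and source and range maps $s,r:E^1\to E^0$; a weighted graph $(E,w)$ is a directed graph with a map $w:E^1\to\{1,2,\dots\}$. All weighted graphs are assumed to have at least one vertex and to be row-finite, i.e. $s^{-1}(v)$ is finite for every $v\in E^0$. Put $w(v)=\max\{w(e)\mid e\in s^{-1}(v)\}$ (with $\max\emptyset=0$). The weighted Leavitt path algebra $L_K(E,w)$ is the associative (not necessarily unital) $K$-algebra generated by the vertices $v\in E^0$ and elements $e_i,e_i^*$ ($e\in E^1$, $1\le i\le w(e)$), subject to the relations $$uv=\delta_{uv}u\ (u,v\in E^0),\qquad s(e)e_i=e_i=e_ir(e),\qquad r(e)e_i^*=e_i^*=e_i^*s(e),$$ $$\sum_{e\in s^{-1}(v)}e_ie_j^*=\delta_{ij}v\ (v\in E^0,\ 1\le i,j\le w(v)),\qquad \sum_{1\le i\le w(v)}e_i^*f_i=\delta_{ef}r(e)\ (v\in E^0,\ e,f\in s^{-1}(v)),$$ where $e_i$ and $e_i^*$ are read as $0$ if $i>w(e)$. It is graded by $\deg v=0$, $\deg e_i=\epsilon_i$,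 $\deg e_i^*=-\epsilon_i$, where $\epsilon_i$ is the $i$-th unit vector of $\mathbb Z^n$ and $n$ is the maximal weight; it is called locally finite if all its homogeneous components are finite-dimensional over $K$. The graph is unweighted if $w(e)=1$ for all $e\in E^1$. Write $E^1_w=\{e\in E^1\mid w(e)>1\}$ for the set of weighted edges; a weighted edge $e$ is of type B if $s^{-1}(s(e))\neq\{e\}$. A sink is a vertex that emits no edge. **Replacement graph.** A set $H\subseteq E^0$ is hereditary if every vertex that can be reached by a path from a vertex of $H$ lies in $H$; then $(E_H,w_H)$ denotes the weighted graph with vertex set $H$, edge set $s^{-1}(H)$ and the restrictions of $s,r,w$. Let $E'=((E')^0,(E')^1,s',r')$ be a row-finite directed graph with Leavitt path algebra $L_K(E')$, and let $\phi:L_K(E_H,w_H)\to L_K(E')$ be a $K$-algebra isomorphism such that for every $v\in H$ one has $\phi(v)=u'_{v,1}+\dots+u'_{v,n_v}$ with distinct vertices $u'_{v,1},\dots,u'_{v,n_v}$ of $E'$. The replacement graph defined by $\phi$ is the weighted graph with vertex set $(E^0\setminus H)\sqcup(E')^0$ and the following edges: the edges $e\in E^1$ with $s(e),r(e)\notin H$,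 with their source, range and weight; for every $e\in E^1$ with $s(e)\notin H$ and $r(e)\in H$, edges $e^{(1)},\dots,e^{(n_{r(e)})}$ of weight $w(e)$, where $e^{(j)}$ has source $s(e)$ and range $u'_{r(e),j}$; and the edges of $E'$, with their source and range and with weight $1$. **Proposition 5.5.** Let $(E,w)$ be a weighted graph such that $L_K(E,w)$ is locally finite, all weighted edges of $(E,w)$ are of type B, and their ranges are sinks. If $(E,w)$ is not unweighted, then there is a weighted graph $(\tilde E,\tilde w)$, which is the replacement graph defined by some $\phi$ as above, such that $E^1_w$ and $\tilde E^1_w$ are finite with $|\tilde E^1_w|=|E^1_w|-1$, the $K$-algebras $L_K(\tilde E,\tilde w)$ and $L_K(E,w)$ are isomorphic, and $L_K(\tilde E,\tilde w)$ is locally finite. -/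

import Mathlib

universe u v

namespace WLPA

/-! ### Algebras without unit given by generators and relations -/

section Presentation

variable {K A : Type*} [Field K] [NonUnitalRing A] [Module K A]

/-- The smallest two-sided ideal of the `K`-algebra `A` (a `K`-subspace that absorbs products on both
sides) which contains all differences `a - b` with `r a b`. -/
def relIdeal (K : Type*) {A : Type*} [Field K] [NonUnitalRing A] [Module K A]
    (r : A → A → Prop) : Submodule K A :=
  sInf {J : Submodule K A | (∀ a b, r a b → a - b ∈ J) ∧
    ∀ a, ∀ x ∈ J, a * x ∈ J ∧ x * a ∈ J}

theorem mul_mem_relIdeal (r : A → A → Prop) (a : A) {x : A} (hx : x ∈ relIdeal K r) :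
    a * x ∈ relIdeal K r ∧ x * a ∈ relIdeal K r := by
  simp only [relIdeal, Submodule.mem_sInf] at hx ⊢
  exact ⟨fun J hJ => (hJ.2 a x (hx J hJ)).1, fun J hJ => (hJ.2 a x (hx J hJ)).2⟩

/-- The quotient of the (not necessarily unital) algebra `A` by the ideal generated by the
relations `r`. -/
def RelQuot (K : Type*) {A : Type*} [Field K] [NonUnitalRing A] [Module K A]
    (r : A → A → Prop) : Type _ :=
  A ⧸ relIdeal K r

namespace RelQuot

variable (r : A → A → Prop)

instance : AddCommGroup (RelQuot K r) := inferInstanceAs (AddCommGroup (A ⧸ relIdeal K r))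

instance : Module K (RelQuot K r) := inferInstanceAs (Module K (A ⧸ relIdeal K r))

/-- The canonical projection as a linear map. -/
def mkₗ : A →ₗ[K] RelQuot K r := (relIdeal K r).mkQ

theorem mkₗ_surjective : Function.Surjective (mkₗ (K := K) r) := (relIdeal K r).mkQ_surjective

/-- Multiplication of cosets. -/
instance : Mul (RelQuot K r) where
  mul := Quotient.map₂ (· * ·) (by
    intro a a' ha b b' hb
    have ha' : a - a' ∈ relIdeal K r := (Submodule.quotientRel_def _).1 ha
    have hb' : b - b' ∈ relIdeal K r := (Submodule.quotientRel_def _).1 hb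
    refine (Submodule.quotientRel_def _).2 ?_
    have h : a * b - a' * b' = (a - a') * b + a' * (b - b') := by
      rw [sub_mul, mul_sub]; abel
    rw [h]
    exact add_mem (mul_mem_relIdeal r b ha').2 (mul_mem_relIdeal r a' hb').1)

theorem mkₗ_mul (a b : A) : mkₗ (K := K) r (a * b) = mkₗ r a * mkₗ r b := rfl

instance : NonUnitalRing (RelQuot K r) where
  left_distrib x y z := by
    obtain ⟨a, rfl⟩ := mkₗ_surjective r x
    obtain ⟨b, rfl⟩ := mkₗ_surjective r y
    obtain ⟨c, rfl⟩ := mkₗ_surjective r z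
    simp only [← map_add, ← mkₗ_mul, mul_add]
  right_distrib x y z := by
    obtain ⟨a, rfl⟩ := mkₗ_surjective r x
    obtain ⟨b, rfl⟩ := mkₗ_surjective r y
    obtain ⟨c, rfl⟩ := mkₗ_surjective r z
    simp only [← map_add, ← mkₗ_mul, add_mul]
  zero_mul x := by
    obtain ⟨a, rfl⟩ := mkₗ_surjective r x
    rw [← map_zero (mkₗ r), ← mkₗ_mul, zero_mul]
  mul_zero x := by
    obtain ⟨a, rfl⟩ := mkₗ_surjective r x
    rw [← map_zero (mkₗ r), ← mkₗ_mul, mul_zero]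
  mul_assoc x y z := by
    obtain ⟨a, rfl⟩ := mkₗ_surjective r x
    obtain ⟨b, rfl⟩ := mkₗ_surjective r y
    obtain ⟨c, rfl⟩ := mkₗ_surjective r z
    simp only [← mkₗ_mul, mul_assoc]

instance [IsScalarTower K A A] : IsScalarTower K (RelQuot K r) (RelQuot K r) where
  smul_assoc k x y := by
    obtain ⟨a, rfl⟩ := mkₗ_surjective r x
    obtain ⟨b, rfl⟩ := mkₗ_surjective r y
    simp only [smul_eq_mul, ← map_smul, ← mkₗ_mul, smul_mul_assoc]

instance [SMulCommClass K A A] : SMulCommClass K (RelQuot K r) (RelQuot K r) where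
  smul_comm k x y := by
    obtain ⟨a, rfl⟩ := mkₗ_surjective r x
    obtain ⟨b, rfl⟩ := mkₗ_surjective r y
    simp only [smul_eq_mul, ← map_smul, ← mkₗ_mul, mul_smul_comm]

/-- The canonical projection as a homomorphism of (not necessarily unital) algebras. -/
def mk : A →ₙₐ[K] RelQuot K r where
  toFun := mkₗ r
  map_smul' := map_smul (mkₗ r)
  map_zero' := map_zero (mkₗ r)
  map_add' := map_add (mkₗ r)
  map_mul' := mkₗ_mul r

end RelQuot

end Presentation

/-- The free associative `K`-algebra (without unit) on `X`: the `K`-vector space with basis the set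
of nonempty words over `X`, multiplied by juxtaposition. -/
abbrev FreeAlg (K X : Type*) [Field K] : Type _ := MonoidAlgebra K (FreeSemigroup X)

/-- A word over `X` as an element of the free algebra. -/
noncomputable def word (K : Type*) {X : Type*} [Field K] (x : FreeSemigroup X) : FreeAlg K X :=
  MonoidAlgebra.single x 1

/-- A letter as an element of the free algebra. -/
noncomputable def letter (K : Type*) {X : Type*} [Field K] (x : X) : FreeAlg K X :=
  word K (FreeSemigroup.of x)

/-- Two (not necessarily unital) `K`-algebras are isomorphic. -/
def AlgIso (K A B : Type*) [Field K] [NonUnitalRing A] [Module K A] [NonUnitalRing B]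
    [Module K B] : Prop :=
  ∃ f : A →ₙₐ[K] B, Function.Bijective f

/-! ### Directed graphs and their Leavitt path algebras -/

/-- A directed graph: vertices, edges, source and range. -/
structure DirectedGraph where
  /-- the vertices -/
  V : Type u
  /-- the edges -/
  Edge : Type v
  /-- the source of an edge -/
  s : Edge → V
  /-- the range of an edge -/
  r : Edge → V

namespace DirectedGraph

variable (G : DirectedGraph.{u, v})

/-- Every vertex emits only finitely many edges. -/
def RowFinite : Prop := ∀ x : G.V, {e : G.Edge | G.s e = x}.Finite

/-- A sink is a vertex that emits no edge. -/
def IsSink (x : G.V) : Prop := {e : G.Edge | G.s e = x} = ∅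

/-- There is a path (possibly trivial) from `x` to `y`. -/
def Geq (x y : G.V) : Prop :=
  Relation.ReflTransGen (fun a b => ∃ e : G.Edge, G.s e = a ∧ G.r e = b) x y

/-- A set of vertices is hereditary if it contains every vertex that can be reached from it. -/
def IsHereditary (H : Set G.V) : Prop := ∀ x ∈ H, ∀ y, G.Geq x y → y ∈ H

theorem IsHereditary.range_mem {G : DirectedGraph.{u, v}} {H : Set G.V} (hH : G.IsHereditary H)
    {e : G.Edge} (he : G.s e ∈ H) : G.r e ∈ H :=
  hH _ he _ (Relation.ReflTransGen.single ⟨e, rfl, rfl⟩)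

/-- The letters of the Leavitt path algebra: vertices, edges `e` and ghost edges `e*`. -/
inductive Gen where
  | vertex (x : G.V)
  | edge (e : G.Edge)
  | ghost (e : G.Edge)

variable (K : Type*) [Field K]

/-- The defining relations of the Leavitt path algebra of a directed graph. -/
inductive Rel : FreeAlg K G.Gen → FreeAlg K G.Gen → Prop
  | vertex_mul_self (x : G.V) :
      Rel (letter K (.vertex x) * letter K (.vertex x)) (letter K (.vertex x))
  | vertex_mul_ne (x y : G.V) (h : x ≠ y) :
      Rel (letter K (.vertex x) * letter K (.vertex y)) 0
  | source_mul_edge (e : G.Edge) :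
      Rel (letter K (.vertex (G.s e)) * letter K (.edge e)) (letter K (.edge e))
  | edge_mul_range (e : G.Edge) :
      Rel (letter K (.edge e) * letter K (.vertex (G.r e))) (letter K (.edge e))
  | range_mul_ghost (e : G.Edge) :
      Rel (letter K (.vertex (G.r e)) * letter K (.ghost e)) (letter K (.ghost e))
  | ghost_mul_source (e : G.Edge) :
      Rel (letter K (.ghost e) * letter K (.vertex (G.s e))) (letter K (.ghost e))
  | ghost_mul_edge_self (e : G.Edge) :
      Rel (letter K (.ghost e) * letter K (.edge e)) (letter K (.vertex (G.r e)))
  | ghost_mul_edge_ne (e f : G.Edge) (h : e ≠ f) :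
      Rel (letter K (.ghost e) * letter K (.edge f)) 0
  | sum_edge_mul_ghost (x : G.V) (hx : ¬ G.IsSink x) (hfin : {e : G.Edge | G.s e = x}.Finite) :
      Rel (∑ e ∈ hfin.toFinset, letter K (.edge e) * letter K (.ghost e)) (letter K (.vertex x))

/-- The Leavitt path algebra `L_K(G)` of a directed graph. -/
abbrev LPA : Type _ := RelQuot K (G.Rel K)

/-- The image of a vertex in `L_K(G)`. -/
noncomputable def lpaVertex (x : G.V) : G.LPA K := RelQuot.mk (G.Rel K) (letter K (.vertex x))

end DirectedGraph

/-! ### Weighted graphs and weighted Leavitt path algebras -/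

/-- A row-finite weighted graph. -/
structure WeightedGraph extends DirectedGraph.{u, v} where
  /-- the weight of an edge -/
  w : Edge → ℕ
  /-- weights are positive -/
  w_pos : ∀ e, 1 ≤ w e
  /-- every vertex emits only finitely many edges -/
  rowFinite : toDirectedGraph.RowFinite

namespace WeightedGraph

variable (E : WeightedGraph.{u, v})

/-- The finite set of edges emitted by a vertex. -/
noncomputable def out (x : E.V) : Finset E.Edge := (E.rowFinite x).toFinset

/-- The weight of a vertex: the maximal weight of an emitted edge, `0` for a sink. -/
noncomputable def vw (x : E.V) : ℕ := (E.out x).sup E.w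

/-- All edges have weight one. -/
def IsUnweighted : Prop := ∀ e : E.Edge, E.w e = 1

/-- The weighted edges, i.e. those of weight greater than one. -/
def weightedEdges : Set E.Edge := {e | 1 < E.w e}

/-- The weighted edges of type A: those which are the only edge emitted by their source. -/
def weightedEdgesA : Set E.Edge := {e ∈ E.weightedEdges | {f : E.Edge | E.s f = E.s e} = {e}}

/-- The weighted edges of type B: those not of type A. -/
def weightedEdgesB : Set E.Edge := E.weightedEdges \ E.weightedEdgesA

/-- The letters of the weighted Leavitt path algebra: vertices, and for every edge `e` the edges
`e_1, ..., e_{w(e)}` and the ghost edges `e_1*, ..., e_{w(e)}*`. The index `i : Fin (w e)` stands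
for `e_{i+1}`. -/
inductive Gen where
  | vertex (x : E.V)
  | edge (e : E.Edge) (i : Fin (E.w e))
  | ghost (e : E.Edge) (i : Fin (E.w e))

variable (K : Type*) [Field K]

/-- `e_{i+1}` as an element of the free algebra, with `e_{i+1} = 0` if `i + 1 > w(e)`. -/
noncomputable def edgeElt (e : E.Edge) (i : ℕ) : FreeAlg K E.Gen :=
  if h : i < E.w e then letter K (.edge e ⟨i, h⟩) else 0

/-- `e_{i+1}*` as an element of the free algebra, with `e_{i+1}* = 0` if `i + 1 > w(e)`. -/
noncomputable def ghostElt (e : E.Edge) (i : ℕ) : FreeAlg K E.Gen :=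
  if h : i < E.w e then letter K (.ghost e ⟨i, h⟩) else 0

/-- The defining relations of the weighted Leavitt path algebra: the relations of the path algebra
of the double graph of the directed graph associated to `E`, and the two families
`∑_{e ∈ s⁻¹(x)} e_i e_j* = δ_{ij} x` (`1 ≤ i, j ≤ w(x)`) and
`∑_{1 ≤ i ≤ w(x)} e_i* f_i = δ_{ef} r(e)` (`e, f ∈ s⁻¹(x)`). -/
inductive Rel : FreeAlg K E.Gen → FreeAlg K E.Gen → Prop
  | vertex_mul_self (x : E.V) :
      Rel (letter K (.vertex x) * letter K (.vertex x)) (letter K (.vertex x))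
  | vertex_mul_ne (x y : E.V) (h : x ≠ y) :
      Rel (letter K (.vertex x) * letter K (.vertex y)) 0
  | source_mul_edge (e : E.Edge) (i : Fin (E.w e)) :
      Rel (letter K (.vertex (E.s e)) * letter K (.edge e i)) (letter K (.edge e i))
  | edge_mul_range (e : E.Edge) (i : Fin (E.w e)) :
      Rel (letter K (.edge e i) * letter K (.vertex (E.r e))) (letter K (.edge e i))
  | range_mul_ghost (e : E.Edge) (i : Fin (E.w e)) :
      Rel (letter K (.vertex (E.r e)) * letter K (.ghost e i)) (letter K (.ghost e i))
  | ghost_mul_source (e : E.Edge) (i : Fin (E.w e)) :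
      Rel (letter K (.ghost e i) * letter K (.vertex (E.s e))) (letter K (.ghost e i))
  | sum_edge_mul_ghost_self (x : E.V) (i : ℕ) (hi : i < E.vw x) :
      Rel (∑ e ∈ E.out x, E.edgeElt K e i * E.ghostElt K e i) (letter K (.vertex x))
  | sum_edge_mul_ghost_ne (x : E.V) (i j : ℕ) (hi : i < E.vw x) (hj : j < E.vw x) (h : i ≠ j) :
      Rel (∑ e ∈ E.out x, E.edgeElt K e i * E.ghostElt K e j) 0
  | sum_ghost_mul_edge_self (x : E.V) (e : E.Edge) (he : E.s e = x) :
      Rel (∑ i ∈ Finset.range (E.vw x), E.ghostElt K e i * E.edgeElt K e i)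
        (letter K (.vertex (E.r e)))
  | sum_ghost_mul_edge_ne (x : E.V) (e f : E.Edge) (he : E.s e = x) (hf : E.s f = x)
      (h : e ≠ f) :
      Rel (∑ i ∈ Finset.range (E.vw x), E.ghostElt K e i * E.edgeElt K f i) 0

/-- The weighted Leavitt path algebra `L_K(E, w)`. -/
abbrev wLPA : Type _ := RelQuot K (E.Rel K)

/-- The image of a vertex in `L_K(E, w)`. -/
noncomputable def wlpaVertex (x : E.V) : E.wLPA K := RelQuot.mk (E.Rel K) (letter K (.vertex x))

/-- The degree of a letter: `deg x = 0`, `deg e_i = ε_i`, `deg e_i* = -ε_i`. The degrees are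
written in the group of finitely supported integer sequences, which contains `ℤⁿ` for all `n`. -/
noncomputable def genDeg : E.Gen → (ℕ →₀ ℤ)
  | .vertex _ => 0
  | .edge _ i => Finsupp.single (i : ℕ) 1
  | .ghost _ i => -Finsupp.single (i : ℕ) 1

/-- The degree of a word: the sum of the degrees of its letters. -/
noncomputable def wordDeg (p : FreeSemigroup E.Gen) : ℕ →₀ ℤ :=
  (FreeSemigroup.lift (fun x => Multiplicative.ofAdd (E.genDeg x)) p).toAdd

/-- The homogeneous component of degree `d` for the standard grading of `L_K(E, w)`: the span of
the words of degree `d`. If all weights are at most `n`, then it vanishes unless `d` lies in `ℤⁿ`,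
so that this is the standard `ℤⁿ`-grading. -/
noncomputable def component (d : ℕ →₀ ℤ) : Submodule K (E.wLPA K) :=
  Submodule.span K {a | ∃ p : FreeSemigroup E.Gen,
    E.wordDeg p = d ∧ a = RelQuot.mk (E.Rel K) (word K p)}

/-- All homogeneous components of the standard grading are finite-dimensional. -/
def LocallyFinite : Prop := ∀ d : ℕ →₀ ℤ, FiniteDimensional K (E.component K d)

/-- The weighted subgraph `(E_H, w_H)` defined by a hereditary set of vertices. -/
def sub (H : Set E.V) (hH : E.IsHereditary H) : WeightedGraph.{u, v} where
  V := H
  Edge := {e : E.Edge // E.s e ∈ H}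
  s e := ⟨E.s e, e.2⟩
  r e := ⟨E.r e, hH.range_mem e.2⟩
  w e := E.w e
  w_pos e := E.w_pos e
  rowFinite x := by
    refine Set.Finite.of_finite_image (f := Subtype.val) ((E.rowFinite x).subset ?_)
      Subtype.val_injective.injOn
    rintro _ ⟨e, he, rfl⟩
    exact congrArg Subtype.val he

/-- The edges of a replacement graph: the edges outside `H`; for every edge `e` from the complement
of `H` into `H` one copy of `e` for each element of `U (r e)`; and the edges of `G`. -/
inductive ReplEdge (H : Set E.V) (G : DirectedGraph.{u, v}) (U : H → Finset G.V) : Type (max u v)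
  | old (e : E.Edge) (hs : E.s e ∉ H) (hr : E.r e ∉ H)
  | copy (e : E.Edge) (hs : E.s e ∉ H) (hr : E.r e ∈ H) (x : U ⟨E.r e, hr⟩)
  | new (e : G.Edge)

variable {E}

namespace ReplEdge

variable {H : Set E.V} {G : DirectedGraph.{u, v}} {U : H → Finset G.V}

/-- The source of an edge of the replacement graph. -/
def source : E.ReplEdge H G U → {x : E.V // x ∉ H} ⊕ G.V
  | .old e hs _ => .inl ⟨E.s e, hs⟩
  | .copy e hs _ _ => .inl ⟨E.s e, hs⟩
  | .new e => .inr (G.s e)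

/-- The range of an edge of the replacement graph. -/
def range : E.ReplEdge H G U → {x : E.V // x ∉ H} ⊕ G.V
  | .old e _ hr => .inl ⟨E.r e, hr⟩
  | .copy _ _ _ x => .inr x
  | .new e => .inr (G.r e)

/-- The weight of an edge of the replacement graph. -/
def weight : E.ReplEdge H G U → ℕ
  | .old e _ _ => E.w e
  | .copy e _ _ _ => E.w e
  | .new _ => 1

end ReplEdge

/-- The graph obtained from `E` by replacing the subgraph on the hereditary set `H` by the
unweighted graph `G`, an edge ending in `y ∈ H` being replaced by one copy for each vertex in
`U y`. -/
def replace (E : WeightedGraph.{u, v}) (H : Set E.V) (G : DirectedGraph.{u, v})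
    (hG : G.RowFinite) (U : H → Finset G.V) : WeightedGraph.{u, max u v} where
  V := {x : E.V // x ∉ H} ⊕ G.V
  Edge := E.ReplEdge H G U
  s := ReplEdge.source
  r := ReplEdge.range
  w := ReplEdge.weight
  w_pos e := by
    cases e with
    | old e _ _ => exact E.w_pos e
    | copy e _ _ _ => exact E.w_pos e
    | new e => exact le_refl 1
  rowFinite x := by
    classical
    rcases x with x | x
    · have h1 : Set.Finite {e : E.Edge | E.s e = x} := E.rowFinite x
      refine (h1.biUnion (t := fun e => {f : E.ReplEdge H G U |
        (∃ hs hr, f = .old e hs hr) ∨ ∃ hs hr y, f = .copy e hs hr y}) ?_).subset ?_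
      · intro e _
        by_cases hs : E.s e ∈ H
        · convert Set.finite_empty
          ext f
          simp [hs]
        by_cases hr : E.r e ∈ H
        · refine (Set.finite_range (fun y : U ⟨E.r e, hr⟩ =>
            (ReplEdge.copy e hs hr y : E.ReplEdge H G U))).subset ?_
          rintro f (⟨_, hr', rfl⟩ | ⟨_, _, y, rfl⟩)
          · exact absurd hr hr'
          · exact ⟨y, rfl⟩
        · refine (Set.finite_singleton (ReplEdge.old e hs hr : E.ReplEdge H G U)).subset ?_
          rintro f (⟨_, _, rfl⟩ | ⟨_, hr', y, rfl⟩)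
          · rfl
          · exact absurd hr' hr
      · intro f hf
        cases f with
        | old e hs hr =>
          exact Set.mem_biUnion (congrArg Subtype.val (Sum.inl.inj hf)) (Or.inl ⟨hs, hr, rfl⟩)
        | copy e hs hr y =>
          exact Set.mem_biUnion (congrArg Subtype.val (Sum.inl.inj hf))
            (Or.inr ⟨hs, hr, y, rfl⟩)
        | new e => exact absurd hf (by simp [ReplEdge.source])
    · refine ((hG x).image ReplEdge.new).subset ?_
      intro f hf
      cases f with
      | old e hs hr => exact absurd hf (by simp [ReplEdge.source])
      | copy e hs hr y => exact absurd hf (by simp [ReplEdge.source])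
      | new e => exact ⟨e, Sum.inr.inj hf, rfl⟩

/-- `E'` is the replacement graph defined by some algebra isomorphism `φ : L_K(E_H, w_H) → L_K(G)`,
where `H` is hereditary and `G` is a row-finite directed graph, that maps every vertex `y` to a sum
of distinct vertices, namely those in `U y`. -/
def IsReplacementGraph (K : Type*) [Field K] (E : WeightedGraph.{u, v})
    (E' : WeightedGraph.{u, max u v}) : Prop :=
  ∃ (H : Set E.V) (hH : E.IsHereditary H) (G : DirectedGraph.{u, v}) (hG : G.RowFinite)
    (φ : (E.sub H hH).wLPA K →ₙₐ[K] G.LPA K) (U : H → Finset G.V),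
    Function.Bijective φ ∧
    (∀ y : H, φ ((E.sub H hH).wlpaVertex K y) = ∑ x ∈ U y, G.lpaVertex K x) ∧
    E' = E.replace H G hG U

end WeightedGraph

end WLPA

/-!
Splitting the range of a weighted edge. Suppose first that a weighted edge `e` with source `x` and
range `y` is the only weighted edge of the graph, and that `y` is a sink. Since every other edge at
`x` has weight one, the relations for indices greater than one only involve `e`: one has
`e_i e_j* = δ_{ij} x` unless `i = j = 1`, and `y` is the sum of the orthogonal idempotents
`e_i* e_i`. For `i ≥ 2` the idempotent `e_i* e_i` is thus linked to `x` by `e_i*`. So `L_K(E, w)` is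
the Leavitt path algebra of the directed graph in which `y` is split into vertices `y_1, …, y_n`
with `n = w(e)`, where `e_1` becomes an edge from `x` to `y_1`, and `e_i*` for `i ≥ 2` an edge from
`y_i` to `x`, and every other edge ending in `y` is replaced by a copy for each `y_i`
(`exists_split_iso`).

In general one chooses a weighted edge `e` such that no other weighted edge starts in the set `H` of
the vertices that can be reached from `s(e)`, applies this to the subgraph on `H`, and extends the
isomorphism to the whole algebra (`exists_replacement_iso`). The weighted edges of the replacement
graph are those of `E` except `e`, provided that no other weighted edge ends in `r(e)`, which would
have several copies.

That such an `e` exists, and that weighted edges have distinct ranges, follows from local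
finiteness. The diamond lemma in the form of an action on normal words shows that the normal words
are linearly independent (`linearIndependent_elt`). So there are only finitely many of each degree,
and each forbidden configuration is excluded by normal words of degree zero and of unbounded length
(`controlled_of_locallyFinite`). The configurations to be excluded include the exits of closed paths
which may also run through weighted edges against their direction; these are the closed paths that
become cycles when the ranges of the weighted edges are split.

The isomorphism does not respect the degrees of `e_i` for `i ≥ 2`, so that local finiteness of the
new algebra needs an argument. As the closed paths have no exits, the algebra is spanned by products
`p t b`, where `p` and `b` run through finite sets and `t` is a path or a ghost path along a cycle
whose edges have weight one (`Controlled.exists_span_eq_top`). The isomorphism does respect the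
degrees of such `t`, and there are only finitely many `t` of each degree
(`Controlled.locallyFinite_of_surjective`).
-/


namespace WLPA

/-! ### Homomorphisms from algebras given by generators and relations -/

section Lift

variable {K A B : Type*} [Field K] [NonUnitalRing A] [Module K A] [NonUnitalRing B] [Module K B]

theorem sub_mem_relIdeal {r : A → A → Prop} {a b : A} (h : r a b) : a - b ∈ relIdeal K r := by
  simp only [relIdeal, Submodule.mem_sInf]
  exact fun J hJ => hJ.1 a b h

theorem RelQuot.mk_eq {r : A → A → Prop} {a b : A} (h : r a b) :
    RelQuot.mk (K := K) r a = RelQuot.mk r b :=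
  (Submodule.Quotient.eq _).2 (sub_mem_relIdeal h)

theorem RelQuot.mk_surjective (r : A → A → Prop) : Function.Surjective (RelQuot.mk (K := K) r) :=
  RelQuot.mkₗ_surjective r

/-- A homomorphism that respects the relations `r` descends to the quotient by `r`. -/
def RelQuot.lift (r : A → A → Prop) (g : A →ₙₐ[K] B) (h : ∀ a b, r a b → g a = g b) :
    RelQuot K r →ₙₐ[K] B where
  toFun := Submodule.liftQ (relIdeal K r) (g : A →ₗ[K] B) (by
    have : relIdeal K r ≤ LinearMap.ker (g : A →ₗ[K] B) := by
      refine sInf_le ⟨fun a b hab => ?_, fun a x hx => ?_⟩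
      · simp [h a b hab]
      · have hx' : g x = 0 := hx
        simp [hx']
    exact this)
  map_smul' k x := map_smul (Submodule.liftQ (relIdeal K r) (g : A →ₗ[K] B) _) k x
  map_zero' := map_zero (Submodule.liftQ (relIdeal K r) (g : A →ₗ[K] B) _)
  map_add' x y := map_add (Submodule.liftQ (relIdeal K r) (g : A →ₗ[K] B) _) x y
  map_mul' x y := by
    obtain ⟨a, rfl⟩ := RelQuot.mkₗ_surjective r x
    obtain ⟨b, rfl⟩ := RelQuot.mkₗ_surjective r y
    exact map_mul g a b

theorem RelQuot.lift_mk (r : A → A → Prop) (g : A →ₙₐ[K] B) (h : ∀ a b, r a b → g a = g b)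
    (a : A) : RelQuot.lift r g h (RelQuot.mk r a) = g a := rfl

end Lift

section FreeAlg

variable {K B X : Type*} [Field K] [NonUnitalRing B] [Module K B] [IsScalarTower K B B]
  [SMulCommClass K B B]

/-- The homomorphism from the free algebra on `X` that extends a map on the letters. -/
noncomputable def FreeAlg.lift (f : X → B) : FreeAlg K X →ₙₐ[K] B :=
  MonoidAlgebra.liftMagma K (FreeSemigroup.lift f)

theorem FreeAlg.lift_word (f : X → B) (p : FreeSemigroup X) :
    FreeAlg.lift f (word K p) = FreeSemigroup.lift f p := by
  have := (MonoidAlgebra.liftMagma (A := B) K).symm_apply_apply (FreeSemigroup.lift f)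
  exact DFunLike.congr_fun this p

theorem FreeAlg.lift_letter (f : X → B) (x : X) : FreeAlg.lift f (letter K x) = f x := by
  rw [letter, FreeAlg.lift_word, FreeSemigroup.lift_of]

theorem word_mul (p q : FreeSemigroup X) : word K (p * q) = word K p * word K q := by
  simp [word, MonoidAlgebra.single_mul_single]

/-- Homomorphisms from an algebra given by generators and relations agree if they agree on the
generators. -/
theorem RelQuot.hom_ext_letter {r : FreeAlg K X → FreeAlg K X → Prop} {C : Type*}
    [NonUnitalRing C] [Module K C] {g h : RelQuot K r →ₙₐ[K] C}
    (H : ∀ x, g (RelQuot.mk r (letter K x)) = h (RelQuot.mk r (letter K x))) : g = h := by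
  have : g.comp (RelQuot.mk r) = h.comp (RelQuot.mk r) := by
    apply MonoidAlgebra.nonUnitalAlgHom_ext
    intro p
    change g (RelQuot.mk r (word K p)) = h (RelQuot.mk r (word K p))
    induction p using FreeSemigroup.recOnMul with
    | ih1 x => exact H x
    | ih2 x y hx hy => rw [word_mul, map_mul, map_mul, map_mul, hx, hy]
  ext x
  obtain ⟨a, rfl⟩ := RelQuot.mk_surjective r x
  exact DFunLike.congr_fun this a

theorem RelQuot.span_word (r : FreeAlg K X → FreeAlg K X → Prop) :
    Submodule.span K (Set.range fun p => RelQuot.mk (K := K) r (word K p)) = ⊤ := by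
  rw [eq_top_iff]
  rintro x -
  obtain ⟨a, rfl⟩ := RelQuot.mk_surjective r x
  induction a using MonoidAlgebra.induction_linear with
  | zero => rw [map_zero]; exact zero_mem _
  | add f g hf hg => rw [map_add]; exact add_mem hf hg
  | single p k =>
    have : (MonoidAlgebra.single p k : FreeAlg K X) = k • word K p := by
      simp [word, MonoidAlgebra.smul_single]
    rw [this, map_smul]
    exact Submodule.smul_mem _ _ (Submodule.subset_span ⟨p, rfl⟩)

/-- A subspace that is closed under left multiplication by the generators is a left ideal. -/
theorem RelQuot.mul_mem_of_letter {r : FreeAlg K X → FreeAlg K X → Prop}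
    (N : Submodule K (RelQuot K r))
    (hN : ∀ x, ∀ n ∈ N, RelQuot.mk r (letter K x) * n ∈ N) (a : RelQuot K r) {n : RelQuot K r}
    (hn : n ∈ N) : a * n ∈ N := by
  have ha : a ∈ Submodule.span K (Set.range fun p => RelQuot.mk (K := K) r (word K p)) := by
    rw [RelQuot.span_word]; trivial
  induction ha using Submodule.span_induction with
  | zero => rw [zero_mul]; exact zero_mem _
  | add x y _ _ hx hy => rw [add_mul]; exact add_mem hx hy
  | smul k x _ hx => rw [smul_mul_assoc]; exact N.smul_mem k hx
  | mem x hx =>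
    obtain ⟨p, rfl⟩ := hx
    dsimp only
    induction p using FreeSemigroup.recOnMul generalizing n with
    | ih1 x => exact hN x n hn
    | ih2 x y hx hy => rw [word_mul, map_mul, mul_assoc]; exact hx (hy hn)

end FreeAlg

namespace WeightedGraph

/-! ### The universal property of weighted Leavitt path algebras -/

variable (E : WeightedGraph.{u, v}) (K : Type*) [Field K]

theorem mem_out {E : WeightedGraph.{u, v}} {x : E.V} {e : E.Edge} : e ∈ E.out x ↔ E.s e = x := by
  simp [out]

theorem w_le_vw {E : WeightedGraph.{u, v}} {x : E.V} {e : E.Edge} (h : E.s e = x) :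
    E.w e ≤ E.vw x :=
  Finset.le_sup (f := E.w) (mem_out.2 h)

/-- The image of `e_{i+1}` in `L_K(E, w)`, zero if `i + 1 > w(e)`. -/
noncomputable def ed (e : E.Edge) (i : ℕ) : E.wLPA K := RelQuot.mk (E.Rel K) (E.edgeElt K e i)

/-- The image of `e_{i+1}*` in `L_K(E, w)`, zero if `i + 1 > w(e)`. -/
noncomputable def gh (e : E.Edge) (i : ℕ) : E.wLPA K := RelQuot.mk (E.Rel K) (E.ghostElt K e i)

/-- Elements `P x`, `X e i`, `Y e i` of an algebra that satisfy the defining relations of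
`L_K(E, w)` in the roles of `x`, `e_{i+1}`, `e_{i+1}*`. -/
structure Family {B : Type*} [NonUnitalRing B] (P : E.V → B) (X Y : E.Edge → ℕ → B) : Prop where
  X_zero : ∀ e i, E.w e ≤ i → X e i = 0
  Y_zero : ∀ e i, E.w e ≤ i → Y e i = 0
  P_self : ∀ x, P x * P x = P x
  P_ne : ∀ x y, x ≠ y → P x * P y = 0
  PX : ∀ e i, i < E.w e → P (E.s e) * X e i = X e i
  XP : ∀ e i, i < E.w e → X e i * P (E.r e) = X e i
  PY : ∀ e i, i < E.w e → P (E.r e) * Y e i = Y e i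
  YP : ∀ e i, i < E.w e → Y e i * P (E.s e) = Y e i
  XY_self : ∀ x i, i < E.vw x → ∑ e ∈ E.out x, X e i * Y e i = P x
  XY_ne : ∀ x i j, i < E.vw x → j < E.vw x → i ≠ j → ∑ e ∈ E.out x, X e i * Y e j = 0
  YX_self : ∀ e, ∑ i ∈ Finset.range (E.vw (E.s e)), Y e i * X e i = P (E.r e)
  YX_ne : ∀ e f, E.s f = E.s e → e ≠ f →
    ∑ i ∈ Finset.range (E.vw (E.s e)), Y e i * X f i = 0

variable {E K}

theorem edgeElt_fin (e : E.Edge) (i : Fin (E.w e)) :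
    E.edgeElt K e i = letter K (.edge e i) := by simp [edgeElt]

theorem ghostElt_fin (e : E.Edge) (i : Fin (E.w e)) :
    E.ghostElt K e i = letter K (.ghost e i) := by simp [ghostElt]

theorem family_wlpa : E.Family (E.wlpaVertex K) (E.ed K) (E.gh K) where
  X_zero e i h := by rw [ed, edgeElt, dif_neg (by omega), map_zero]
  Y_zero e i h := by rw [gh, ghostElt, dif_neg (by omega), map_zero]
  P_self x := by
    simp only [wlpaVertex, ← map_mul]; exact RelQuot.mk_eq (.vertex_mul_self x)
  P_ne x y h := by
    simp only [wlpaVertex, ← map_mul]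
    rw [RelQuot.mk_eq (.vertex_mul_ne x y h), map_zero]
  PX e i h := by
    simp only [wlpaVertex, ed, ← map_mul, edgeElt_fin e ⟨i, h⟩]
    exact RelQuot.mk_eq (by simpa [edgeElt, h] using Rel.source_mul_edge e ⟨i, h⟩)
  XP e i h := by
    simp only [wlpaVertex, ed, ← map_mul]
    exact RelQuot.mk_eq (by simpa [edgeElt, h] using Rel.edge_mul_range e ⟨i, h⟩)
  PY e i h := by
    simp only [wlpaVertex, gh, ← map_mul]
    exact RelQuot.mk_eq (by simpa [ghostElt, h] using Rel.range_mul_ghost e ⟨i, h⟩)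
  YP e i h := by
    simp only [wlpaVertex, gh, ← map_mul]
    exact RelQuot.mk_eq (by simpa [ghostElt, h] using Rel.ghost_mul_source e ⟨i, h⟩)
  XY_self x i hi := by
    simp only [wlpaVertex, ed, gh, ← map_mul, ← map_sum]
    exact RelQuot.mk_eq (.sum_edge_mul_ghost_self x i hi)
  XY_ne x i j hi hj h := by
    simp only [ed, gh, ← map_mul, ← map_sum]
    rw [RelQuot.mk_eq (.sum_edge_mul_ghost_ne x i j hi hj h), map_zero]
  YX_self e := by
    simp only [wlpaVertex, ed, gh, ← map_mul, ← map_sum]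
    exact RelQuot.mk_eq (.sum_ghost_mul_edge_self _ e rfl)
  YX_ne e f hf h := by
    simp only [ed, gh, ← map_mul, ← map_sum]
    rw [RelQuot.mk_eq (.sum_ghost_mul_edge_ne _ e f rfl hf h), map_zero]

section Lift

variable {B : Type*} [NonUnitalRing B] [Module K B] [IsScalarTower K B B] [SMulCommClass K B B]
  {P : E.V → B} {X Y : E.Edge → ℕ → B}

/-- The values of a family on the letters. -/
def letterVal (P : E.V → B) (X Y : E.Edge → ℕ → B) : E.Gen → B
  | .vertex x => P x
  | .edge e i => X e i
  | .ghost e i => Y e i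

theorem lift_edgeElt (h : E.Family P X Y) (e : E.Edge) (i : ℕ) :
    FreeAlg.lift (letterVal P X Y) (E.edgeElt K e i) = X e i := by
  by_cases hi : i < E.w e
  · rw [edgeElt, dif_pos hi, FreeAlg.lift_letter]; rfl
  · rw [edgeElt, dif_neg hi, map_zero, h.X_zero e i (by omega)]

theorem lift_ghostElt (h : E.Family P X Y) (e : E.Edge) (i : ℕ) :
    FreeAlg.lift (letterVal P X Y) (E.ghostElt K e i) = Y e i := by
  by_cases hi : i < E.w e
  · rw [ghostElt, dif_pos hi, FreeAlg.lift_letter]; rfl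
  · rw [ghostElt, dif_neg hi, map_zero, h.Y_zero e i (by omega)]

/-- The universal property of `L_K(E, w)`. -/
noncomputable def lift (h : E.Family P X Y) : E.wLPA K →ₙₐ[K] B :=
  RelQuot.lift (E.Rel K) (FreeAlg.lift (letterVal P X Y)) (by
    intro a b hab
    cases hab <;> simp only [map_mul, map_sum, map_zero, FreeAlg.lift_letter, lift_edgeElt h,
      lift_ghostElt h, letterVal]
    case vertex_mul_self x => exact h.P_self x
    case vertex_mul_ne x y hxy => exact h.P_ne x y hxy
    case source_mul_edge e i => exact h.PX e i i.2
    case edge_mul_range e i => exact h.XP e i i.2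
    case range_mul_ghost e i => exact h.PY e i i.2
    case ghost_mul_source e i => exact h.YP e i i.2
    case sum_edge_mul_ghost_self x i hi => exact h.XY_self x i hi
    case sum_edge_mul_ghost_ne x i j hi hj hij => exact h.XY_ne x i j hi hj hij
    case sum_ghost_mul_edge_self x e he => subst he; exact h.YX_self e
    case sum_ghost_mul_edge_ne x e f he hf hef => subst he; exact h.YX_ne e f hf hef)

theorem lift_vertex (h : E.Family P X Y) (x : E.V) : lift h (E.wlpaVertex K x) = P x := by
  rw [lift, wlpaVertex, RelQuot.lift_mk, FreeAlg.lift_letter]; rfl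

theorem lift_ed (h : E.Family P X Y) (e : E.Edge) (i : ℕ) : lift h (E.ed K e i) = X e i := by
  rw [lift, ed, RelQuot.lift_mk, lift_edgeElt h]

theorem lift_gh (h : E.Family P X Y) (e : E.Edge) (i : ℕ) : lift h (E.gh K e i) = Y e i := by
  rw [lift, gh, RelQuot.lift_mk, lift_ghostElt h]

end Lift

theorem hom_ext {C : Type*} [NonUnitalRing C] [Module K C] {g h : E.wLPA K →ₙₐ[K] C}
    (hP : ∀ x, g (E.wlpaVertex K x) = h (E.wlpaVertex K x))
    (hX : ∀ e i, i < E.w e → g (E.ed K e i) = h (E.ed K e i))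
    (hY : ∀ e i, i < E.w e → g (E.gh K e i) = h (E.gh K e i)) : g = h := by
  apply RelQuot.hom_ext_letter
  rintro (x | ⟨e, i⟩ | ⟨e, i⟩)
  · exact hP x
  · simpa only [ed, edgeElt_fin] using hX e i i.2
  · simpa only [gh, ghostElt_fin] using hY e i i.2

/-- A subspace of `L_K(E, w)` that is closed under left multiplication by vertices, edges and ghost
edges is a left ideal. -/
theorem mul_mem_of_gen (N : Submodule K (E.wLPA K))
    (hP : ∀ x, ∀ n ∈ N, E.wlpaVertex K x * n ∈ N)
    (hX : ∀ e i, i < E.w e → ∀ n ∈ N, E.ed K e i * n ∈ N)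
    (hY : ∀ e i, i < E.w e → ∀ n ∈ N, E.gh K e i * n ∈ N) (a : E.wLPA K) {n : E.wLPA K}
    (hn : n ∈ N) : a * n ∈ N := by
  refine RelQuot.mul_mem_of_letter N ?_ a hn
  rintro (x | ⟨e, i⟩ | ⟨e, i⟩) n hn
  · exact hP x n hn
  · simpa only [ed, edgeElt_fin] using hX e i i.2 n hn
  · simpa only [gh, ghostElt_fin] using hY e i i.2 n hn

/-! ### Degrees -/

theorem vertex_mem_component (x : E.V) : E.wlpaVertex K x ∈ E.component K 0 :=
  Submodule.subset_span ⟨FreeSemigroup.of (.vertex x), by simp [wordDeg, genDeg], rfl⟩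

theorem ed_mem_component (e : E.Edge) (i : ℕ) :
    E.ed K e i ∈ E.component K (Finsupp.single i 1) := by
  by_cases hi : i < E.w e
  · refine Submodule.subset_span ⟨FreeSemigroup.of (.edge e ⟨i, hi⟩), by simp [wordDeg, genDeg], ?_⟩
    rw [ed, edgeElt, dif_pos hi]; rfl
  · rw [family_wlpa.X_zero e i (by omega)]; exact zero_mem _

theorem gh_mem_component (e : E.Edge) (i : ℕ) :
    E.gh K e i ∈ E.component K (-Finsupp.single i 1) := by
  by_cases hi : i < E.w e
  · refine Submodule.subset_span ⟨FreeSemigroup.of (.ghost e ⟨i, hi⟩), by simp [wordDeg, genDeg], ?_⟩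
    rw [gh, ghostElt, dif_pos hi]; rfl
  · rw [family_wlpa.Y_zero e i (by omega)]; exact zero_mem _

theorem mul_mem_component {a b : E.wLPA K} {c d : ℕ →₀ ℤ} (ha : a ∈ E.component K c)
    (hb : b ∈ E.component K d) : a * b ∈ E.component K (c + d) := by
  induction ha using Submodule.span_induction with
  | zero => rw [zero_mul]; exact zero_mem _
  | add x y _ _ hx hy => rw [add_mul]; exact add_mem hx hy
  | smul k x _ hx => rw [smul_mul_assoc]; exact Submodule.smul_mem _ k hx
  | mem x hx =>
    induction hb using Submodule.span_induction with
    | zero => rw [mul_zero]; exact zero_mem _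
    | add x y _ _ hx hy => rw [mul_add]; exact add_mem hx hy
    | smul k x _ hx => rw [mul_smul_comm]; exact Submodule.smul_mem _ k hx
    | mem y hy =>
      obtain ⟨p, rfl, rfl⟩ := hx
      obtain ⟨q, rfl, rfl⟩ := hy
      refine Submodule.subset_span ⟨p * q, ?_, ?_⟩
      · simp [wordDeg]
      · rw [word_mul, map_mul]

end WeightedGraph

namespace DirectedGraph

/-! ### The universal property of Leavitt path algebras -/

variable (G : DirectedGraph.{u, v}) (K : Type*) [Field K]

/-- The image of an edge in `L_K(G)`. -/
noncomputable def lpaEdge (e : G.Edge) : G.LPA K := RelQuot.mk (G.Rel K) (letter K (.edge e))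

/-- The image of a ghost edge in `L_K(G)`. -/
noncomputable def lpaGhost (e : G.Edge) : G.LPA K := RelQuot.mk (G.Rel K) (letter K (.ghost e))

/-- Elements `P x`, `X e`, `Y e` of an algebra that satisfy the defining relations of
`L_K(G)` in the roles of `x`, `e`, `e*`. -/
structure Family {B : Type*} [NonUnitalRing B] (P : G.V → B) (X Y : G.Edge → B) : Prop where
  P_self : ∀ x, P x * P x = P x
  P_ne : ∀ x y, x ≠ y → P x * P y = 0
  PX : ∀ e, P (G.s e) * X e = X e
  XP : ∀ e, X e * P (G.r e) = X e
  PY : ∀ e, P (G.r e) * Y e = Y e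
  YP : ∀ e, Y e * P (G.s e) = Y e
  YX_self : ∀ e, Y e * X e = P (G.r e)
  YX_ne : ∀ e f, e ≠ f → Y e * X f = 0
  XY : ∀ x, ¬ G.IsSink x → ∀ hfin : {e : G.Edge | G.s e = x}.Finite,
    ∑ e ∈ hfin.toFinset, X e * Y e = P x

variable {G K}

theorem family_lpa : G.Family (G.lpaVertex K) (G.lpaEdge K) (G.lpaGhost K) where
  P_self x := by
    simp only [lpaVertex, ← map_mul]; exact RelQuot.mk_eq (.vertex_mul_self x)
  P_ne x y h := by
    simp only [lpaVertex, ← map_mul]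
    rw [RelQuot.mk_eq (.vertex_mul_ne x y h), map_zero]
  PX e := by
    simp only [lpaVertex, lpaEdge, ← map_mul]; exact RelQuot.mk_eq (.source_mul_edge e)
  XP e := by
    simp only [lpaVertex, lpaEdge, ← map_mul]; exact RelQuot.mk_eq (.edge_mul_range e)
  PY e := by
    simp only [lpaVertex, lpaGhost, ← map_mul]; exact RelQuot.mk_eq (.range_mul_ghost e)
  YP e := by
    simp only [lpaVertex, lpaGhost, ← map_mul]; exact RelQuot.mk_eq (.ghost_mul_source e)
  YX_self e := by
    simp only [lpaVertex, lpaGhost, lpaEdge, ← map_mul]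
    exact RelQuot.mk_eq (.ghost_mul_edge_self e)
  YX_ne e f h := by
    simp only [lpaGhost, lpaEdge, ← map_mul]
    rw [RelQuot.mk_eq (.ghost_mul_edge_ne e f h), map_zero]
  XY x hx hfin := by
    simp only [lpaVertex, lpaGhost, lpaEdge, ← map_mul, ← map_sum]
    exact RelQuot.mk_eq (.sum_edge_mul_ghost x hx hfin)

section Lift

variable {B : Type*} [NonUnitalRing B] [Module K B] [IsScalarTower K B B] [SMulCommClass K B B]
  {P : G.V → B} {X Y : G.Edge → B}

/-- The values of a family on the letters. -/
def letterVal (P : G.V → B) (X Y : G.Edge → B) : G.Gen → B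
  | .vertex x => P x
  | .edge e => X e
  | .ghost e => Y e

/-- The universal property of `L_K(G)`. -/
noncomputable def lift (h : G.Family P X Y) : G.LPA K →ₙₐ[K] B :=
  RelQuot.lift (G.Rel K) (FreeAlg.lift (letterVal P X Y)) (by
    intro a b hab
    cases hab <;> simp only [map_mul, map_sum, map_zero, FreeAlg.lift_letter, letterVal]
    case vertex_mul_self x => exact h.P_self x
    case vertex_mul_ne x y hxy => exact h.P_ne x y hxy
    case source_mul_edge e => exact h.PX e
    case edge_mul_range e => exact h.XP e
    case range_mul_ghost e => exact h.PY e
    case ghost_mul_source e => exact h.YP e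
    case ghost_mul_edge_self e => exact h.YX_self e
    case ghost_mul_edge_ne e f hef => exact h.YX_ne e f hef
    case sum_edge_mul_ghost x hx hfin => exact h.XY x hx hfin)

theorem lift_vertex (h : G.Family P X Y) (x : G.V) : lift h (G.lpaVertex K x) = P x := by
  rw [lift, lpaVertex, RelQuot.lift_mk, FreeAlg.lift_letter]; rfl

theorem lift_edge (h : G.Family P X Y) (e : G.Edge) : lift h (G.lpaEdge K e) = X e := by
  rw [lift, lpaEdge, RelQuot.lift_mk, FreeAlg.lift_letter]; rfl

theorem lift_ghost (h : G.Family P X Y) (e : G.Edge) : lift h (G.lpaGhost K e) = Y e := by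
  rw [lift, lpaGhost, RelQuot.lift_mk, FreeAlg.lift_letter]; rfl

end Lift

theorem hom_ext {C : Type*} [NonUnitalRing C] [Module K C] {g h : G.LPA K →ₙₐ[K] C}
    (hP : ∀ x, g (G.lpaVertex K x) = h (G.lpaVertex K x))
    (hX : ∀ e, g (G.lpaEdge K e) = h (G.lpaEdge K e))
    (hY : ∀ e, g (G.lpaGhost K e) = h (G.lpaGhost K e)) : g = h := by
  apply RelQuot.hom_ext_letter
  rintro (x | e | e)
  · exact hP x
  · exact hX e
  · exact hY e

end DirectedGraph

end WLPA

namespace WLPA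
namespace WeightedGraph

/-! ### Normal words are linearly independent -/

/-- Words in the double graph of `E`, written from left to right, together with the vertex in which
they end. Composability of the letters and the bounds on the indices are imposed by
`NWord.Legal`. -/
inductive NWord (E : WeightedGraph.{u, v}) where
  | base (x : E.V)
  | real (e : E.Edge) (i : ℕ) (W : NWord E)
  | ghost (e : E.Edge) (i : ℕ) (W : NWord E)

/-- A choice of one edge of maximal weight at each vertex that is not a sink. -/
structure IsSpecial (E : WeightedGraph.{u, v}) (Sp : E.Edge → Prop) : Prop where
  uniq : ∀ e f, Sp e → Sp f → E.s e = E.s f → e = f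
  weight : ∀ e, Sp e → E.w e = E.vw (E.s e)
  exist : ∀ e, ∃ f, Sp f ∧ E.s f = E.s e

variable {E : WeightedGraph.{u, v}}

namespace NWord

/-- The vertex in which a word starts. -/
def start : E.NWord → E.V
  | base x => x
  | real e _ _ => E.s e
  | ghost e _ _ => E.r e

/-- The vertex in which a word ends. -/
def target : E.NWord → E.V
  | base x => x
  | real _ _ W => W.target
  | ghost _ _ W => W.target

/-- The number of letters. -/
def length : E.NWord → ℕ
  | base _ => 0
  | real _ _ W => W.length + 1
  | ghost _ _ W => W.length + 1

/-- The degree of a word. -/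
noncomputable def deg : E.NWord → (ℕ →₀ ℤ)
  | base _ => 0
  | real _ i W => Finsupp.single i 1 + W.deg
  | ghost _ i W => -Finsupp.single i 1 + W.deg

/-- The first letter is some `e_j*`. -/
def HeadGh (e : E.Edge) : E.NWord → Prop
  | ghost f _ _ => f = e
  | _ => False

/-- The first letter is some `f_1`. -/
def HeadEd : E.NWord → Prop
  | real _ 0 _ => True
  | _ => False

/-- The normal words: composable words without subwords `e_i e_j*` (`e` special) and
`e_1* f_1`. -/
def Legal (Sp : E.Edge → Prop) : E.NWord → Prop
  | base _ => True
  | real e i W => i < E.w e ∧ W.start = E.r e ∧ ¬ (Sp e ∧ W.HeadGh e) ∧ W.Legal Sp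
  | ghost e i W => i < E.w e ∧ W.start = E.s e ∧ ¬ (i = 0 ∧ W.HeadEd) ∧ W.Legal Sp

variable (K : Type*) [Field K]

/-- The element of `L_K(E, w)` given by a word. -/
noncomputable def elt : E.NWord → E.wLPA K
  | base x => E.wlpaVertex K x
  | real e i W => E.ed K e i * W.elt
  | ghost e i W => E.gh K e i * W.elt

variable {K}

theorem elt_mem_component (W : E.NWord) : W.elt K ∈ E.component K W.deg := by
  induction W with
  | base x => exact vertex_mem_component x
  | real e i W ih => exact mul_mem_component (ed_mem_component e i) ih
  | ghost e i W ih => exact mul_mem_component (gh_mem_component e i) ih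

theorem elt_mem_of_deg {W : E.NWord} {d : ℕ →₀ ℤ} (h : W.deg = d) :
    W.elt K ∈ E.component K d :=
  h ▸ elt_mem_component W

end NWord

section NormalForm

open NWord

variable (K : Type*) [Field K] (Sp : E.Edge → Prop)

/-- The vector space with basis the normal words. -/
abbrev NMod : Type _ := {W : E.NWord // W.Legal Sp} →₀ K

open Classical in
/-- The basis vector given by a normal word; zero for words that are not normal. -/
noncomputable def br (W : E.NWord) : NMod K Sp :=
  if h : W.Legal Sp then Finsupp.single ⟨W, h⟩ 1 else 0

variable {Sp}

theorem br_of_not {W : E.NWord} (h : ¬ W.Legal Sp) : br K Sp W = 0 := dif_neg h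

variable (Sp)

open Classical in
/-- Left multiplication of a normal word by `e_{i+1}`. If the word begins with `e_{j+1}*` and `e` is
special, the product is rewritten by `∑ g_{i+1} g_{j+1}* = δ_{ij} s(e)`; one step suffices, as the
words obtained are normal or contain a letter whose index exceeds the weight, and then `br` is
zero. -/
noncomputable def edAct (e : E.Edge) (i : ℕ) : E.NWord → NMod K Sp
  | base x => br K Sp (real e i (base x))
  | real f j W => br K Sp (real e i (real f j W))
  | ghost f j W => if f = e ∧ Sp e ∧ i < E.w e then
      (if i = j then br K Sp W else 0) -
        ∑ g ∈ (E.out (E.s e)).erase e, br K Sp (real g i (ghost g j W))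
      else br K Sp (real e i (ghost f j W))

open Classical in
/-- Left multiplication of a normal word by `e_{i+1}*`. A subword `e_1* f_1` is rewritten by
`∑ e_k* f_k = δ_{ef} r(e)`, in one step as in `edAct`. -/
noncomputable def ghAct (e : E.Edge) (i : ℕ) : E.NWord → NMod K Sp
  | base x => br K Sp (ghost e i (base x))
  | ghost f j W => br K Sp (ghost e i (ghost f j W))
  | real f (j + 1) W => br K Sp (ghost e i (real f (j + 1) W))
  | real f 0 W => if i = 0 ∧ E.s f = E.s e then
      (if e = f then br K Sp W else 0) -
        ∑ k ∈ Finset.Ico 1 (E.vw (E.s e)), br K Sp (ghost e k (real f k W))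
      else br K Sp (ghost e i (real f 0 W))

/-- Left multiplication by `e_{i+1}` as a linear map. -/
noncomputable def edOp (e : E.Edge) (i : ℕ) : Module.End K (NMod K Sp) :=
  Finsupp.linearCombination K fun W => edAct K Sp e i W.1

/-- Left multiplication by `e_{i+1}*` as a linear map. -/
noncomputable def ghOp (e : E.Edge) (i : ℕ) : Module.End K (NMod K Sp) :=
  Finsupp.linearCombination K fun W => ghAct K Sp e i W.1

open Classical in
/-- Left multiplication by a vertex as a linear map. -/
noncomputable def vxOp (x : E.V) : Module.End K (NMod K Sp) :=
  Finsupp.linearCombination K fun W => if W.1.start = x then br K Sp W.1 else 0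

variable {Sp}

theorem edOp_br (e : E.Edge) (i : ℕ) {W : E.NWord} (h : W.Legal Sp) :
    edOp K Sp e i (br K Sp W) = edAct K Sp e i W := by
  simp [br, h, edOp]

theorem ghOp_br (e : E.Edge) (i : ℕ) {W : E.NWord} (h : W.Legal Sp) :
    ghOp K Sp e i (br K Sp W) = ghAct K Sp e i W := by
  simp [br, h, ghOp]

open Classical in
theorem vxOp_br (x : E.V) (W : E.NWord) :
    vxOp K Sp x (br K Sp W) = if W.start = x then br K Sp W else 0 := by
  by_cases h : W.Legal Sp
  · simp [br, h, vxOp]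
  · simp [br, h]

theorem edAct_eq {e : E.Edge} {W : E.NWord} (h : ¬ (Sp e ∧ W.HeadGh e)) (i : ℕ) :
    edAct K Sp e i W = br K Sp (real e i W) := by
  cases W with
  | base x => rfl
  | real f j W => rfl
  | ghost f j W => rw [edAct, if_neg]; exact fun h' => h ⟨h'.2.1, h'.1⟩

open Classical in
theorem edAct_gh {e : E.Edge} (h : Sp e) {i : ℕ} (hi : i < E.w e) (j : ℕ) (W : E.NWord) :
    edAct K Sp e i (ghost e j W) = (if i = j then br K Sp W else 0) -
        ∑ g ∈ (E.out (E.s e)).erase e, br K Sp (real g i (ghost g j W)) := by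
  rw [edAct, if_pos ⟨rfl, h, hi⟩]

theorem ghAct_eq {e : E.Edge} {i : ℕ} {W : E.NWord} (h : ¬ (i = 0 ∧ W.HeadEd)) :
    ghAct K Sp e i W = br K Sp (ghost e i W) := by
  match W with
  | base x => rfl
  | ghost f j W => rfl
  | real f (j + 1) W => rfl
  | real f 0 W => rw [ghAct, if_neg]; exact fun h' => h ⟨h'.1, trivial⟩

open Classical in
theorem ghAct_ed {e f : E.Edge} (h : E.s f = E.s e) (W : E.NWord) :
    ghAct K Sp e 0 (real f 0 W) = (if e = f then br K Sp W else 0) -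
        ∑ k ∈ Finset.Ico 1 (E.vw (E.s e)), br K Sp (ghost e k (real f k W)) := by
  rw [ghAct, if_pos ⟨rfl, h⟩]

theorem br_ed_of_le {e : E.Edge} {i : ℕ} (h : E.w e ≤ i) (W : E.NWord) :
    br K Sp (real e i W) = 0 := br_of_not K fun h' => absurd h'.1 (by omega)

theorem br_gh_of_le {e : E.Edge} {i : ℕ} (h : E.w e ≤ i) (W : E.NWord) :
    br K Sp (ghost e i W) = 0 := br_of_not K fun h' => absurd h'.1 (by omega)

theorem edAct_of_le {e : E.Edge} {i : ℕ} (h : E.w e ≤ i) (W : E.NWord) :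
    edAct K Sp e i W = 0 := by
  cases W with
  | base x => exact br_ed_of_le K h _
  | real f j W => exact br_ed_of_le K h _
  | ghost f j W => rw [edAct, if_neg (by omega)]; exact br_ed_of_le K h _

theorem ghAct_of_start_ne {e : E.Edge} {i : ℕ} {W : E.NWord} (h : W.start ≠ E.s e) :
    ghAct K Sp e i W = 0 := by
  match W with
  | base x => exact br_of_not K fun h' => h h'.2.1
  | ghost f j W => exact br_of_not K fun h' => h h'.2.1
  | real f (j + 1) W => exact br_of_not K fun h' => h h'.2.1
  | real f 0 W =>
    rw [ghAct, if_neg fun h' => h h'.2]; exact br_of_not K fun h' => h h'.2.1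

theorem edAct_of_start_ne {e : E.Edge} {i : ℕ} {W : E.NWord} (h : W.start ≠ E.r e) :
    edAct K Sp e i W = 0 := by
  rw [edAct_eq]
  · exact br_of_not K fun h' => h h'.2.1
  · rintro ⟨-, h'⟩
    cases W with
    | base x => exact h'
    | real f j W => exact h'
    | ghost f j W => exact h (congrArg E.r h')

theorem ghAct_of_le {e : E.Edge} {i : ℕ} (h : E.w e ≤ i) (W : E.NWord) :
    ghAct K Sp e i W = 0 := by
  have := E.w_pos e
  rw [ghAct_eq K (by omega)]
  exact br_gh_of_le K h _

variable (hSp : E.IsSpecial Sp)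

include hSp in
open Classical in
theorem sum_edOp_br_gh {x : E.V} {i j : ℕ} (hi : i < E.vw x) (hj : j < E.vw x) {W : E.NWord}
    (hW : W.Legal Sp) (hx : W.start = x) (hj0 : ¬ (j = 0 ∧ W.HeadEd)) :
    ∑ e ∈ E.out x, edOp K Sp e i (br K Sp (ghost e j W)) = if i = j then br K Sp W else 0 := by
  obtain ⟨e, he, rfl⟩ : ∃ e, Sp e ∧ E.s e = x := by
    obtain ⟨f, hf⟩ : (E.out x).Nonempty := by
      by_contra h
      rw [Finset.not_nonempty_iff_eq_empty] at h
      simp [vw, h] at hi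
    obtain ⟨e, he, hs⟩ := hSp.exist f
    exact ⟨e, he, hs.trans (mem_out.1 hf)⟩
  rw [← Finset.add_sum_erase _ _ (mem_out.2 rfl : e ∈ E.out (E.s e))]
  rw [← hSp.weight e he] at hi hj
  rw [edOp_br K e i (W := ghost e j W) ⟨hj, hx, hj0, hW⟩, edAct_gh K he hi, sub_add_eq_add_sub,
    sub_eq_iff_eq_add, add_right_inj]
  refine Finset.sum_congr rfl fun f hf => ?_
  rw [Finset.mem_erase, mem_out] at hf
  by_cases hjf : j < E.w f
  · rw [edOp_br K f i (W := ghost f j W) ⟨hjf, hx.trans hf.2.symm, hj0, hW⟩, edAct_eq]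
    exact fun h => hf.1 (hSp.uniq f e h.1 he hf.2)
  · rw [br_gh_of_le K (by omega), map_zero, br_of_not]
    exact fun h => hjf h.2.2.2.1

omit hSp in
open Classical in
theorem sum_ghOp_br_ed {e f : E.Edge} (hef : E.s f = E.s e) {W : E.NWord}
    (hW : W.Legal Sp) (hx : W.start = E.r f) (hf : ¬ (Sp f ∧ W.HeadGh f)) :
    ∑ i ∈ Finset.range (E.vw (E.s e)), ghOp K Sp e i (br K Sp (real f i W)) =
      if e = f then br K Sp W else 0 := by
  have hpos : 0 < E.vw (E.s e) := (E.w_pos e).trans (w_le_vw rfl)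
  rw [Finset.range_eq_Ico, Finset.sum_eq_sum_Ico_succ_bot hpos,
    ghOp_br K e 0 (W := real f 0 W) ⟨E.w_pos f, hx, hf, hW⟩, ghAct_ed K hef, sub_add_eq_add_sub,
    sub_eq_iff_eq_add, add_right_inj]
  refine Finset.sum_congr rfl fun k hk => ?_
  rw [Finset.mem_Ico] at hk
  by_cases hkf : k < E.w f
  · rw [ghOp_br K e k (W := real f k W) ⟨hkf, hx, hf, hW⟩, ghAct_eq K (by omega)]
  · rw [br_ed_of_le K (by omega), map_zero, br_of_not]
    exact fun h => hkf h.2.2.2.1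

theorem headEd_iff {W : E.NWord} : W.HeadEd ↔ ∃ f W', W = real f 0 W' := by
  match W with
  | base x => simp [HeadEd]
  | ghost f j W => simp [HeadEd]
  | real f (j + 1) W => simp [HeadEd]
  | real f 0 W => simp [HeadEd]

theorem headGh_iff {e : E.Edge} {W : E.NWord} : W.HeadGh e ↔ ∃ j W', W = ghost e j W' := by
  cases W <;> simp [HeadGh]

include hSp in
open Classical in
/-- The operators satisfy the relation `∑ e_i e_j* = δ_{ij} x`. If the word begins with `g_1` and
`j = 1`, the products `e_1* g_1` have to be reduced first, and the sums over `e` are then computed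
word by word. -/
theorem sum_edOp_ghAct {x : E.V} {i j : ℕ} (hi : i < E.vw x) (hj : j < E.vw x) {W : E.NWord}
    (hW : W.Legal Sp) :
    ∑ e ∈ E.out x, edOp K Sp e i (ghAct K Sp e j W) =
      if i = j ∧ W.start = x then br K Sp W else 0 := by
  by_cases hx : W.start = x
  swap
  · rw [if_neg fun h => hx h.2]
    refine Finset.sum_eq_zero fun e he => ?_
    rw [ghAct_of_start_ne K (by rwa [mem_out.1 he]), map_zero]
  by_cases hj0 : j = 0 ∧ W.HeadEd
  swap
  · simp only [hx, and_true, ← sum_edOp_br_gh K hSp hi hj hW hx hj0, ghAct_eq K hj0]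
  obtain ⟨rfl, hW0⟩ := hj0
  obtain ⟨g, W, rfl⟩ := headEd_iff.1 hW0
  obtain ⟨-, hs, hred, hleg⟩ := hW
  change E.s g = x at hx
  have h1 : ∀ e ∈ E.out x, edOp K Sp e i (ghAct K Sp e 0 (real g 0 W)) =
      (if e = g then br K Sp (real g i W) else 0) -
        ∑ k ∈ Finset.Ico 1 (E.vw x), edOp K Sp e i (br K Sp (ghost e k (real g k W))) := by
    intro e he
    rw [mem_out] at he
    rw [ghAct_ed K (hx.trans he.symm), map_sub, map_sum, he]
    split_ifs with h
    · subst h; rw [edOp_br K e i hleg, edAct_eq K hred]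
    · rw [map_zero]
  rw [Finset.sum_congr rfl h1, Finset.sum_sub_distrib, Finset.sum_comm,
    Finset.sum_ite_eq' (E.out x) g, if_pos (mem_out.2 hx)]
  have h2 : ∀ k ∈ Finset.Ico 1 (E.vw x),
      ∑ e ∈ E.out x, edOp K Sp e i (br K Sp (ghost e k (real g k W))) =
        if i = k then br K Sp (real g k W) else 0 := by
    intro k hk
    rw [Finset.mem_Ico] at hk
    by_cases hkg : k < E.w g
    · exact sum_edOp_br_gh K hSp hi hk.2 (W := real g k W) ⟨hkg, hs, hred, hleg⟩ hx (by omega)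
    · rw [br_ed_of_le K (by omega), ite_self]
      refine Finset.sum_eq_zero fun e _ => ?_
      rw [br_of_not K fun h : (ghost e k (real g k W)).Legal Sp => hkg h.2.2.2.1, map_zero]
  rw [Finset.sum_congr rfl h2, Finset.sum_ite_eq]
  rcases Nat.eq_zero_or_pos i with rfl | hi0
  · simp [start, hx]
  · rw [if_pos (Finset.mem_Ico.2 ⟨hi0, hi⟩), if_neg (by omega), sub_self]

include hSp in
open Classical in
/-- The operators satisfy the relation `∑ e_i* f_i = δ_{ef} r(e)`. -/
theorem sum_ghOp_edAct {e f : E.Edge} (hef : E.s f = E.s e) {W : E.NWord} (hW : W.Legal Sp) :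
    ∑ i ∈ Finset.range (E.vw (E.s e)), ghOp K Sp e i (edAct K Sp f i W) =
      if e = f ∧ W.start = E.r e then br K Sp W else 0 := by
  by_cases hx : W.start = E.r f
  swap
  · rw [if_neg]
    · exact Finset.sum_eq_zero fun i _ => by rw [edAct_of_start_ne K hx, map_zero]
    · rintro ⟨rfl, h⟩; exact hx h
  have hcond : (e = f ∧ W.start = E.r e) ↔ e = f :=
    ⟨fun h => h.1, fun h => ⟨h, by rw [hx, h]⟩⟩
  rw [if_congr hcond rfl rfl]
  by_cases hf : Sp f ∧ W.HeadGh f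
  swap
  · simp only [← sum_ghOp_br_ed K hef hW hx hf, edAct_eq K hf]
  obtain ⟨hf, hh⟩ := hf
  obtain ⟨j, W, rfl⟩ := headGh_iff.1 hh
  obtain ⟨hj, hs, hred, hleg⟩ := hW
  have hw : E.w f = E.vw (E.s e) := by rw [hSp.weight f hf, hef]
  have h1 : ∀ i ∈ Finset.range (E.vw (E.s e)), ghOp K Sp e i (edAct K Sp f i (ghost f j W)) =
      (if i = j then br K Sp (ghost e j W) else 0) -
        ∑ g ∈ (E.out (E.s e)).erase f, ghOp K Sp e i (br K Sp (real g i (ghost g j W))) := by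
    intro i hi
    rw [Finset.mem_range, ← hw] at hi
    rw [edAct_gh K hf hi, map_sub, map_sum, hef]
    split_ifs with h
    · subst h; rw [ghOp_br K e i hleg, ghAct_eq K hred]
    · rw [map_zero]
  rw [Finset.sum_congr rfl h1, Finset.sum_sub_distrib, Finset.sum_comm, Finset.sum_ite_eq',
    if_pos (Finset.mem_range.2 (by omega))]
  have h2 : ∀ g ∈ (E.out (E.s e)).erase f,
      ∑ i ∈ Finset.range (E.vw (E.s e)), ghOp K Sp e i (br K Sp (real g i (ghost g j W))) =
        if e = g then br K Sp (ghost g j W) else 0 := by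
    intro g hg
    rw [Finset.mem_erase, mem_out] at hg
    by_cases hjg : j < E.w g
    · refine sum_ghOp_br_ed K hg.2 (W := ghost g j W) ⟨hjg, ?_, hred, hleg⟩ rfl ?_
      · rw [hs, hef, hg.2]
      · exact fun h => hg.1 (hSp.uniq g f h.1 hf (hg.2.trans hef.symm))
    · rw [br_gh_of_le K (by omega), ite_self]
      refine Finset.sum_eq_zero fun i _ => ?_
      rw [br_of_not K fun h : (real g i (ghost g j W)).Legal Sp => hjg h.2.2.2.1, map_zero]
  rw [Finset.sum_congr rfl h2, Finset.sum_ite_eq]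
  by_cases hfe : e = f
  · subst hfe; simp
  · rw [if_pos (Finset.mem_erase.2 ⟨hfe, mem_out.2 rfl⟩), if_neg hfe, sub_self]

theorem nmod_ext {A B : Module.End K (NMod K Sp)}
    (h : ∀ W : E.NWord, W.Legal Sp → A (br K Sp W) = B (br K Sp W)) : A = B := by
  refine Finsupp.lhom_ext' fun W => LinearMap.ext_ring ?_
  have := h W.1 W.2
  rwa [br, dif_pos W.2] at this

theorem vxOp_edAct (e : E.Edge) (i : ℕ) {W : E.NWord} (hW : W.Legal Sp) :
    vxOp K Sp (E.s e) (edAct K Sp e i W) = edAct K Sp e i W := by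
  classical
  by_cases h : Sp e ∧ W.HeadGh e
  swap
  · rw [edAct_eq K h, vxOp_br]; exact if_pos rfl
  obtain ⟨he, h⟩ := h
  obtain ⟨j, W, rfl⟩ := headGh_iff.1 h
  by_cases hi : i < E.w e
  swap
  · rw [edAct_of_le K (by omega), map_zero]
  rw [edAct_gh K he hi, map_sub, map_sum]
  congr 1
  · split_ifs
    · rw [vxOp_br, if_pos hW.2.1]
    · rw [map_zero]
  · refine Finset.sum_congr rfl fun g hg => ?_
    rw [vxOp_br]; exact if_pos (mem_out.1 (Finset.mem_of_mem_erase hg))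

theorem vxOp_ghAct (e : E.Edge) (i : ℕ) {W : E.NWord} (hW : W.Legal Sp) :
    vxOp K Sp (E.r e) (ghAct K Sp e i W) = ghAct K Sp e i W := by
  classical
  by_cases h : i = 0 ∧ W.HeadEd
  swap
  · rw [ghAct_eq K h, vxOp_br]; exact if_pos rfl
  obtain ⟨rfl, h⟩ := h
  obtain ⟨f, W, rfl⟩ := headEd_iff.1 h
  by_cases hs : E.s f = E.s e
  swap
  · rw [ghAct_of_start_ne K (W := real f 0 W) hs, map_zero]
  rw [ghAct_ed K hs, map_sub, map_sum]
  congr 1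
  · split_ifs with h
    · subst h; rw [vxOp_br, if_pos hW.2.1]
    · rw [map_zero]
  · refine Finset.sum_congr rfl fun g hg => ?_
    rw [vxOp_br]; exact if_pos rfl

include hSp in
open Classical in
/-- The space with basis the normal words is a module over `L_K(E, w)`. -/
theorem family_nmod : E.Family (vxOp K Sp) (edOp K Sp) (ghOp K Sp) where
  X_zero e i h := nmod_ext K fun W hW => by rw [edOp_br K e i hW, edAct_of_le K h]; rfl
  Y_zero e i h := nmod_ext K fun W hW => by rw [ghOp_br K e i hW, ghAct_of_le K h]; rfl
  P_self x := nmod_ext K fun W hW => by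
    rw [Module.End.mul_apply, vxOp_br]
    split_ifs with h
    · rw [vxOp_br, if_pos h]
    · rw [map_zero]
  P_ne x y hxy := nmod_ext K fun W hW => by
    rw [Module.End.mul_apply, vxOp_br]
    split_ifs with h
    · rw [vxOp_br, if_neg (by rw [h]; exact hxy.symm)]; rfl
    · rw [map_zero]; rfl
  PX e i _ := nmod_ext K fun W hW => by
    rw [Module.End.mul_apply, edOp_br K e i hW, vxOp_edAct K e i hW]
  XP e i _ := nmod_ext K fun W hW => by
    rw [Module.End.mul_apply, vxOp_br]
    split_ifs with h
    · rfl
    · rw [map_zero, edOp_br K e i hW, edAct_of_start_ne K h]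
  PY e i _ := nmod_ext K fun W hW => by
    rw [Module.End.mul_apply, ghOp_br K e i hW, vxOp_ghAct K e i hW]
  YP e i _ := nmod_ext K fun W hW => by
    rw [Module.End.mul_apply, vxOp_br]
    split_ifs with h
    · rfl
    · rw [map_zero, ghOp_br K e i hW, ghAct_of_start_ne K h]
  XY_self x i hi := nmod_ext K fun W hW => by
    simp only [LinearMap.sum_apply, Module.End.mul_apply, ghOp_br K _ _ hW,
      sum_edOp_ghAct K hSp hi hi hW, vxOp_br]
    exact if_congr (and_iff_right trivial) rfl rfl
  XY_ne x i j hi hj hij := nmod_ext K fun W hW => by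
    simp only [LinearMap.sum_apply, Module.End.mul_apply, ghOp_br K _ _ hW,
      sum_edOp_ghAct K hSp hi hj hW, hij, false_and, if_false, LinearMap.zero_apply]
  YX_self e := nmod_ext K fun W hW => by
    simp only [LinearMap.sum_apply, Module.End.mul_apply, edOp_br K _ _ hW,
      sum_ghOp_edAct K hSp rfl hW, vxOp_br]
    exact if_congr (and_iff_right trivial) rfl rfl
  YX_ne e f hef hne := nmod_ext K fun W hW => by
    simp only [LinearMap.sum_apply, Module.End.mul_apply, edOp_br K _ _ hW,
      sum_ghOp_edAct K hSp hef hW, hne, false_and, if_false, LinearMap.zero_apply]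

open Classical in
/-- A normal word sends the vertex in which it ends to itself. -/
theorem lift_elt_br {W : E.NWord} (hW : W.Legal Sp) (x : E.V) :
    lift (family_nmod K hSp) (W.elt K) (br K Sp (base x)) =
      if W.target = x then br K Sp W else 0 := by
  induction W with
  | base y =>
    rw [elt, lift_vertex, vxOp_br]
    by_cases h : x = y
    · subst h; rfl
    · exact (if_neg h).trans (if_neg (Ne.symm h)).symm
  | real e i W ih =>
    rw [elt, map_mul, lift_ed, Module.End.mul_apply, ih hW.2.2.2]
    change _ = if W.target = x then _ else _
    split_ifs
    · rw [edOp_br K e i hW.2.2.2, edAct_eq K hW.2.2.1]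
    · rw [map_zero]
  | ghost e i W ih =>
    rw [elt, map_mul, lift_gh, Module.End.mul_apply, ih hW.2.2.2]
    change _ = if W.target = x then _ else _
    split_ifs
    · rw [ghOp_br K e i hW.2.2.2, ghAct_eq K hW.2.2.1]
    · rw [map_zero]

include hSp in
/-- Distinct normal words give linearly independent elements of `L_K(E, w)`. -/
theorem linearIndependent_elt :
    LinearIndependent K fun W : {W : E.NWord // W.Legal Sp} => W.1.elt K := by
  classical
  let ρ := lift (K := K) (family_nmod K hSp)
  let T : E.wLPA K →ₗ[K] ({W : E.NWord // W.Legal Sp} → K) :=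
    LinearMap.pi fun W => (Finsupp.lapply W) ∘ₗ
      (LinearMap.applyₗ (br K Sp (base W.1.target))) ∘ₗ (ρ : E.wLPA K →ₗ[K] Module.End K _)
  refine LinearIndependent.of_comp T ?_
  have : T ∘ (fun W : {W : E.NWord // W.Legal Sp} => W.1.elt K) = fun W => Pi.single W 1 := by
    funext W W'
    change (lift (family_nmod K hSp) (W.1.elt K) (br K Sp (base W'.1.target))) W' = _
    rw [lift_elt_br K hSp W.2, br, dif_pos W.2]
    by_cases h : W' = W
    · subst h; simp
    · rw [Pi.single_eq_of_ne h]
      split_ifs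
      · rw [Finsupp.single_eq_of_ne h]
      · rfl
  rw [this]
  exact Pi.linearIndependent_single_one _ _

include hSp in
/-- In a locally finite algebra there are only finitely many normal words of each degree. -/
theorem finite_legal_of_deg (hfin : E.LocallyFinite K) (d : ℕ →₀ ℤ) :
    {W : E.NWord | W.Legal Sp ∧ W.deg = d}.Finite := by
  have := hfin d
  let ι := {W : E.NWord // W.Legal Sp ∧ W.deg = d}
  have h1 : LinearIndependent K fun W : ι => W.1.elt K :=
    (linearIndependent_elt K hSp).comp (fun W : ι => ⟨W.1, W.2.1⟩) fun a b h => by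
      apply Subtype.ext; simpa using h
  have h2 : LinearIndependent K
      fun W : ι => (⟨W.1.elt K, elt_mem_of_deg W.2.2⟩ : E.component K d) :=
    LinearIndependent.of_comp (E.component K d).subtype h1
  have : Finite ι := h2.finite_of_isNoetherian
  exact Set.finite_coe_iff.1 this

include hSp in
/-- A sequence of normal words of fixed degree has bounded length. -/
theorem not_unbounded_legal (hfin : E.LocallyFinite K) (d : ℕ →₀ ℤ) (W : ℕ → E.NWord)
    (hW : ∀ n, (W n).Legal Sp) (hd : ∀ n, (W n).deg = d) (hl : ∀ n, n ≤ (W n).length) :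
    False := by
  obtain ⟨N, hN⟩ := ((finite_legal_of_deg K hSp hfin d).image NWord.length).bddAbove
  have := hN ⟨W (N + 1), ⟨hW _, hd _⟩, rfl⟩
  have := hl (N + 1)
  omega

end NormalForm

end WeightedGraph
end WLPA

namespace WLPA
namespace WeightedGraph

/-! ### Combinatorial consequences of local finiteness -/

open NWord

section Combinatorics

variable (E : WeightedGraph.{u, v})

/-- The steps along an unweighted edge in its direction, or along a weighted edge against its
direction. -/
inductive DStep : E.V → E.V → Prop
  | real (f : E.Edge) (hf : E.w f = 1) : DStep (E.s f) (E.r f)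
  | back (e : E.Edge) (he : 1 < E.w e) : DStep (E.r e) (E.s e)

/-- Reachability by the steps `DStep`. -/
abbrev DReach : E.V → E.V → Prop := Relation.ReflTransGen E.DStep

/-- The combinatorial condition that local finiteness imposes on a weighted graph whose weighted
edges are of type B and end in sinks. The last field says that the edges of weight one on closed
paths of steps `DStep` have no competitor at their source. -/
structure Controlled : Prop where
  finite_V : Finite E.V
  source_inj : ∀ e f, 1 < E.w e → 1 < E.w f → E.s e = E.s f → e = f
  range_inj : ∀ e f, 1 < E.w e → 1 < E.w f → E.r e = E.r f → e = f
  sink : ∀ e, 1 < E.w e → ∀ f, E.s f ≠ E.r e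
  no_exit : ∀ f g, E.w f = 1 → E.DReach (E.r f) (E.s f) → E.s g = E.s f → g = f

variable {E}

theorem w_eq_one_of_not {f : E.Edge} (h : ¬ 1 < E.w f) : E.w f = 1 := by
  have := E.w_pos f; omega

/-- Special edges can be chosen outside a set `S` if each edge in `S` has a competitor outside
`S` of at least the same weight. -/
theorem exists_isSpecial (S : Set E.Edge)
    (hS : ∀ f ∈ S, ∃ g, g ∉ S ∧ E.s g = E.s f ∧ E.w f ≤ E.w g) :
    ∃ Sp, E.IsSpecial Sp ∧ ∀ f ∈ S, ¬ Sp f := by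
  have H : ∀ x, (∃ e, E.s e = x) → ∃ m, m ∉ S ∧ E.s m = x ∧ E.w m = E.vw x := by
    rintro x ⟨e, he⟩
    obtain ⟨m, hm, hmw⟩ := Finset.exists_mem_eq_sup (E.out x) ⟨e, mem_out.2 he⟩ E.w
    rw [mem_out] at hm
    by_cases h : m ∈ S
    · obtain ⟨g, hg, hgs, hgw⟩ := hS m h
      exact ⟨g, hg, hgs.trans hm, le_antisymm (w_le_vw (hgs.trans hm)) (hmw.le.trans hgw)⟩
    · exact ⟨m, h, hm, hmw.symm⟩
  choose m hmS hms hmw using H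
  have hm : ∀ x y p q, x = y → m x p = m y q := by
    rintro x y p q rfl; rfl
  refine ⟨fun e => e = m (E.s e) ⟨e, rfl⟩, ⟨fun e f he hf h => ?_, fun e he => ?_, fun e => ?_⟩,
    fun f hf h => ?_⟩
  · exact he.trans ((hm _ _ _ _ h).trans hf.symm)
  · have := hmw (E.s e) ⟨e, rfl⟩
    rwa [← he] at this
  · exact ⟨m (E.s e) ⟨e, rfl⟩, hm _ _ _ _ (hms _ _).symm, hms _ _⟩
  · rw [h] at hf; exact hmS _ _ hf

variable {K : Type*} [Field K] {Sp : E.Edge → Prop}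

/-- An operation on normal words that keeps the degree cannot increase the length. -/
theorem false_of_iterate (hfin : E.LocallyFinite K) (hSp : E.IsSpecial Sp) (F : E.NWord → E.NWord)
    (x : E.V) (hF : ∀ W : E.NWord, W.Legal Sp → W.start = x →
      (F W).Legal Sp ∧ (F W).start = x ∧ (F W).deg = W.deg ∧ W.length < (F W).length) : False := by
  have key : ∀ n, (F^[n] (base x)).Legal Sp ∧ (F^[n] (base x)).start = x ∧
      (F^[n] (base x)).deg = 0 ∧ n ≤ (F^[n] (base x)).length := by
    intro n
    induction n with
    | zero => exact ⟨trivial, rfl, rfl, le_rfl⟩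
    | succ n ih =>
      rw [Function.iterate_succ_apply']
      obtain ⟨h1, h2, h3, h4⟩ := hF _ ih.1 ih.2.1
      exact ⟨h1, h2, h3.trans ih.2.2.1, by omega⟩
  exact not_unbounded_legal K hSp hfin 0 _ (fun n => (key n).1) (fun n => (key n).2.2.1)
    fun n => (key n).2.2.2

theorem finite_V_of_locallyFinite (hfin : E.LocallyFinite K) : Finite E.V := by
  obtain ⟨Sp, hSp, -⟩ := exists_isSpecial (E := E) ∅ (by simp)
  have h := finite_legal_of_deg K hSp hfin 0
  have : Set.range (base : E.V → E.NWord) ⊆ {W | W.Legal Sp ∧ W.deg = 0} := by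
    rintro _ ⟨x, rfl⟩; exact ⟨trivial, rfl⟩
  have := (h.subset this).to_subtype
  exact Finite.of_injective_finite_range (f := (base : E.V → E.NWord))
    fun x y h => by injection h

/-- Two weighted edges with the same source would give normal words of degree `0` of any length. -/
theorem source_inj_of_locallyFinite (hfin : E.LocallyFinite K) {e f : E.Edge} (he : 1 < E.w e)
    (hf : 1 < E.w f) (h : E.s e = E.s f) : e = f := by
  wlog hle : E.w f ≤ E.w e generalizing e f
  · exact (this hf he h.symm (by omega)).symm
  by_contra hne
  obtain ⟨Sp, hSp, hS⟩ := exists_isSpecial (E := E) {f} (by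
    rintro _ rfl; exact ⟨e, hne, h, hle⟩)
  have hf' : ¬ Sp f := hS f rfl
  -- The powers of `f_2 f_2*` are normal.
  refine false_of_iterate hfin hSp (fun W => real f 1 (ghost f 1 W)) (E.s f) fun W hW hs => ?_
  refine ⟨⟨hf, rfl, fun h => hf' h.1, hf, hs, by simp, hW⟩, rfl, by simp [deg], ?_⟩
  simp only [length]; omega

/-- The argument needs the edges `f`, `g` that exist by type B: they are chosen to be nonspecial, so
that `f_1 f_1*` and `g_1 g_1*` are normal. -/
theorem range_inj_of_locallyFinite (hfin : E.LocallyFinite K)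
    (hB : ∀ e, 1 < E.w e → ∃ f, f ≠ e ∧ E.s f = E.s e) {e h : E.Edge} (he : 1 < E.w e)
    (hh : 1 < E.w h) (hr : E.r e = E.r h) : e = h := by
  by_contra hne
  have hs : E.s e ≠ E.s h := fun hs => hne (source_inj_of_locallyFinite hfin he hh hs)
  obtain ⟨f, hfe, hfs⟩ := hB e he
  obtain ⟨g, hgh, hgs⟩ := hB h hh
  have hf1 : E.w f = 1 := w_eq_one_of_not fun hf =>
    hfe (source_inj_of_locallyFinite hfin hf he hfs)
  have hg1 : E.w g = 1 := w_eq_one_of_not fun hg =>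
    hgh (source_inj_of_locallyFinite hfin hg hh hgs)
  obtain ⟨Sp, hSp, hS⟩ := exists_isSpecial (E := E) {f, g} (by
    rintro _ (rfl | rfl)
    · refine ⟨e, ?_, hfs.symm, by omega⟩
      rintro (rfl | rfl)
      · exact hfe rfl
      · exact hs hgs
    · refine ⟨h, ?_, hgs.symm, by omega⟩
      rintro (rfl | rfl)
      · exact hs hfs.symm
      · exact hgh rfl)
  have hf' : ¬ Sp f := hS f (Or.inl rfl)
  have hg' : ¬ Sp g := hS g (Or.inr rfl)
  -- The powers of `f_1* e_2 h_2* g_1 g_1* h_2 e_2* f_1` are normal.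
  refine false_of_iterate hfin hSp (fun W => ghost f 0 (real e 1 (ghost h 1 (real g 0 (ghost g 0
    (real h 1 (ghost e 1 (real f 0 W)))))))) (E.r f) fun W hW hst => ?_
  refine ⟨⟨by omega, hfs.symm, by simp [HeadEd], he, hr.symm, ?_, hh, hgs, by simp, by omega, rfl,
    fun h => hg' h.1, by omega, hgs.symm, by simp [HeadEd], hh, hr, ?_, he, hfs, by simp, by omega,
    hst, fun h => hf' h.1, hW⟩, rfl, ?_, ?_⟩
  · exact fun h => hne h.2.symm
  · exact fun h => hne h.2
  · simp only [deg]; abel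
  · simp only [length]; omega

/-- A path of steps `DStep` from `y` to `z` acts on normal words by prolongation on the left, and so
does its inverse. The conditions on the first letter ensure that nothing cancels. -/
theorem DReach.exists_prolongation (Sp : E.Edge → Prop) {y z : E.V} (h : E.DReach y z) :
    ∃ (A B : E.NWord → E.NWord) (δ : ℕ →₀ ℤ),
      (∀ W : E.NWord, W.Legal Sp → W.start = z → (∀ g, W.HeadGh g → 1 < E.w g) →
        (A W).Legal Sp ∧ (A W).start = y ∧ (∀ g, (A W).HeadGh g → 1 < E.w g) ∧
          (A W).deg = δ + W.deg ∧ W.length ≤ (A W).length) ∧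
      (∀ W : E.NWord, W.Legal Sp → W.start = y →
        (¬ W.HeadEd ∧ ∀ g, W.HeadGh g → E.w g = 1) →
        (B W).Legal Sp ∧ (B W).start = z ∧ (¬ (B W).HeadEd ∧ ∀ g, (B W).HeadGh g → E.w g = 1) ∧
          (B W).deg = -δ + W.deg ∧ W.length ≤ (B W).length) := by
  induction h using Relation.ReflTransGen.head_induction_on with
  | refl =>
    exact ⟨id, id, 0, fun W h1 h2 h3 => ⟨h1, h2, h3, by simp, le_rfl⟩,
      fun W h1 h2 h3 => ⟨h1, h2, h3, by simp, le_rfl⟩⟩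
  | head hstep _ ih =>
    obtain ⟨A, B, δ, hA, hB⟩ := ih
    cases hstep with
    | real f hf =>
      refine ⟨fun W => real f 0 (A W), fun W => B (ghost f 0 W), Finsupp.single 0 1 + δ, ?_, ?_⟩
      · intro W h1 h2 h3
        obtain ⟨a1, a2, a3, a4, a5⟩ := hA W h1 h2 h3
        refine ⟨⟨by omega, a2, fun h => ?_, a1⟩, rfl, fun g h => h.elim, ?_, ?_⟩
        · have := a3 f h.2; omega
        · rw [deg, a4, add_assoc]
        · rw [length]; omega
      · intro W h1 h2 h3
        obtain ⟨a1, a2, a3, a4, a5⟩ := hB (ghost f 0 W) ⟨by omega, h2, fun h => h3.1 h.2, h1⟩ rfl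
          ⟨fun h => h.elim, fun g h => by change f = g at h; rw [← h, hf]⟩
        refine ⟨a1, a2, a3, ?_, ?_⟩
        · rw [a4, deg]; abel
        · rw [length] at a5
          exact (Nat.le_succ _).trans a5
    | back e he =>
      refine ⟨fun W => ghost e 1 (A W), fun W => B (real e 1 W), -Finsupp.single 1 1 + δ, ?_, ?_⟩
      · intro W h1 h2 h3
        obtain ⟨a1, a2, a3, a4, a5⟩ := hA W h1 h2 h3
        refine ⟨⟨he, a2, by simp, a1⟩, rfl, fun g h => ?_, ?_, ?_⟩
        · change e = g at h; rwa [← h]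
        · rw [deg, a4, add_assoc]
        · rw [length]; omega
      · intro W h1 h2 h3
        have hred : ¬ (Sp e ∧ W.HeadGh e) := fun h => by have := h3.2 e h.2; omega
        obtain ⟨a1, a2, a3, a4, a5⟩ := hB (real e 1 W) ⟨he, h2, hred, h1⟩ rfl
          ⟨fun h => h.elim, fun g h => h.elim⟩
        refine ⟨a1, a2, a3, ?_, ?_⟩
        · rw [a4, deg]; abel
        · rw [length] at a5
          exact (Nat.le_succ _).trans a5

/-- If there is a second edge at the source of `f`, then `f` can be chosen nonspecial, and the powers
of a closed path through `f` do not cancel against those of its inverse. -/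
theorem no_exit_of_locallyFinite (hfin : E.LocallyFinite K) {f g : E.Edge} (hf : E.w f = 1)
    (hcyc : E.DReach (E.r f) (E.s f)) (hs : E.s g = E.s f) : g = f := by
  by_contra hne
  obtain ⟨Sp, hSp, hS⟩ := exists_isSpecial (E := E) {f} (by
    rintro _ rfl; exact ⟨g, hne, hs, hf.trans_le (E.w_pos g)⟩)
  have hf' : ¬ Sp f := hS f rfl
  obtain ⟨A, B, δ, hA, hB⟩ := hcyc.exists_prolongation Sp
  -- The words `c^n (c*)^n`, where `c` is the closed path that ends with `f`, are normal.
  have h1 : ∀ n : ℕ, ∃ W : E.NWord, W.Legal Sp ∧ W.start = E.r f ∧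
      (¬ W.HeadEd ∧ ∀ g, W.HeadGh g → E.w g = 1) ∧
      W.deg = -(n • (δ + Finsupp.single 0 1)) ∧ n ≤ W.length := by
    intro n
    induction n with
    | zero => exact ⟨base (E.r f), trivial, rfl, ⟨fun h => h.elim, fun g h => h.elim⟩,
        by simp [deg], le_rfl⟩
    | succ n ih =>
      obtain ⟨W, w1, w2, w3, w4, w5⟩ := ih
      obtain ⟨b1, b2, b3, b4, b5⟩ := hB W w1 w2 w3
      refine ⟨ghost f 0 (B W), ⟨by omega, b2, fun h => b3.1 h.2, b1⟩, rfl,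
        ⟨fun h => h.elim, fun g h => by change f = g at h; rw [← h, hf]⟩, ?_, ?_⟩
      · rw [deg, b4, w4, add_smul, one_smul]; abel
      · rw [length]; omega
  have h2 : ∀ (n : ℕ) (U : E.NWord), U.Legal Sp → U.start = E.r f → ∃ W : E.NWord,
      W.Legal Sp ∧ W.start = E.r f ∧ W.deg = n • (δ + Finsupp.single 0 1) + U.deg ∧
        U.length ≤ W.length := by
    intro n U u1 u2
    induction n with
    | zero => exact ⟨U, u1, u2, by simp, le_rfl⟩
    | succ n ih =>
      obtain ⟨W, w1, w2, w3, w4⟩ := ih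
      obtain ⟨a1, a2, a3, a4, a5⟩ := hA (real f 0 W)
        ⟨by omega, w2, fun h => hf' h.1, w1⟩ rfl fun g h => h.elim
      refine ⟨A (real f 0 W), a1, a2, ?_, ?_⟩
      · rw [a4, deg, w3, add_smul, one_smul]; abel
      · rw [length] at a5; omega
  have h3 : ∀ n : ℕ, ∃ W : E.NWord, W.Legal Sp ∧ W.deg = 0 ∧ n ≤ W.length := by
    intro n
    obtain ⟨U, u1, u2, -, u4, u5⟩ := h1 n
    obtain ⟨W, w1, -, w3, w4⟩ := h2 n U u1 u2
    exact ⟨W, w1, by rw [w3, u4, add_neg_cancel], u5.trans w4⟩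
  choose W hW using h3
  exact not_unbounded_legal K hSp hfin 0 W (fun n => (hW n).1) (fun n => (hW n).2.1)
    fun n => (hW n).2.2

theorem controlled_of_locallyFinite (hfin : E.LocallyFinite K)
    (hB : ∀ e, 1 < E.w e → ∃ f, f ≠ e ∧ E.s f = E.s e)
    (hsink : ∀ e, 1 < E.w e → ∀ f, E.s f ≠ E.r e) : E.Controlled where
  finite_V := finite_V_of_locallyFinite hfin
  source_inj _ _ he hf h := source_inj_of_locallyFinite hfin he hf h
  range_inj _ _ he hf h := range_inj_of_locallyFinite hfin hB he hf h
  sink := hsink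
  no_exit _ _ hf hc hs := no_exit_of_locallyFinite hfin hf hc hs

end Combinatorics

/-! ### Cycles -/

section Controlled

variable {E : WeightedGraph.{u, v}}

/-- The vertices that lie on a closed path of steps `DStep` whose step from that vertex follows an
edge of weight one. Under `Controlled` every closed path has this form, see
`Controlled.isCyc_of_transGen`. -/
def IsCyc (E : WeightedGraph.{u, v}) (y : E.V) : Prop :=
  ∃ f, E.s f = y ∧ E.w f = 1 ∧ E.DReach (E.r f) y

theorem finite_edge [Finite E.V] : Finite E.Edge := by
  have h : (Set.univ : Set E.Edge) = ⋃ x : E.V, {e | E.s e = x} := by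
    ext e; simp
  rw [← Set.finite_univ_iff, h]
  exact Set.finite_iUnion E.rowFinite

namespace Controlled

variable (hE : E.Controlled)
include hE

theorem w_eq_one_of_isCyc {f : E.Edge} (h : E.IsCyc (E.s f)) :
    E.w f = 1 ∧ E.DReach (E.r f) (E.s f) := by
  obtain ⟨g, hgs, hgw, hg⟩ := h
  rw [← hgs] at hg
  obtain rfl := hE.no_exit g f hgw hg hgs.symm
  exact ⟨hgw, hg⟩

theorem eq_of_isCyc {f g : E.Edge} (h : E.IsCyc (E.s f)) (hs : E.s g = E.s f) : g = f :=
  hE.no_exit f g (hE.w_eq_one_of_isCyc h).1 (hE.w_eq_one_of_isCyc h).2 hs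

/-- A weighted edge does not lie on a closed path of steps `DStep`. -/
theorem not_dReach {e : E.Edge} (he : 1 < E.w e) : ¬ E.DReach (E.s e) (E.r e) := by
  intro h
  rcases Relation.ReflTransGen.cases_head h with h | ⟨y, hy, h⟩
  · exact hE.sink e he e h
  · generalize hx : E.s e = x at hy
    cases hy with
    | real f hf =>
      have := hE.no_exit f e hf (h.tail (hx ▸ .back e he)) hx
      rw [this] at he; omega
    | back e' he' => exact hE.sink e' he' e hx

theorem isCyc_of_transGen {y : E.V} (h : Relation.TransGen E.DStep y y) : E.IsCyc y := by
  obtain ⟨z, hz, h⟩ := Relation.TransGen.head'_iff.1 h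
  cases hz with
  | real f hf => exact ⟨f, rfl, hf, h⟩
  | back e he => exact absurd h (hE.not_dReach he)

theorem isCyc_range {f : E.Edge} (h : E.IsCyc (E.s f)) : E.IsCyc (E.r f) := by
  obtain ⟨hf, hr⟩ := hE.w_eq_one_of_isCyc h
  exact hE.isCyc_of_transGen (Relation.TransGen.tail' hr (.real f hf))

/-- Only one edge of a cycle ends in a given vertex. -/
theorem range_inj_of_isCyc {f g : E.Edge} (hf : E.IsCyc (E.s f)) (hg : E.IsCyc (E.s g))
    (h : E.r f = E.r g) : f = g := by
  have := hE.finite_V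
  let C := {y : E.V // E.IsCyc y}
  choose F hF using fun y : C => y.2
  have hFc : ∀ y, E.IsCyc (E.s (F y)) := fun y => by rw [(hF y).1]; exact y.2
  let σ : C → C := fun y => ⟨E.r (F y), hE.isCyc_range (hFc y)⟩
  have hσ : Function.Surjective σ := by
    rintro ⟨z, hz⟩
    obtain ⟨f, hfz, hfw, hr⟩ := id hz
    rcases Relation.ReflTransGen.cases_tail hr with h | ⟨y, hy, hyz⟩
    · refine ⟨⟨z, hz⟩, Subtype.ext ?_⟩
      have : F ⟨z, hz⟩ = f :=
        hE.eq_of_isCyc (by rwa [hfz]) ((hF ⟨z, hz⟩).1.trans hfz.symm)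
      change E.r (F ⟨z, hz⟩) = z
      rw [this, ← h]
    · cases hyz with
      | real f' hf' =>
        have hz' : E.IsCyc (E.s f') :=
          ⟨f', rfl, hf', (Relation.ReflTransGen.head (hfz ▸ .real f hfw) hy)⟩
        refine ⟨⟨E.s f', hz'⟩, Subtype.ext ?_⟩
        change E.r (F ⟨E.s f', hz'⟩) = E.r f'
        rw [hE.eq_of_isCyc hz' (hF ⟨E.s f', hz'⟩).1]
      | back e he =>
        have := (hE.w_eq_one_of_isCyc hz).1
        omega
  have hinj := Finite.injective_iff_surjective.2 hσ
  have hFf : F ⟨E.s f, hf⟩ = f := hE.eq_of_isCyc hf (hF ⟨E.s f, hf⟩).1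
  have hFg : F ⟨E.s g, hg⟩ = g := hE.eq_of_isCyc hg (hF ⟨E.s g, hg⟩).1
  have : (⟨E.s f, hf⟩ : C) = ⟨E.s g, hg⟩ := hinj (Subtype.ext (by
    change E.r (F _) = E.r (F _)
    rw [hFf, hFg, h]))
  rw [← hFf, ← hFg, this]

/-- Away from the cycles, the steps `DStep` go down in a well-founded order. -/
theorem wellFounded_dStep : WellFounded fun z y => E.DStep y z ∧ ¬ E.IsCyc y := by
  have := hE.finite_V
  let R : E.V → E.V → Prop := Relation.TransGen fun z y => E.DStep y z ∧ ¬ E.IsCyc y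
  have hR : ∀ y z, R z y → Relation.TransGen E.DStep y z := fun y z h => by
    induction h with
    | single h => exact .single h.1
    | tail _ h ih => exact .head h.1 ih
  have h1 : IsTrans E.V R := ⟨fun _ _ _ => Relation.TransGen.trans⟩
  have h2 : Std.Irrefl R := ⟨fun y h => by
    obtain ⟨z, -, hz⟩ := Relation.TransGen.tail'_iff.1 h
    exact hz.2 (hE.isCyc_of_transGen (hR y y h))⟩
  have hwf : WellFounded R := Finite.wellFounded_of_trans_of_irrefl R
  exact Subrelation.wf (r := R) (fun h => Relation.TransGen.single h) hwf

end Controlled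

end Controlled

end WeightedGraph
end WLPA

namespace WLPA
namespace WeightedGraph

/-! ### Relations in families -/

variable {E : WeightedGraph.{u, v}}

namespace Family

variable {B : Type*} [NonUnitalRing B] {P : E.V → B} {X Y : E.Edge → ℕ → B}
  (h : E.Family P X Y)
include h

theorem PX_all (e : E.Edge) (i : ℕ) : P (E.s e) * X e i = X e i := by
  by_cases hi : i < E.w e
  · exact h.PX e i hi
  · rw [h.X_zero e i (by omega), mul_zero]

theorem XP_all (e : E.Edge) (i : ℕ) : X e i * P (E.r e) = X e i := by
  by_cases hi : i < E.w e
  · exact h.XP e i hi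
  · rw [h.X_zero e i (by omega), zero_mul]

theorem PY_all (e : E.Edge) (i : ℕ) : P (E.r e) * Y e i = Y e i := by
  by_cases hi : i < E.w e
  · exact h.PY e i hi
  · rw [h.Y_zero e i (by omega), mul_zero]

theorem YP_all (e : E.Edge) (i : ℕ) : Y e i * P (E.s e) = Y e i := by
  by_cases hi : i < E.w e
  · exact h.YP e i hi
  · rw [h.Y_zero e i (by omega), zero_mul]

theorem X_mul_of_ne {e : E.Edge} {i : ℕ} {y : E.V} {a : B} (ha : P y * a = a) (hy : y ≠ E.r e) :
    X e i * a = 0 := by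
  rw [← ha, ← h.XP_all e i, mul_assoc, ← mul_assoc (P _), h.P_ne _ _ hy.symm, zero_mul, mul_zero]

theorem Y_mul_of_ne {e : E.Edge} {i : ℕ} {y : E.V} {a : B} (ha : P y * a = a) (hy : y ≠ E.s e) :
    Y e i * a = 0 := by
  rw [← ha, ← h.YP_all e i, mul_assoc, ← mul_assoc (P _), h.P_ne _ _ hy.symm, zero_mul, mul_zero]

theorem P_mul_of_ne {x y : E.V} {a : B} (ha : P y * a = a) (hy : y ≠ x) : P x * a = 0 := by
  rw [← ha, ← mul_assoc, h.P_ne _ _ hy.symm, zero_mul]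

theorem sum_XY_zero {e : E.Edge} : ∑ f ∈ E.out (E.s e), X f 0 * Y f 0 = P (E.s e) :=
  h.XY_self _ 0 ((E.w_pos e).trans (w_le_vw rfl))

theorem sum_YX (e : E.Edge) : ∑ i ∈ Finset.range (E.w e), Y e i * X e i = P (E.r e) := by
  rw [← h.YX_self e]
  refine Finset.sum_subset (Finset.range_subset_range.2 (w_le_vw rfl)) fun i _ hi => ?_
  rw [h.X_zero e i (by simpa using hi), mul_zero]

theorem YX_self_of_one {f : E.Edge} (hf : E.w f = 1) : Y f 0 * X f 0 = P (E.r f) := by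
  rw [← h.sum_YX f, hf, Finset.sum_range_one]

theorem YX_ne_zero {e f : E.Edge} (hs : E.s f = E.s e) (hne : e ≠ f)
    (hw : E.w e = 1 ∨ E.w f = 1) : Y e 0 * X f 0 = 0 := by
  rw [← h.YX_ne e f hs hne, Finset.sum_eq_single_of_mem 0
    (Finset.mem_range.2 ((E.w_pos e).trans (w_le_vw rfl)))]
  intro i _ hi
  rcases hw with hw | hw
  · rw [h.Y_zero e i (by omega), zero_mul]
  · rw [h.X_zero f i (by omega), mul_zero]

/-- If `e` is the only weighted edge at its source, then the relations that involve an index greater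
than one are relations between `e_i` and `e_j*`. -/
theorem XY_self_of_pos {e : E.Edge} (he : ∀ f, E.s f = E.s e → f ≠ e → E.w f = 1) {i : ℕ}
    (hi : i < E.w e) (hi0 : 1 ≤ i) : X e i * Y e i = P (E.s e) := by
  rw [← h.XY_self (E.s e) i (hi.trans_le (w_le_vw rfl)),
    Finset.sum_eq_single_of_mem e (mem_out.2 rfl)]
  intro f hf hne
  rw [h.X_zero f i (by rw [he f (mem_out.1 hf) hne]; exact hi0), zero_mul]

theorem XY_ne_of_pos {e : E.Edge} (he : ∀ f, E.s f = E.s e → f ≠ e → E.w f = 1) {i j : ℕ}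
    (hi : i < E.w e) (hj : j < E.w e) (hij : i ≠ j) : X e i * Y e j = 0 := by
  rw [← h.XY_ne (E.s e) i j (hi.trans_le (w_le_vw rfl)) (hj.trans_le (w_le_vw rfl)) hij,
    Finset.sum_eq_single_of_mem e (mem_out.2 rfl)]
  intro f hf hne
  have hw := he f (mem_out.1 hf) hne
  rcases Nat.eq_zero_or_pos i with rfl | hi0
  · rw [h.Y_zero f j (by omega), mul_zero]
  · rw [h.X_zero f i (by omega), zero_mul]

theorem XYX {e : E.Edge} (he : ∀ f, E.s f = E.s e → f ≠ e → E.w f = 1) {i : ℕ}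
    (hi : i < E.w e) : X e i * (Y e i * X e i) = X e i := by
  conv_rhs => rw [← h.XP_all e i, ← h.sum_YX e, Finset.mul_sum]
  rw [Finset.sum_eq_single_of_mem i (Finset.mem_range.2 hi)]
  intro j hj hij
  rw [← mul_assoc, h.XY_ne_of_pos he hi (Finset.mem_range.1 hj) hij.symm, zero_mul]

theorem YXY {e : E.Edge} (he : ∀ f, E.s f = E.s e → f ≠ e → E.w f = 1) {i : ℕ}
    (hi : i < E.w e) : Y e i * X e i * Y e i = Y e i := by
  conv_rhs => rw [← h.PY_all e i, ← h.sum_YX e, Finset.sum_mul]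
  rw [Finset.sum_eq_single_of_mem i (Finset.mem_range.2 hi)]
  intro j hj hij
  rw [mul_assoc, h.XY_ne_of_pos he (Finset.mem_range.1 hj) hi hij, mul_zero]

end Family

/-! ### A spanning set -/

section Spanning

variable (E) (K : Type*) [Field K]

/-- The products of unweighted edges and of ghosts `e_i*` (`i ≥ 2`, `e` weighted) along a path of
steps `DStep` that starts in a given vertex and is followed until it meets a cycle, a sink, or the
part of a weighted edge `e` that is governed by `e_1`. -/
inductive Pth : E.V → E.wLPA K → Prop
  | cyc (y : E.V) (hy : E.IsCyc y) : Pth y (E.wlpaVertex K y)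
  | sink (y : E.V) (hs : ∀ f, E.s f ≠ y) (hr : ∀ e, 1 < E.w e → E.r e ≠ y) :
      Pth y (E.wlpaVertex K y)
  | top (e : E.Edge) (he : 1 < E.w e) : Pth (E.r e) (E.gh K e 0 * E.ed K e 0)
  | out (e : E.Edge) (he : 1 < E.w e) : Pth (E.s e) (E.ed K e 0)
  | real (f : E.Edge) (hf : E.w f = 1) (hc : ¬ E.IsCyc (E.s f)) (p : E.wLPA K)
      (hp : Pth (E.r f) p) : Pth (E.s f) (E.ed K f 0 * p)
  | ghost (e : E.Edge) (he : 1 < E.w e) (i : ℕ) (hi : 1 ≤ i) (hie : i < E.w e) (p : E.wLPA K)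
      (hp : Pth (E.s e) p) : Pth (E.r e) (E.gh K e i * p)

/-- Paths of length `n` along the cycles. -/
inductive RealTail : ℕ → E.V → E.wLPA K → Prop
  | zero (y : E.V) : RealTail 0 y (E.wlpaVertex K y)
  | succ (n : ℕ) (f : E.Edge) (hf : E.IsCyc (E.s f)) (t : E.wLPA K)
      (ht : RealTail n (E.r f) t) : RealTail (n + 1) (E.s f) (E.ed K f 0 * t)

/-- Ghost paths of length `n` along the cycles. -/
inductive GhostTail : ℕ → E.V → E.wLPA K → Prop
  | zero (y : E.V) : GhostTail 0 y (E.wlpaVertex K y)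
  | succ (n : ℕ) (f : E.Edge) (hf : E.IsCyc (E.s f)) (t : E.wLPA K)
      (ht : GhostTail n (E.s f) t) : GhostTail (n + 1) (E.r f) (E.gh K f 0 * t)

/-- Paths along the cycles, ghost paths being counted with negative length. -/
def Tail (n : ℤ) (y : E.V) (t : E.wLPA K) : Prop :=
  ∃ m : ℕ, (n = m ∧ E.RealTail K m y t) ∨ (n = -m ∧ E.GhostTail K m y t)

variable {E K}

theorem Pth.start_mul {y : E.V} {p : E.wLPA K} (h : E.Pth K y p) : E.wlpaVertex K y * p = p := by
  have F := family_wlpa (E := E) (K := K)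
  cases h with
  | cyc _ hy => exact F.P_self _
  | sink _ hs hr => exact F.P_self _
  | top e he => rw [← mul_assoc, F.PY_all]
  | out e he => exact F.PX_all e 0
  | real f hf hc p hp => rw [← mul_assoc, F.PX_all]
  | ghost e he i hi hie p hp => rw [← mul_assoc, F.PY_all]

theorem Pth.exists_mul_end {y : E.V} {p : E.wLPA K} (h : E.Pth K y p) :
    ∃ z, p * E.wlpaVertex K z = p := by
  have F := family_wlpa (E := E) (K := K)
  induction h with
  | cyc y hy => exact ⟨y, F.P_self _⟩
  | sink y hs hr => exact ⟨y, F.P_self _⟩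
  | top e he => exact ⟨E.r e, by rw [mul_assoc, F.XP_all]⟩
  | out e he => exact ⟨E.r e, F.XP_all e 0⟩
  | real f hf hc p hp ih => obtain ⟨z, hz⟩ := ih; exact ⟨z, by rw [mul_assoc, hz]⟩
  | ghost e he i hi hie p hp ih => obtain ⟨z, hz⟩ := ih; exact ⟨z, by rw [mul_assoc, hz]⟩

theorem Tail.start_mul {n : ℤ} {y : E.V} {t : E.wLPA K} (h : E.Tail K n y t) :
    E.wlpaVertex K y * t = t := by
  have F := family_wlpa (E := E) (K := K)
  obtain ⟨m, ⟨-, h⟩ | ⟨-, h⟩⟩ := h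
  · cases h with
    | zero => exact F.P_self _
    | succ n f hf t ht => rw [← mul_assoc, F.PX_all]
  · cases h with
    | zero => exact F.P_self _
    | succ n f hf t ht => rw [← mul_assoc, F.PY_all]

theorem finite_tail [Finite E.V] (n : ℤ) : {t | ∃ y, E.Tail K n y t}.Finite := by
  have := finite_edge (E := E)
  have hR : ∀ m : ℕ, {t | ∃ y, E.RealTail K m y t}.Finite := by
    intro m
    induction m with
    | zero =>
      refine (Set.finite_range (E.wlpaVertex K)).subset ?_
      rintro t ⟨y, ht⟩
      cases ht; exact ⟨y, rfl⟩
    | succ m ih =>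
      refine (Set.finite_iUnion fun f : E.Edge => ih.image (E.ed K f 0 * ·)).subset ?_
      rintro _ ⟨y, ht⟩
      cases ht with
      | succ n f hf t ht => exact Set.mem_iUnion.2 ⟨f, t, ⟨_, ht⟩, rfl⟩
  have hG : ∀ m : ℕ, {t | ∃ y, E.GhostTail K m y t}.Finite := by
    intro m
    induction m with
    | zero =>
      refine (Set.finite_range (E.wlpaVertex K)).subset ?_
      rintro t ⟨y, ht⟩
      cases ht; exact ⟨y, rfl⟩
    | succ m ih =>
      refine (Set.finite_iUnion fun f : E.Edge => ih.image (E.gh K f 0 * ·)).subset ?_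
      rintro _ ⟨y, ht⟩
      cases ht with
      | succ n f hf t ht => exact Set.mem_iUnion.2 ⟨f, t, ⟨_, ht⟩, rfl⟩
  refine ((hR n.toNat).union (hG (-n).toNat)).subset ?_
  rintro t ⟨y, m, ⟨hm, h⟩ | ⟨hm, h⟩⟩
  · left; rw [hm, Int.toNat_natCast]; exact ⟨y, h⟩
  · right; rw [hm, neg_neg, Int.toNat_natCast]; exact ⟨y, h⟩

namespace Controlled

variable (hE : E.Controlled)
include hE

theorem w_eq_one_of_ne {e : E.Edge} (he : 1 < E.w e) (f : E.Edge) (hs : E.s f = E.s e)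
    (hne : f ≠ e) : E.w f = 1 :=
  w_eq_one_of_not fun hf => hne (hE.source_inj f e hf he hs)

theorem not_isCyc_range {e : E.Edge} (he : 1 < E.w e) : ¬ E.IsCyc (E.r e) := by
  rintro ⟨f, hf, -⟩
  exact hE.sink e he f hf

theorem finite_pth (y : E.V) : {p | E.Pth K y p}.Finite := by
  have := hE.finite_V
  have := finite_edge (E := E)
  induction y using hE.wellFounded_dStep.induction with
  | _ y ih =>
    have h1 : ∀ f : {f : E.Edge // E.s f = y ∧ E.w f = 1 ∧ ¬ E.IsCyc y},
        ((E.ed K f.1 0 * ·) '' {p | E.Pth K (E.r f.1) p}).Finite := fun f =>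
      (ih _ ⟨by have := DStep.real f.1 f.2.2.1; rwa [f.2.1] at this, f.2.2.2⟩).image _
    have h2 : ∀ e : {e : E.Edge // E.r e = y ∧ 1 < E.w e},
        (⋃ i : Fin (E.w e.1), (E.gh K e.1 i * ·) '' {p | E.Pth K (E.s e.1) p}).Finite := fun e =>
      Set.finite_iUnion fun i => (ih _ ⟨by
        have := DStep.back e.1 e.2.2; rwa [e.2.1] at this, by
        have := hE.not_isCyc_range e.2.2; rwa [e.2.1] at this⟩).image _
    refine ((Set.finite_singleton (E.wlpaVertex K y)).union
      ((Set.finite_range fun e => E.gh K e 0 * E.ed K e 0).union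
      ((Set.finite_range fun e => E.ed K e 0).union
      ((Set.finite_iUnion h1).union (Set.finite_iUnion h2))))).subset ?_
    intro p hp
    cases hp with
    | cyc _ hy => exact Or.inl rfl
    | sink _ hs hr => exact Or.inl rfl
    | top e he => exact Or.inr (Or.inl ⟨e, rfl⟩)
    | out e he => exact Or.inr (Or.inr (Or.inl ⟨e, rfl⟩))
    | real f hf hc p hp =>
      exact Or.inr (Or.inr (Or.inr (Or.inl (Set.mem_iUnion.2 ⟨⟨f, rfl, hf, hc⟩, p, hp, rfl⟩))))
    | ghost e he i hi hie p hp =>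
      exact Or.inr (Or.inr (Or.inr (Or.inr (Set.mem_iUnion.2 ⟨⟨e, rfl, he⟩,
        Set.mem_iUnion.2 ⟨⟨i, hie⟩, p, hp, rfl⟩⟩))))

/-- Left multiplication by an edge maps the elements `Pth` to such elements or to zero, except for
an edge of a cycle, which is to be absorbed by a factor `Tail`. -/
theorem ed_mul_pth {y : E.V} {p : E.wLPA K} (h : E.Pth K y p) {e : E.Edge} {i : ℕ}
    (hi : i < E.w e) : E.ed K e i * p = 0 ∨ (∃ z, E.Pth K z (E.ed K e i * p)) ∨
      (i = 0 ∧ IsCyc E (E.s e) ∧ p = E.wlpaVertex K (E.r e)) := by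
  have F := family_wlpa (E := E) (K := K)
  by_cases hy : y = E.r e
  swap
  · exact Or.inl (F.X_mul_of_ne h.start_mul hy)
  by_cases he : 1 < E.w e
  · cases h with
    | cyc _ hc => subst hy; exact absurd hc (hE.not_isCyc_range he)
    | sink _ hs hr => exact absurd hy.symm (hr e he)
    | top e' he' =>
      obtain rfl := hE.range_inj e' e he' he hy
      rcases Nat.eq_zero_or_pos i with rfl | hi0
      · rw [F.XYX (hE.w_eq_one_of_ne he) (E.w_pos _)]
        exact Or.inr (Or.inl ⟨_, .out e' he⟩)
      · left
        rw [← mul_assoc, F.XY_ne_of_pos (hE.w_eq_one_of_ne he) hi (by omega) (by omega), zero_mul]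
    | out e' he' => exact absurd hy (hE.sink e he e')
    | real f hf hc p hp => exact absurd hy (hE.sink e he f)
    | ghost e' he' j hj hje p hp =>
      obtain rfl := hE.range_inj e' e he' he hy
      by_cases hij : i = j
      · subst hij
        rw [← mul_assoc, F.XY_self_of_pos (hE.w_eq_one_of_ne he) hi hj, hp.start_mul]
        exact Or.inr (Or.inl ⟨_, hp⟩)
      · left
        rw [← mul_assoc, F.XY_ne_of_pos (hE.w_eq_one_of_ne he) hi hje hij, zero_mul]
  · have he1 := w_eq_one_of_not he
    obtain rfl : i = 0 := by omega
    subst hy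
    by_cases hc : E.IsCyc (E.s e)
    swap
    · exact Or.inr (Or.inl ⟨_, .real e he1 hc p h⟩)
    have hr : E.IsCyc (E.r e) := hE.isCyc_range hc
    refine Or.inr (Or.inr ⟨rfl, hc, ?_⟩)
    generalize E.r e = y at h hr
    cases h with
    | cyc _ hc => rfl
    | sink _ hs hr => rfl
    | top e' he' => exact absurd hr (hE.not_isCyc_range he')
    | out e' he' =>
      have := (hE.w_eq_one_of_isCyc hr).1
      omega
    | real f hf hc p hp => exact absurd hr hc
    | ghost e' he' j hj hje p hp => exact absurd hr (hE.not_isCyc_range he')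

theorem gh_mul_pth {y : E.V} {p : E.wLPA K} (h : E.Pth K y p) {e : E.Edge} {i : ℕ}
    (hi : i < E.w e) : E.gh K e i * p = 0 ∨ (∃ z, E.Pth K z (E.gh K e i * p)) ∨
      (i = 0 ∧ IsCyc E (E.s e) ∧ p = E.wlpaVertex K (E.s e)) := by
  have F := family_wlpa (E := E) (K := K)
  by_cases hy : y = E.s e
  swap
  · exact Or.inl (F.Y_mul_of_ne h.start_mul hy)
  cases h with
  | cyc _ hc =>
    subst hy
    have := (hE.w_eq_one_of_isCyc hc).1
    exact Or.inr (Or.inr ⟨by omega, hc, rfl⟩)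
  | sink _ hs hr => exact absurd hy.symm (hs e)
  | top e' he' => exact absurd hy.symm (hE.sink e' he' e)
  | out e' he' =>
    by_cases hee : e = e'
    · subst hee
      rcases Nat.eq_zero_or_pos i with rfl | hi0
      · exact Or.inr (Or.inl ⟨_, .top e he'⟩)
      · exact Or.inr (Or.inl ⟨_, .ghost e he' i hi0 hi _ (.out e he')⟩)
    · have he1 := hE.w_eq_one_of_ne he' e hy.symm hee
      obtain rfl : i = 0 := by omega
      exact Or.inl (F.YX_ne_zero hy hee (Or.inl he1))
  | real f hf hc p hp =>
    rcases Nat.eq_zero_or_pos i with rfl | hi0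
    · by_cases hef : e = f
      · subst hef
        rw [← mul_assoc, F.YX_self_of_one hf, hp.start_mul]
        exact Or.inr (Or.inl ⟨_, hp⟩)
      · left
        rw [← mul_assoc, F.YX_ne_zero hy hef (Or.inr hf), zero_mul]
    · exact Or.inr (Or.inl ⟨_, .ghost e (by omega) i hi0 hi _ (hy ▸ .real f hf hc p hp)⟩)
  | ghost e' he' j hj hje p hp => exact absurd hy.symm (hE.sink e' he' e)

theorem ed_mul_tail {e : E.Edge} (he : E.IsCyc (E.s e)) {n : ℤ} {z : E.V} {t : E.wLPA K}
    (ht : E.Tail K n z t) : E.ed K e 0 * t = 0 ∨ ∃ m, E.Tail K m (E.s e) (E.ed K e 0 * t) := by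
  have F := family_wlpa (E := E) (K := K)
  by_cases hz : z = E.r e
  swap
  · exact Or.inl (F.X_mul_of_ne ht.start_mul hz)
  subst hz
  right
  obtain ⟨m, ⟨-, h⟩ | ⟨-, h⟩⟩ := ht
  · exact ⟨_, m + 1, Or.inl ⟨rfl, .succ m e he t h⟩⟩
  · generalize hz : E.r e = z at h
    cases h with
    | zero => subst hz; exact ⟨_, 1, Or.inl ⟨rfl, .succ 0 e he _ (.zero _)⟩⟩
    | succ n f hf t h =>
      obtain rfl := hE.range_inj_of_isCyc he hf hz
      have : E.ed K e 0 * E.gh K e 0 = E.wlpaVertex K (E.s e) := by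
        rw [← F.sum_XY_zero, Finset.sum_eq_single_of_mem e (mem_out.2 rfl)]
        exact fun g hg hne => absurd (hE.eq_of_isCyc he (mem_out.1 hg)) hne
      have ht : E.Tail K _ (E.s e) t := ⟨n, Or.inr ⟨rfl, h⟩⟩
      rw [← mul_assoc, this, ht.start_mul]
      exact ⟨_, ht⟩

theorem gh_mul_tail {e : E.Edge} (he : E.IsCyc (E.s e)) {n : ℤ} {z : E.V} {t : E.wLPA K}
    (ht : E.Tail K n z t) : E.gh K e 0 * t = 0 ∨ ∃ m, E.Tail K m (E.r e) (E.gh K e 0 * t) := by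
  have F := family_wlpa (E := E) (K := K)
  by_cases hz : z = E.s e
  swap
  · exact Or.inl (F.Y_mul_of_ne ht.start_mul hz)
  subst hz
  right
  obtain ⟨m, ⟨-, h⟩ | ⟨-, h⟩⟩ := ht
  swap
  · exact ⟨_, m + 1, Or.inr ⟨rfl, .succ m e he t h⟩⟩
  · generalize hz : E.s e = z at h
    cases h with
    | zero => subst hz; exact ⟨_, 1, Or.inr ⟨rfl, .succ 0 e he _ (.zero _)⟩⟩
    | succ n f hf t h =>
      obtain rfl := hE.eq_of_isCyc hf hz
      have ht : E.Tail K _ (E.r e) t := ⟨n, Or.inl ⟨rfl, h⟩⟩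
      rw [← mul_assoc, F.YX_self_of_one (hE.w_eq_one_of_isCyc he).1, ht.start_mul]
      exact ⟨_, ht⟩

/-- The products of a path in the sense of `Pth`, a path along a cycle, and an element of `B`
span a left ideal. -/
theorem mul_mem_span (B : Set (E.wLPA K)) (a : E.wLPA K) {c : E.wLPA K}
    (hc : c ∈ Submodule.span K {c | ∃ y p n z t b, E.Pth K y p ∧ E.Tail K n z t ∧ b ∈ B ∧
      c = p * (t * b)}) :
    a * c ∈ Submodule.span K {c | ∃ y p n z t b, E.Pth K y p ∧ E.Tail K n z t ∧ b ∈ B ∧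
      c = p * (t * b)} := by
  have F := family_wlpa (E := E) (K := K)
  set N := Submodule.span K {c | ∃ y p n z t b, E.Pth K y p ∧ E.Tail K n z t ∧ b ∈ B ∧
      c = p * (t * b)} with hN
  have red : ∀ a : E.wLPA K, (∀ y p n z t b, E.Pth K y p → E.Tail K n z t → b ∈ B →
      a * (p * (t * b)) ∈ N) → ∀ c ∈ N, a * c ∈ N := by
    intro a ha c hc
    induction hc using Submodule.span_induction with
    | zero => rw [mul_zero]; exact zero_mem _
    | add x y _ _ hx hy => rw [mul_add]; exact add_mem hx hy
    | smul k x _ hx => rw [mul_smul_comm]; exact Submodule.smul_mem _ k hx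
    | mem x hx => obtain ⟨y, p, n, z, t, b, hp, ht, hb, rfl⟩ := hx; exact ha y p n z t b hp ht hb
  refine mul_mem_of_gen N (fun x => red _ ?_) (fun e i hi => red _ ?_) (fun e i hi => red _ ?_)
    a hc
  · intro y p n z t b hp ht hb
    by_cases hy : y = x
    · subst hy
      rw [← mul_assoc, hp.start_mul]
      exact Submodule.subset_span ⟨y, p, n, z, t, b, hp, ht, hb, rfl⟩
    · rw [← mul_assoc, F.P_mul_of_ne hp.start_mul hy, zero_mul]
      exact zero_mem _
  · intro y p n z t b hp ht hb
    rcases hE.ed_mul_pth hp hi with h | ⟨y', h⟩ | ⟨rfl, he, rfl⟩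
    · rw [← mul_assoc, h, zero_mul]; exact zero_mem _
    · rw [← mul_assoc]
      exact Submodule.subset_span ⟨y', _, n, z, t, b, h, ht, hb, rfl⟩
    · rw [← mul_assoc, F.XP_all, ← mul_assoc]
      rcases hE.ed_mul_tail he ht with h | ⟨m, h⟩
      · rw [h, zero_mul]; exact zero_mem _
      · rw [← h.start_mul, mul_assoc]
        exact Submodule.subset_span ⟨_, _, m, _, _, b, .cyc _ he, h, hb, rfl⟩
  · intro y p n z t b hp ht hb
    rcases hE.gh_mul_pth hp hi with h | ⟨y', h⟩ | ⟨rfl, he, rfl⟩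
    · rw [← mul_assoc, h, zero_mul]; exact zero_mem _
    · rw [← mul_assoc]
      exact Submodule.subset_span ⟨y', _, n, z, t, b, h, ht, hb, rfl⟩
    · rw [← mul_assoc, F.YP_all, ← mul_assoc]
      rcases hE.gh_mul_tail he ht with h | ⟨m, h⟩
      · rw [h, zero_mul]; exact zero_mem _
      · rw [← h.start_mul, mul_assoc]
        exact Submodule.subset_span
          ⟨_, _, m, _, _, b, .cyc _ (hE.isCyc_range he), h, hb, rfl⟩

/-- Every vertex lies in the right ideal generated by the elements `Pth` that start in it: away from
cycles and sinks it is a sum of products along the steps `DStep`. -/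
theorem vertex_mem_span (y : E.V) : E.wlpaVertex K y ∈
    Submodule.span K {c | ∃ p b, E.Pth K y p ∧ c = p * b} := by
  have F := family_wlpa (E := E) (K := K)
  induction y using hE.wellFounded_dStep.induction with
  | _ y ih =>
    have red : ∀ (z z' : E.V) (a b : E.wLPA K), (∀ p, E.Pth K z p → E.Pth K z' (a * p)) →
        ∀ c ∈ Submodule.span K {c | ∃ p b, E.Pth K z p ∧ c = p * b},
          a * c * b ∈ Submodule.span K {c | ∃ p b, E.Pth K z' p ∧ c = p * b} := by
      intro z z' a b hab c hc
      induction hc using Submodule.span_induction with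
      | zero => rw [mul_zero, zero_mul]; exact zero_mem _
      | add x y _ _ hx hy => rw [mul_add, add_mul]; exact add_mem hx hy
      | smul k x _ hx => rw [mul_smul_comm, smul_mul_assoc]; exact Submodule.smul_mem _ k hx
      | mem x hx =>
        obtain ⟨p, c, hp, rfl⟩ := hx
        exact Submodule.subset_span ⟨_, c * b, hab p hp, by simp only [mul_assoc]⟩
    by_cases hc : E.IsCyc y
    · exact Submodule.subset_span ⟨_, _, .cyc y hc, (F.P_self y).symm⟩
    by_cases hr : ∃ e, 1 < E.w e ∧ E.r e = y
    · obtain ⟨e, he, rfl⟩ := hr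
      rw [← F.sum_YX e]
      refine Submodule.sum_mem _ fun i hi => ?_
      rw [Finset.mem_range] at hi
      rcases Nat.eq_zero_or_pos i with rfl | hi0
      · refine Submodule.subset_span ⟨_, E.gh K e 0 * E.ed K e 0, .top e he, ?_⟩
        rw [mul_assoc, F.XYX (hE.w_eq_one_of_ne he) (E.w_pos _)]
      · rw [← F.YP_all]
        exact red _ _ _ _ (fun p hp => .ghost e he i hi0 hi p hp) _ (ih _ ⟨.back e he, hc⟩)
    by_cases hs : ∃ f, E.s f = y
    · obtain ⟨e, rfl⟩ := hs
      rw [← F.sum_XY_zero]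
      refine Submodule.sum_mem _ fun f hf => ?_
      rw [mem_out] at hf
      by_cases hw : 1 < E.w f
      · rw [← hf]; exact Submodule.subset_span ⟨_, _, .out f hw, rfl⟩
      · have hw1 := w_eq_one_of_not hw
        rw [← hf] at hc ⊢
        rw [← F.XP_all]
        exact red _ _ _ _ (fun p hp => .real f hw1 hc p hp) _
          (ih _ ⟨hf ▸ .real f hw1, hf ▸ hc⟩)
    · exact Submodule.subset_span ⟨_, _, .sink y (fun f hf => hs ⟨f, hf⟩)
        (fun e he h => hr ⟨e, he, h⟩), (F.P_self y).symm⟩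

omit hE in
theorem mul_sum_vertex [Fintype E.V] (a : E.wLPA K) : a * ∑ y, E.wlpaVertex K y = a := by
  classical
  have F := family_wlpa (E := E) (K := K)
  have key : ∀ (a : E.wLPA K) (x : E.V), a * E.wlpaVertex K x = a →
      a * ∑ y, E.wlpaVertex K y = a := by
    intro a x ha
    rw [Finset.mul_sum, Finset.sum_eq_single_of_mem x (Finset.mem_univ x), ha]
    intro y _ hy
    rw [← ha, mul_assoc, F.P_ne _ _ hy.symm, mul_zero]
  have ha : a ∈ Submodule.span K (Set.range fun p => RelQuot.mk (E.Rel K) (word K p)) := by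
    rw [RelQuot.span_word]; trivial
  induction ha using Submodule.span_induction with
  | zero => rw [zero_mul]
  | add x y _ _ hx hy => rw [add_mul, hx, hy]
  | smul k x _ hx => rw [smul_mul_assoc, hx]
  | mem x hx =>
    obtain ⟨p, rfl⟩ := hx
    dsimp only
    induction p using FreeSemigroup.recOnMul with
    | ih1 x =>
      change RelQuot.mk (E.Rel K) (letter K x) * _ = RelQuot.mk (E.Rel K) (letter K x)
      rcases x with x | ⟨e, i⟩ | ⟨e, i⟩
      · exact key _ x (F.P_self x)
      · have := F.XP_all e i
        rw [ed, edgeElt_fin] at this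
        exact key _ _ this
      · have := F.YP_all e i
        rw [gh, ghostElt_fin] at this
        exact key _ _ this
    | ih2 x y hx hy => rw [word_mul, map_mul, mul_assoc, hy]

/-- The algebra is spanned by products `p * t * b`, where `p` and `b` run through finite sets and
`t` is a path along a cycle. -/
theorem exists_span_eq_top : ∃ A B : Set (E.wLPA K), A.Finite ∧ B.Finite ∧
    Submodule.span K {c | ∃ n : ℤ, ∃ p ∈ A, ∃ y t, E.Tail K n y t ∧ ∃ b ∈ B,
      c = p * (t * b)} = ⊤ := by
  classical
  have F := family_wlpa (E := E) (K := K)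
  have := hE.finite_V
  have := Fintype.ofFinite E.V
  have hT := fun y : E.V => Submodule.mem_span_finite_of_mem_span (hE.vertex_mem_span (K := K) y)
  choose T hTs hTm using hT
  have hpb : ∀ y (c : T y), ∃ p b, E.Pth K y p ∧ c.1 = p * b := fun y c => hTs y c.2
  choose p b hp hc using hpb
  let B : Set (E.wLPA K) := ⋃ y, Set.range (b y)
  have hB : B.Finite := Set.finite_iUnion fun y => Set.finite_range _
  refine ⟨⋃ y, {p | E.Pth K y p}, B, Set.finite_iUnion hE.finite_pth, hB, ?_⟩
  rw [eq_top_iff]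
  rintro a -
  have hJ : ∀ y, E.wlpaVertex K y ∈ Submodule.span K {c | ∃ y p n z t b, E.Pth K y p ∧
      E.Tail K n z t ∧ b ∈ B ∧ c = p * (t * b)} := by
    intro y
    refine Submodule.span_le.2 ?_ (hTm y)
    intro c hcT
    have h1 := hc y ⟨c, hcT⟩
    obtain ⟨z, hz⟩ := (hp y ⟨c, hcT⟩).exists_mul_end
    refine Submodule.subset_span ⟨y, _, 0, z, E.wlpaVertex K z, b y ⟨c, hcT⟩, hp y ⟨c, hcT⟩,
      ⟨0, Or.inl ⟨rfl, .zero z⟩⟩, Set.mem_iUnion.2 ⟨y, _, rfl⟩, ?_⟩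
    rw [← mul_assoc, hz, ← h1]
  rw [← mul_sum_vertex a, Finset.mul_sum]
  refine Submodule.sum_mem _ fun y _ => ?_
  refine Submodule.span_mono ?_ (hE.mul_mem_span B a (hJ y))
  rintro c ⟨y, p, n, z, t, b, hp, ht, hb, rfl⟩
  exact ⟨n, p, Set.mem_iUnion.2 ⟨y, hp⟩, z, t, ht, b, hb, rfl⟩

end Controlled

end Spanning

end WeightedGraph
end WLPA

namespace WLPA
namespace WeightedGraph

/-! ### Projections to the homogeneous components -/

section Grading

variable {E : WeightedGraph.{u, v}} {K : Type*} [Field K]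

theorem sum_single_inr {ι : Type*} (s : Finset ι) (d : ℕ →₀ ℤ) (f : ι → E.wLPA K) :
    ∑ i ∈ s, AddMonoidAlgebra.single d (Unitization.inr (R := K) (f i)) =
      AddMonoidAlgebra.single d (Unitization.inr (∑ i ∈ s, f i)) := by
  classical
  induction s using Finset.induction_on with
  | empty => simp
  | insert i s hi ih =>
    rw [Finset.sum_insert hi, Finset.sum_insert hi, ih, Unitization.inr_add,
      AddMonoidAlgebra.single_add]

variable (E K) in
/-- The images of the generators in the group algebra of `ℕ →₀ ℤ`, marked with their degrees. The
unitization serves to have a ring of coefficients with unit. -/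
theorem family_graded : E.Family
    (fun x => AddMonoidAlgebra.single (0 : ℕ →₀ ℤ) (Unitization.inr (R := K) (E.wlpaVertex K x)))
    (fun e i => AddMonoidAlgebra.single (Finsupp.single i 1) (Unitization.inr (E.ed K e i)))
    (fun e i => AddMonoidAlgebra.single (-Finsupp.single i 1) (Unitization.inr (E.gh K e i))) where
  X_zero e i h := by rw [family_wlpa.X_zero e i h]; simp
  Y_zero e i h := by rw [family_wlpa.Y_zero e i h]; simp
  P_self x := by
    rw [AddMonoidAlgebra.single_mul_single, ← Unitization.inr_mul, family_wlpa.P_self, add_zero]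
  P_ne x y h := by
    rw [AddMonoidAlgebra.single_mul_single, ← Unitization.inr_mul, family_wlpa.P_ne _ _ h]; simp
  PX e i h := by
    rw [AddMonoidAlgebra.single_mul_single, ← Unitization.inr_mul, family_wlpa.PX e i h, zero_add]
  XP e i h := by
    rw [AddMonoidAlgebra.single_mul_single, ← Unitization.inr_mul, family_wlpa.XP e i h, add_zero]
  PY e i h := by
    rw [AddMonoidAlgebra.single_mul_single, ← Unitization.inr_mul, family_wlpa.PY e i h, zero_add]
  YP e i h := by
    rw [AddMonoidAlgebra.single_mul_single, ← Unitization.inr_mul, family_wlpa.YP e i h, add_zero]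
  XY_self x i hi := by
    simp only [AddMonoidAlgebra.single_mul_single, ← Unitization.inr_mul, add_neg_cancel]
    rw [sum_single_inr, family_wlpa.XY_self x i hi]
  XY_ne x i j hi hj hij := by
    simp only [AddMonoidAlgebra.single_mul_single, ← Unitization.inr_mul]
    rw [sum_single_inr, family_wlpa.XY_ne x i j hi hj hij]; simp
  YX_self e := by
    simp only [AddMonoidAlgebra.single_mul_single, ← Unitization.inr_mul, neg_add_cancel]
    rw [sum_single_inr, family_wlpa.YX_self e]
  YX_ne e f hf hne := by
    simp only [AddMonoidAlgebra.single_mul_single, ← Unitization.inr_mul, neg_add_cancel]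
    rw [sum_single_inr, family_wlpa.YX_ne e f hf hne]; simp

/-- The projection to a homogeneous component. -/
noncomputable def proj (d : ℕ →₀ ℤ) : E.wLPA K →ₗ[K] E.wLPA K :=
  Unitization.sndHom K K (E.wLPA K) ∘ₗ Finsupp.lapply d ∘ₗ
    (AddMonoidAlgebra.coeffLinearEquiv K).toLinearMap ∘ₗ
    (lift (K := K) (family_graded E K) :
      E.wLPA K →ₗ[K] AddMonoidAlgebra (Unitization K (E.wLPA K)) (ℕ →₀ ℤ))

theorem lift_graded {d : ℕ →₀ ℤ} {a : E.wLPA K} (ha : a ∈ E.component K d) :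
    lift (K := K) (family_graded E K) a = AddMonoidAlgebra.single d (Unitization.inr a) := by
  induction ha using Submodule.span_induction with
  | zero => simp
  | add x y _ _ hx hy => rw [map_add, hx, hy, Unitization.inr_add, AddMonoidAlgebra.single_add]
  | smul k x _ hx => rw [map_smul, hx, Unitization.inr_smul, AddMonoidAlgebra.smul_single]
  | mem x hx =>
    obtain ⟨p, rfl, rfl⟩ := hx
    induction p using FreeSemigroup.recOnMul with
    | ih1 x =>
      change lift (K := K) (family_graded E K) (RelQuot.mk (E.Rel K) (letter K x)) =
        AddMonoidAlgebra.single _ (Unitization.inr (RelQuot.mk (E.Rel K) (letter K x)))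
      rcases x with x | ⟨e, i⟩ | ⟨e, i⟩
      · rw [← wlpaVertex, lift_vertex]; rfl
      · have := lift_ed (K := K) (family_graded E K) e i
        rw [ed, edgeElt_fin] at this
        rw [this]; rfl
      · have := lift_gh (K := K) (family_graded E K) e i
        rw [gh, ghostElt_fin] at this
        rw [this]; rfl
    | ih2 x y hx hy =>
      rw [word_mul, map_mul, map_mul, hx, hy, AddMonoidAlgebra.single_mul_single,
        Unitization.inr_mul]
      simp [wordDeg]

theorem proj_of_mem {d : ℕ →₀ ℤ} {a : E.wLPA K} (ha : a ∈ E.component K d) : proj d a = a := by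
  change ((lift (K := K) (family_graded E K) a).coeff d).snd = a
  rw [lift_graded ha, AddMonoidAlgebra.coeff_single, Finsupp.single_eq_same, Unitization.snd_inr]

theorem proj_of_mem_ne {c d : ℕ →₀ ℤ} (h : c ≠ d) {a : E.wLPA K} (ha : a ∈ E.component K c) :
    proj d a = 0 := by
  change ((lift (K := K) (family_graded E K) a).coeff d).snd = 0
  rw [lift_graded ha, AddMonoidAlgebra.coeff_single, Finsupp.single_eq_of_ne h.symm,
    Unitization.snd_zero]

/-- An algebra spanned by homogeneous elements, finitely many of each degree, is locally finite. -/
theorem locallyFinite_of_span {ι : Type*} (A : ι → Set (E.wLPA K)) (deg : ι → (ℕ →₀ ℤ))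
    (hA : ∀ i, (A i).Finite) (hdeg : ∀ d, {i | deg i = d}.Finite)
    (hmem : ∀ i, A i ⊆ E.component K (deg i)) (hspan : Submodule.span K (⋃ i, A i) = ⊤) :
    E.LocallyFinite K := by
  intro d
  have hfin : (⋃ i ∈ {i | deg i = d}, A i).Finite := (hdeg d).biUnion fun i _ => hA i
  have hle : E.component K d ≤ Submodule.span K (⋃ i ∈ {i | deg i = d}, A i) := by
    intro a ha
    have key : ∀ a ∈ Submodule.span K (⋃ i, A i),
        proj d a ∈ Submodule.span K (⋃ i ∈ {i | deg i = d}, A i) := by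
      intro a ha
      induction ha using Submodule.span_induction with
      | zero => rw [map_zero]; exact zero_mem _
      | add x y _ _ hx hy => rw [map_add]; exact add_mem hx hy
      | smul k x _ hx => rw [map_smul]; exact Submodule.smul_mem _ k hx
      | mem x hx =>
        obtain ⟨i, hi⟩ := Set.mem_iUnion.1 hx
        by_cases h : deg i = d
        · rw [proj_of_mem (h ▸ hmem i hi)]
          exact Submodule.subset_span (Set.mem_biUnion h hi)
        · rw [proj_of_mem_ne h (hmem i hi)]; exact zero_mem _
    rw [← proj_of_mem ha]
    exact key a (by rw [hspan]; trivial)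
  have := FiniteDimensional.span_of_finite K hfin
  exact Submodule.finiteDimensional_of_le hle

/-- Finitely many elements have only finitely many homogeneous summands. -/
theorem exists_homogeneous {A : Set (E.wLPA K)} (hA : A.Finite) :
    ∃ A' : Set (E.wLPA K), A'.Finite ∧ (∀ a ∈ A', ∃ d, a ∈ E.component K d) ∧
      A ⊆ Submodule.span K A' := by
  classical
  have h : ∀ a : E.wLPA K, ∃ T : Finset (E.wLPA K),
      ↑T ⊆ Set.range (fun p => RelQuot.mk (K := K) (E.Rel K) (word K p)) ∧
      a ∈ Submodule.span K (T : Set (E.wLPA K)) := fun a =>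
    Submodule.mem_span_finite_of_mem_span (by rw [RelQuot.span_word]; trivial)
  choose T hT hTa using h
  refine ⟨⋃ a ∈ A, (T a : Set (E.wLPA K)), hA.biUnion fun a _ => Finset.finite_toSet _, ?_, ?_⟩
  · intro a ha
    obtain ⟨b, -, hb⟩ := Set.mem_iUnion₂.1 ha
    obtain ⟨p, rfl⟩ := hT b hb
    exact ⟨E.wordDeg p, Submodule.subset_span ⟨p, rfl, rfl⟩⟩
  · intro a ha
    have hsub : (T a : Set (E.wLPA K)) ⊆ ⋃ a ∈ A, (T a : Set (E.wLPA K)) := fun c hc =>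
      Set.mem_iUnion₂.2 ⟨a, ha, hc⟩
    exact Submodule.span_mono hsub (hTa a)

/-! ### Transfer of local finiteness -/

/-- Local finiteness passes to an algebra with a possibly different grading, provided that the
vertices and the unweighted edges keep their degrees: in the spanning set of
`Controlled.exists_span_eq_top` all but finitely many factors are products of such edges. -/
theorem Controlled.locallyFinite_of_surjective (hE : E.Controlled) {E' : WeightedGraph.{u, max u v}}
    (Φ : E.wLPA K →ₙₐ[K] E'.wLPA K) (hΦ : Function.Surjective Φ)
    (hP : ∀ x, Φ (E.wlpaVertex K x) ∈ E'.component K 0)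
    (hX : ∀ f, E.w f = 1 → Φ (E.ed K f 0) ∈ E'.component K (Finsupp.single 0 1))
    (hY : ∀ f, E.w f = 1 → Φ (E.gh K f 0) ∈ E'.component K (-Finsupp.single 0 1)) :
    E'.LocallyFinite K := by
  have := hE.finite_V
  obtain ⟨A, B, hA, hB, hAB⟩ := hE.exists_span_eq_top (K := K)
  obtain ⟨A', hA', hAd, hAs⟩ := exists_homogeneous (hA.image Φ)
  obtain ⟨B', hB', hBd, hBs⟩ := exists_homogeneous (hB.image Φ)
  have htail : ∀ n y t, E.Tail K n y t → Φ t ∈ E'.component K (n • Finsupp.single 0 1) := by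
    rintro n y t ⟨m, ⟨rfl, h⟩ | ⟨rfl, h⟩⟩
    · induction h with
      | zero y => simpa using hP y
      | succ n f hf t ht ih =>
        rw [map_mul]
        have := mul_mem_component (hX f (hE.w_eq_one_of_isCyc hf).1) ih
        convert this using 2
        push_cast; rw [add_smul, one_smul, add_comm]
    · induction h with
      | zero y => simpa using hP y
      | succ n f hf t ht ih =>
        rw [map_mul]
        have := mul_mem_component (hY f (hE.w_eq_one_of_isCyc hf).1) ih
        convert this using 2
        push_cast; rw [neg_smul, neg_smul, add_smul, one_smul, neg_add_rev]
  choose! α hα using hAd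
  choose! β hβ using hBd
  have := hA'.to_subtype
  have := hB'.to_subtype
  refine locallyFinite_of_span (ι := ℤ × A' × B')
    (fun i => (fun t => i.2.1.1 * (Φ t * i.2.2.1)) '' {t | ∃ y, E.Tail K i.1 y t})
    (fun i => α i.2.1.1 + (i.1 • Finsupp.single 0 1 + β i.2.2.1)) (fun i => (finite_tail _).image _)
    (fun d => ?_) ?_ ?_
  · refine Set.Finite.of_injOn (f := Prod.snd) (t := Set.univ) (fun _ _ => Set.mem_univ _) ?_
      Set.finite_univ
    rintro ⟨n, p⟩ hn ⟨m, q⟩ hm hpq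
    obtain rfl : p = q := hpq
    have h := (hn : _ = d).trans (hm : _ = d).symm
    have h' := add_right_cancel (add_left_cancel h)
    have h'' := DFunLike.congr_fun h' 0
    simp at h''
    rw [h'']
  · rintro ⟨n, p, b⟩ _ ⟨t, ⟨y, ht⟩, rfl⟩
    exact mul_mem_component (hα p.1 p.2) (mul_mem_component (htail n y t ht) (hβ b.1 b.2))
  · rw [eq_top_iff]
    rintro a -
    obtain ⟨c, rfl⟩ := hΦ a
    have hc : c ∈ Submodule.span K {c | ∃ n : ℤ, ∃ p ∈ A, ∃ y t, E.Tail K n y t ∧ ∃ b ∈ B,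
      c = p * (t * b)} := by rw [hAB]; trivial
    induction hc using Submodule.span_induction with
    | zero => rw [map_zero]; exact zero_mem _
    | add x y _ _ hx hy => rw [map_add]; exact add_mem hx hy
    | smul k x _ hx => rw [map_smul]; exact Submodule.smul_mem _ k hx
    | mem x hx =>
      obtain ⟨n, p, hp, y, t, ht, b, hb, rfl⟩ := hx
      rw [map_mul, map_mul]
      have h1 : Φ p ∈ Submodule.span K A' := hAs ⟨p, hp, rfl⟩
      have h2 : Φ b ∈ Submodule.span K B' := hBs ⟨b, hb, rfl⟩
      generalize Φ p = p' at h1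
      generalize Φ b = b' at h2
      induction h1 using Submodule.span_induction with
      | zero => rw [zero_mul]; exact zero_mem _
      | add x y _ _ hx hy => rw [add_mul]; exact add_mem hx hy
      | smul k x _ hx => rw [smul_mul_assoc]; exact Submodule.smul_mem _ k hx
      | mem x hx =>
        induction h2 using Submodule.span_induction with
        | zero => rw [mul_zero, mul_zero]; exact zero_mem _
        | add y z _ _ hy hz => rw [mul_add, mul_add]; exact add_mem hy hz
        | smul k y _ hy =>
          rw [mul_smul_comm, mul_smul_comm]; exact Submodule.smul_mem _ k hy
        | mem z hz =>
          exact Submodule.subset_span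
            (Set.mem_iUnion.2 ⟨(n, ⟨x, hx⟩, ⟨z, hz⟩), t, ⟨y, ht⟩, rfl⟩)

end Grading

end WeightedGraph
end WLPA

namespace WLPA

/-! ### Sums of vertices in families -/

namespace DirectedGraph.Family

variable {G : DirectedGraph.{u, v}} {B : Type*} [NonUnitalRing B] {P : G.V → B} {X Y : G.Edge → B}
  (h : G.Family P X Y)
include h

theorem X_mul_of_ne {e : G.Edge} {y : G.V} {a : B} (ha : P y * a = a) (hy : y ≠ G.r e) :
    X e * a = 0 := by
  rw [← ha, ← h.XP e, mul_assoc, ← mul_assoc (P _), h.P_ne _ _ hy.symm, zero_mul, mul_zero]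

theorem Y_mul_of_ne {e : G.Edge} {y : G.V} {a : B} (ha : P y * a = a) (hy : y ≠ G.s e) :
    Y e * a = 0 := by
  rw [← ha, ← h.YP e, mul_assoc, ← mul_assoc (P _), h.P_ne _ _ hy.symm, zero_mul, mul_zero]

theorem mul_sum_P {a : B} {x : G.V} (ha : a * P x = a) {U : Finset G.V} (hx : x ∈ U) :
    a * ∑ y ∈ U, P y = a := by
  rw [Finset.mul_sum, Finset.sum_eq_single_of_mem x hx, ha]
  intro y _ hy
  rw [← ha, mul_assoc, h.P_ne _ _ hy.symm, mul_zero]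

theorem sum_P_mul {a : B} {x : G.V} (ha : P x * a = a) {U : Finset G.V} (hx : x ∈ U) :
    (∑ y ∈ U, P y) * a = a := by
  rw [Finset.sum_mul, Finset.sum_eq_single_of_mem x hx, ha]
  intro y _ hy
  rw [← ha, ← mul_assoc, h.P_ne _ _ hy, zero_mul]

theorem sum_P_mul_eq_zero {a : B} {x : G.V} (ha : P x * a = a) {U : Finset G.V} (hx : x ∉ U) :
    (∑ y ∈ U, P y) * a = 0 := by
  rw [Finset.sum_mul]
  refine Finset.sum_eq_zero fun y hy => ?_
  rw [← ha, ← mul_assoc, h.P_ne y x (by rintro rfl; exact hx hy), zero_mul]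

theorem sum_P_self (U : Finset G.V) : (∑ y ∈ U, P y) * ∑ y ∈ U, P y = ∑ y ∈ U, P y := by
  conv_lhs => rw [Finset.mul_sum]
  exact Finset.sum_congr rfl fun y hy => h.sum_P_mul (h.P_self y) hy

theorem sum_P_ne {U V : Finset G.V} (hUV : ∀ y ∈ V, y ∉ U) :
    (∑ y ∈ U, P y) * ∑ y ∈ V, P y = 0 := by
  rw [Finset.mul_sum]
  exact Finset.sum_eq_zero fun y hy => h.sum_P_mul_eq_zero (h.P_self y) (hUV y hy)

end DirectedGraph.Family

namespace WeightedGraph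

/-! ### Splitting the range of the only weighted edge -/

section Split

variable (F : WeightedGraph.{u, v}) (e : F.Edge)

open Classical in
/-- The numbers of the vertices that replace the vertex `y` when the range of `e` is split into
`w e` vertices. -/
noncomputable def splitIdx (y : F.V) : Finset ℕ :=
  if y = F.r e then Finset.range (F.w e) else {0}

/-- The edges of the graph in which `r(e)` is split: copies of the edges `f ≠ e`, the edge `e_1`,
and an edge in the direction of `e_{k+1}*` for each `k ≥ 1`. -/
inductive SplitEdge : Type v
  | copy (f : F.Edge) (hf : f ≠ e) (k : ℕ) (hk : k ∈ F.splitIdx e (F.r f))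
  | main
  | up (k : ℕ) (hk : 1 ≤ k) (hke : k < F.w e)

variable {F e} in
theorem zero_mem_splitIdx (y : F.V) : 0 ∈ F.splitIdx e y := by
  have := F.w_pos e
  rw [splitIdx]; split_ifs
  · exact Finset.mem_range.2 this
  · exact Finset.mem_singleton_self 0

variable {F e} in
theorem mem_splitIdx_range {k : ℕ} : k ∈ F.splitIdx e (F.r e) ↔ k < F.w e := by
  simp [splitIdx]

/-- The directed graph obtained by splitting the range of `e` into the vertices `(r(e), k)`,
`0 ≤ k < w(e)`. The edge `e_1` ends in `(r(e), 0)`, and for `k ≥ 1` the ghost edge `e_{k+1}*` is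
turned into an edge from `(r(e), k)` to the source of `e`. -/
noncomputable abbrev split : DirectedGraph.{u, v} where
  V := {p : F.V × ℕ // p.2 ∈ F.splitIdx e p.1}
  Edge := F.SplitEdge e
  s
    | .copy f _ _ _ => ⟨(F.s f, 0), zero_mem_splitIdx _⟩
    | .main => ⟨(F.s e, 0), zero_mem_splitIdx _⟩
    | .up k _ hke => ⟨(F.r e, k), mem_splitIdx_range.2 hke⟩
  r
    | .copy f _ k hk => ⟨(F.r f, k), hk⟩
    | .main => ⟨(F.r e, 0), zero_mem_splitIdx _⟩
    | .up _ _ _ => ⟨(F.s e, 0), zero_mem_splitIdx _⟩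

open Classical in
/-- The vertices that replace the vertex `y`. -/
noncomputable def splitOver (y : F.V) : Finset (F.split e).V :=
  (F.splitIdx e y).attach.image fun k => ⟨(y, k.1), k.2⟩

open Classical in
/-- The edges that replace the edge `f`. -/
noncomputable def splitOverEdge (f : F.Edge) : Finset (F.split e).Edge :=
  if hf : f = e then {.main} else
    (F.splitIdx e (F.r f)).attach.image fun k => .copy f hf k.1 k.2

variable {F e}

theorem mem_splitOver {y : F.V} {u : (F.split e).V} : u ∈ F.splitOver e y ↔ u.1.1 = y := by
  obtain ⟨⟨z, k⟩, hk⟩ := u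
  simp only [splitOver, Finset.mem_image, Finset.mem_attach, true_and, Subtype.exists]
  constructor
  · rintro ⟨k', hk', h⟩
    exact (congrArg (fun u => u.1.1) h).symm
  · rintro rfl
    exact ⟨k, hk, rfl⟩

theorem sum_splitOver {M : Type*} [AddCommMonoid M] (y : F.V) (φ : (F.split e).V → M) :
    ∑ u ∈ F.splitOver e y, φ u = ∑ k ∈ (F.splitIdx e y).attach, φ ⟨(y, k.1), k.2⟩ := by
  classical
  rw [splitOver, Finset.sum_image]
  intro a _ b _ h
  exact Subtype.ext (congrArg (fun u => u.1.2) h)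

theorem sum_splitOverEdge {M : Type*} [AddCommMonoid M] {f : F.Edge} (hf : f ≠ e)
    (φ : (F.split e).Edge → M) : ∑ g ∈ F.splitOverEdge e f, φ g =
      ∑ k ∈ (F.splitIdx e (F.r f)).attach, φ (.copy f hf k.1 k.2) := by
  classical
  rw [splitOverEdge, dif_neg hf, Finset.sum_image]
  intro a _ b _ h
  injection h with _ h
  exact Subtype.ext h

theorem splitOverEdge_self : F.splitOverEdge e e = {.main} := by
  rw [splitOverEdge, dif_pos rfl]

theorem copy_mem_splitOverEdge {f f' : F.Edge} {hf k hk} :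
    (.copy f hf k hk : F.SplitEdge e) ∈ F.splitOverEdge e f' ↔ f = f' := by
  classical
  by_cases h : f' = e
  · rw [splitOverEdge, dif_pos h, Finset.mem_singleton]
    refine ⟨fun h => by injection h, fun h' => absurd (h'.trans h) hf⟩
  · simp only [splitOverEdge, dif_neg h, Finset.mem_image, Finset.mem_attach, true_and,
      Subtype.exists]
    constructor
    · rintro ⟨k', hk', h⟩
      injection h with h _
      exact h.symm
    · rintro rfl
      exact ⟨k, hk, rfl⟩

theorem main_mem_splitOverEdge {f' : F.Edge} :
    (.main : F.SplitEdge e) ∈ F.splitOverEdge e f' ↔ e = f' := by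
  classical
  by_cases h : f' = e
  · subst h; simp [splitOverEdge]
  · simp [splitOverEdge, h, Ne.symm h]

theorem up_notMem_splitOverEdge {f' : F.Edge} {k hk hke} :
    (.up k hk hke : F.SplitEdge e) ∉ F.splitOverEdge e f' := by
  classical
  by_cases h : f' = e
  · simp [splitOverEdge, h]
  · simp [splitOverEdge, h]

theorem splitOverEdge_disjoint {f f' : F.Edge} {g : (F.split e).Edge}
    (h : g ∈ F.splitOverEdge e f) (h' : g ∈ F.splitOverEdge e f') : f = f' := by
  cases g with
  | copy f₀ hf k hk => exact (copy_mem_splitOverEdge.1 h).symm.trans (copy_mem_splitOverEdge.1 h')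
  | main => exact (main_mem_splitOverEdge.1 h).symm.trans (main_mem_splitOverEdge.1 h')
  | up k hk hke => exact absurd h up_notMem_splitOverEdge

theorem split_s_of_mem {f : F.Edge} {g : (F.split e).Edge} (h : g ∈ F.splitOverEdge e f) :
    (F.split e).s g = ⟨(F.s f, 0), zero_mem_splitIdx _⟩ := by
  cases g with
  | copy f₀ hf k hk => obtain rfl := copy_mem_splitOverEdge.1 h; rfl
  | main => obtain rfl := main_mem_splitOverEdge.1 h; rfl
  | up k hk hke => exact absurd h up_notMem_splitOverEdge

theorem split_r_of_mem {f : F.Edge} {g : (F.split e).Edge} (h : g ∈ F.splitOverEdge e f) :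
    (F.split e).r g ∈ F.splitOver e (F.r f) := by
  rw [mem_splitOver]
  cases g with
  | copy f₀ hf k hk => obtain rfl := copy_mem_splitOverEdge.1 h; rfl
  | main => obtain rfl := main_mem_splitOverEdge.1 h; rfl
  | up k hk hke => exact absurd h up_notMem_splitOverEdge

theorem split_r_injOn {f : F.Edge} {g g' : (F.split e).Edge} (h : g ∈ F.splitOverEdge e f)
    (h' : g' ∈ F.splitOverEdge e f) (hr : (F.split e).r g = (F.split e).r g') : g = g' := by
  by_cases hf : f = e
  · subst hf
    rw [splitOverEdge_self, Finset.mem_singleton] at h h'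
    rw [h, h']
  · simp only [splitOverEdge, dif_neg hf, Finset.mem_image, Finset.mem_attach, true_and] at h h'
    obtain ⟨k, rfl⟩ := h
    obtain ⟨k', rfl⟩ := h'
    have : k.1 = k'.1 := congrArg (fun u => u.1.2) hr
    obtain rfl := Subtype.ext this
    rfl

/-- The edges that start in a vertex `(y, 0)`, if `y` is not the range of `e`. -/
theorem split_s_eq_iff {y : F.V} (hy : y ≠ F.r e) {g : (F.split e).Edge} :
    (F.split e).s g = ⟨(y, 0), zero_mem_splitIdx _⟩ ↔ ∃ f, F.s f = y ∧ g ∈ F.splitOverEdge e f := by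
  constructor
  · intro h
    have h' := congrArg (fun u => u.1.1) h
    cases g with
    | copy f hf k hk => exact ⟨f, h', copy_mem_splitOverEdge.2 rfl⟩
    | main => exact ⟨e, h', main_mem_splitOverEdge.2 rfl⟩
    | up k hk hke => exact absurd h'.symm hy
  · rintro ⟨f, rfl, h⟩
    exact split_s_of_mem h

theorem split_s_eq_iff_up (hsink : ∀ f, F.s f ≠ F.r e) {k : ℕ} (hk : 1 ≤ k) (hke : k < F.w e)
    {g : (F.split e).Edge} :
    (F.split e).s g = ⟨(F.r e, k), mem_splitIdx_range.2 hke⟩ ↔ g = .up k hk hke := by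
  constructor
  · intro h
    cases g with
    | copy f hf k hk => exact absurd (congrArg (fun u => u.1.1) h) (hsink f)
    | main => exact absurd (congrArg (fun u => u.1.1) h) (hsink e)
    | up k' hk' hke' =>
      obtain rfl : k' = k := congrArg (fun u => u.1.2) h
      rfl
  · rintro rfl; rfl

/-- A vertex of the split graph is a copy of a vertex `y ≠ r(e)`, or `(r(e), 0)`, or a new
vertex. -/
theorem split_vertex_cases (u : (F.split e).V) :
    (∃ y, y ≠ F.r e ∧ u = ⟨(y, 0), zero_mem_splitIdx _⟩) ∨
      ∃ k, ∃ hk : k < F.w e, u = ⟨(F.r e, k), mem_splitIdx_range.2 hk⟩ := by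
  obtain ⟨⟨y, k⟩, hk⟩ := u
  by_cases hy : y = F.r e
  · subst hy
    exact Or.inr ⟨k, mem_splitIdx_range.1 hk, rfl⟩
  · have : k = 0 := by simpa [splitIdx, hy] using hk
    subst this
    exact Or.inl ⟨y, hy, rfl⟩

theorem sum_split_out {M : Type*} [AddCommMonoid M] {y : F.V} (hy : y ≠ F.r e)
    (hfin : {g : (F.split e).Edge | (F.split e).s g = ⟨(y, 0), zero_mem_splitIdx _⟩}.Finite)
    (φ : (F.split e).Edge → M) :
    ∑ g ∈ hfin.toFinset, φ g = ∑ f ∈ F.out y, ∑ g ∈ F.splitOverEdge e f, φ g := by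
  classical
  rw [← Finset.sum_biUnion]
  · refine Finset.sum_congr ?_ fun _ _ => rfl
    ext g
    simp only [Set.Finite.mem_toFinset, Set.mem_ofPred_eq, split_s_eq_iff hy, Finset.mem_biUnion,
      mem_out]
  · intro f _ f' _ hne
    exact Finset.disjoint_left.2 fun g h h' => hne (splitOverEdge_disjoint h h')

theorem split_rowFinite (hsink : ∀ f, F.s f ≠ F.r e) : (F.split e).RowFinite := by
  classical
  intro u
  rcases split_vertex_cases u with ⟨y, hy, rfl⟩ | ⟨k, hk, rfl⟩
  · refine ((F.out y).biUnion fun f => F.splitOverEdge e f).finite_toSet.subset ?_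
    intro g hg
    obtain ⟨f, hf, hgf⟩ := (split_s_eq_iff hy).1 hg
    exact Finset.mem_coe.2 (Finset.mem_biUnion.2 ⟨f, mem_out.2 hf, hgf⟩)
  · rcases Nat.eq_zero_or_pos k with rfl | hk0
    · convert Set.finite_empty
      ext g
      simp only [Set.mem_ofPred_eq, Set.mem_empty_iff_false, iff_false]
      intro h
      cases g with
      | copy f hf k hk => exact absurd (congrArg (fun u => u.1.1) h) (hsink f)
      | main => exact absurd (congrArg (fun u => u.1.1) h) (hsink e)
      | up k' hk' hke' =>
        have : k' = 0 := congrArg (fun u => u.1.2) h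
        omega
    · refine (Set.finite_singleton (.up k hk0 hk : (F.split e).Edge)).subset ?_
      intro g hg
      exact (split_s_eq_iff_up hsink hk0 hk).1 hg

theorem sum_split_up (hsink : ∀ f, F.s f ≠ F.r e) {k : ℕ} (hk : 1 ≤ k) (hke : k < F.w e)
    {M : Type*} [AddCommMonoid M]
    (hfin : {g : (F.split e).Edge | (F.split e).s g =
      ⟨(F.r e, k), mem_splitIdx_range.2 hke⟩}.Finite) (φ : (F.split e).Edge → M) :
    ∑ g ∈ hfin.toFinset, φ g = φ (.up k hk hke) :=
  Finset.sum_eq_single_of_mem _ ((Set.Finite.mem_toFinset hfin).2 rfl) fun _ hg hne =>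
    absurd ((split_s_eq_iff_up hsink hk hke).1 ((Set.Finite.mem_toFinset hfin).1 hg)) hne

variable (K : Type*) [Field K]

variable (F e) in
/-- The image in `L_K(split)` of a vertex. -/
noncomputable def splitP (y : F.V) : (F.split e).LPA K :=
  ∑ u ∈ F.splitOver e y, (F.split e).lpaVertex K u

variable (F e) in
open Classical in
/-- The image in `L_K(split)` of an edge. -/
noncomputable def splitX (f : F.Edge) (i : ℕ) : (F.split e).LPA K :=
  if i = 0 then ∑ g ∈ F.splitOverEdge e f, (F.split e).lpaEdge K g else
    if h : f = e ∧ 1 ≤ i ∧ i < F.w e then (F.split e).lpaGhost K (.up i h.2.1 h.2.2) else 0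

variable (F e) in
open Classical in
/-- The image in `L_K(split)` of a ghost edge. -/
noncomputable def splitY (f : F.Edge) (i : ℕ) : (F.split e).LPA K :=
  if i = 0 then ∑ g ∈ F.splitOverEdge e f, (F.split e).lpaGhost K g else
    if h : f = e ∧ 1 ≤ i ∧ i < F.w e then (F.split e).lpaEdge K (.up i h.2.1 h.2.2) else 0

theorem splitX_zero (f : F.Edge) :
    F.splitX e K f 0 = ∑ g ∈ F.splitOverEdge e f, (F.split e).lpaEdge K g := if_pos rfl

theorem splitY_zero (f : F.Edge) :
    F.splitY e K f 0 = ∑ g ∈ F.splitOverEdge e f, (F.split e).lpaGhost K g := if_pos rfl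

theorem splitX_pos {i : ℕ} (h : 1 ≤ i) (hi : i < F.w e) :
    F.splitX e K e i = (F.split e).lpaGhost K (.up i h hi) := by
  rw [splitX, if_neg (by omega), dif_pos ⟨rfl, h, hi⟩]

theorem splitY_pos {i : ℕ} (h : 1 ≤ i) (hi : i < F.w e) :
    F.splitY e K e i = (F.split e).lpaEdge K (.up i h hi) := by
  rw [splitY, if_neg (by omega), dif_pos ⟨rfl, h, hi⟩]

theorem splitX_eq_zero {f : F.Edge} {i : ℕ} (h : F.w f ≤ i) : F.splitX e K f i = 0 := by
  have := F.w_pos f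
  rw [splitX, if_neg (by omega), dif_neg]
  rintro ⟨rfl, -, h'⟩; omega

theorem splitY_eq_zero {f : F.Edge} {i : ℕ} (h : F.w f ≤ i) : F.splitY e K f i = 0 := by
  have := F.w_pos f
  rw [splitY, if_neg (by omega), dif_neg]
  rintro ⟨rfl, -, h'⟩; omega

variable {K}

theorem splitP_of_ne {y : F.V} (hy : y ≠ F.r e) :
    F.splitP e K y = (F.split e).lpaVertex K ⟨(y, 0), zero_mem_splitIdx _⟩ := by
  rw [splitP, Finset.sum_eq_single_of_mem]
  · exact mem_splitOver.2 rfl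
  · intro u hu hne
    rw [mem_splitOver] at hu
    rcases split_vertex_cases u with ⟨y', hy', rfl⟩ | ⟨k, hk, rfl⟩
    · change y' = y at hu
      subst hu; exact absurd rfl hne
    · exact absurd hu.symm hy

theorem splitX_zero_mul_splitY_zero (f : F.Edge) : F.splitX e K f 0 * F.splitY e K f 0 =
    ∑ g ∈ F.splitOverEdge e f, (F.split e).lpaEdge K g * (F.split e).lpaGhost K g := by
  have G := (F.split e).family_lpa (K := K)
  rw [splitX_zero, splitY_zero, Finset.sum_mul_sum]
  refine Finset.sum_congr rfl fun g hg => ?_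
  refine Finset.sum_eq_single_of_mem g hg fun g' hg' hne => ?_
  exact G.X_mul_of_ne (G.PY g') fun h => hne (split_r_injOn hg' hg h)

theorem splitY_zero_mul_splitX_zero (f : F.Edge) : F.splitY e K f 0 * F.splitX e K f 0 =
    ∑ g ∈ F.splitOverEdge e f, (F.split e).lpaVertex K ((F.split e).r g) := by
  have G := (F.split e).family_lpa (K := K)
  rw [splitX_zero, splitY_zero, Finset.sum_mul_sum]
  refine Finset.sum_congr rfl fun g hg => ?_
  rw [Finset.sum_eq_single_of_mem g hg fun g' hg' hne => G.YX_ne _ _ hne.symm, G.YX_self]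

theorem splitY_zero_mul_splitX_zero_of_ne {f f' : F.Edge} (h : f ≠ f') :
    F.splitY e K f 0 * F.splitX e K f' 0 = 0 := by
  have G := (F.split e).family_lpa (K := K)
  rw [splitX_zero, splitY_zero, Finset.sum_mul_sum]
  refine Finset.sum_eq_zero fun g hg => Finset.sum_eq_zero fun g' hg' => G.YX_ne _ _ ?_
  rintro rfl
  exact h (splitOverEdge_disjoint hg hg')

variable (K)

theorem lpa_up_mul_ghost (hsink : ∀ f, F.s f ≠ F.r e) {k : ℕ} (hk : 1 ≤ k) (hke : k < F.w e) :
    (F.split e).lpaEdge K (.up k hk hke) * (F.split e).lpaGhost K (.up k hk hke) =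
      (F.split e).lpaVertex K ⟨(F.r e, k), mem_splitIdx_range.2 hke⟩ := by
  have G := (F.split e).family_lpa (K := K)
  have h1 : ¬ (F.split e).IsSink ⟨(F.r e, k), mem_splitIdx_range.2 hke⟩ := by
    intro h
    have : (.up k hk hke : (F.split e).Edge) ∈
        {g | (F.split e).s g = ⟨(F.r e, k), mem_splitIdx_range.2 hke⟩} := rfl
    rw [h] at this
    exact this
  rw [← G.XY _ h1 (split_rowFinite hsink _)]
  exact (sum_split_up hsink hk hke _
    fun g => (F.split e).lpaEdge K g * (F.split e).lpaGhost K g).symm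

theorem family_split (hsink : ∀ f, F.s f ≠ F.r e) (hone : ∀ f, f ≠ e → F.w f = 1) :
    F.Family (F.splitP e K) (F.splitX e K) (F.splitY e K) where
  X_zero f i h := splitX_eq_zero K h
  Y_zero f i h := splitY_eq_zero K h
  P_self y := (F.split e).family_lpa.sum_P_self _
  P_ne x y hxy := (F.split e).family_lpa.sum_P_ne fun u hu hu' =>
    hxy ((mem_splitOver.1 hu').symm.trans (mem_splitOver.1 hu))
  PX f i hi := by
    have G := (F.split e).family_lpa (K := K)
    rw [splitP_of_ne (hsink f)]
    rcases Nat.eq_zero_or_pos i with rfl | hi0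
    · rw [splitX_zero, Finset.mul_sum]
      refine Finset.sum_congr rfl fun g hg => ?_
      rw [← split_s_of_mem hg, G.PX]
    · by_cases hf : f = e
      · subst hf; rw [splitX_pos K hi0 hi]; exact G.PY _
      · have := hone f hf; omega
  XP f i hi := by
    have G := (F.split e).family_lpa (K := K)
    rcases Nat.eq_zero_or_pos i with rfl | hi0
    · rw [splitX_zero, Finset.sum_mul]
      exact Finset.sum_congr rfl fun g hg => G.mul_sum_P (G.XP g) (split_r_of_mem hg)
    · by_cases hf : f = e
      · subst hf
        rw [splitX_pos K hi0 hi]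
        exact G.mul_sum_P (G.YP _) (mem_splitOver.2 rfl)
      · have := hone f hf; omega
  PY f i hi := by
    have G := (F.split e).family_lpa (K := K)
    rcases Nat.eq_zero_or_pos i with rfl | hi0
    · rw [splitY_zero, Finset.mul_sum]
      exact Finset.sum_congr rfl fun g hg => G.sum_P_mul (G.PY g) (split_r_of_mem hg)
    · by_cases hf : f = e
      · subst hf
        rw [splitY_pos K hi0 hi]
        exact G.sum_P_mul (G.PX _) (mem_splitOver.2 rfl)
      · have := hone f hf; omega
  YP f i hi := by
    have G := (F.split e).family_lpa (K := K)
    rw [splitP_of_ne (hsink f)]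
    rcases Nat.eq_zero_or_pos i with rfl | hi0
    · rw [splitY_zero, Finset.sum_mul]
      refine Finset.sum_congr rfl fun g hg => ?_
      rw [← split_s_of_mem hg, G.YP]
    · by_cases hf : f = e
      · subst hf; rw [splitY_pos K hi0 hi]; exact G.XP _
      · have := hone f hf; omega
  XY_self x i hi := by
    have G := (F.split e).family_lpa (K := K)
    have hx : x ≠ F.r e := by
      rintro rfl
      have : F.out (F.r e) = ∅ := by
        ext f; simpa [mem_out] using hsink f
      simp [vw, this] at hi
    rw [splitP_of_ne hx]
    rcases Nat.eq_zero_or_pos i with rfl | hi0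
    · rw [Finset.sum_congr rfl fun f _ => splitX_zero_mul_splitY_zero f,
        ← sum_split_out hx (split_rowFinite hsink _)]
      refine G.XY _ ?_ _
      obtain ⟨f, hf⟩ : (F.out x).Nonempty := by
        by_contra h
        rw [Finset.not_nonempty_iff_eq_empty] at h
        simp [vw, h] at hi
      obtain ⟨g, hg⟩ : ∃ g, g ∈ F.splitOverEdge e f := by
        by_cases hfe : f = e
        · subst hfe; exact ⟨_, main_mem_splitOverEdge.2 rfl⟩
        · exact ⟨.copy f hfe 0 (zero_mem_splitIdx _), copy_mem_splitOverEdge.2 rfl⟩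
      intro h
      have : g ∈ {g | (F.split e).s g = ⟨(x, 0), zero_mem_splitIdx _⟩} :=
        (split_s_eq_iff hx).2 ⟨f, mem_out.1 hf, hg⟩
      rw [h] at this
      exact this
    · -- An edge of weight at least two leaves `x`, so that `x` is the source of `e`.
      obtain ⟨f, hf, hfi⟩ : ∃ f ∈ F.out x, i < F.w f := by
        by_contra! h
        exact absurd (Finset.sup_le h) (not_le.2 hi)
      obtain rfl : f = e := by
        by_contra hne
        have := hone f hne; omega
      rw [mem_out] at hf
      subst hf
      rw [Finset.sum_eq_single_of_mem f (mem_out.2 rfl), splitX_pos K hi0 hfi,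
        splitY_pos K hi0 hfi, G.YX_self]
      intro f' _ hne
      rw [splitX_eq_zero K (by rw [hone f' hne]; exact hi0), zero_mul]
  XY_ne x i j hi hj hij := by
    have G := (F.split e).family_lpa (K := K)
    refine Finset.sum_eq_zero fun f _ => ?_
    by_cases hfi : F.w f ≤ i
    · rw [splitX_eq_zero K hfi, zero_mul]
    by_cases hfj : F.w f ≤ j
    · rw [splitY_eq_zero K hfj, mul_zero]
    obtain rfl : f = e := by
      by_contra hne
      have := hone f hne; omega
    rcases Nat.eq_zero_or_pos i with rfl | hi0
    · rw [splitX_zero, splitOverEdge_self, Finset.sum_singleton,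
        splitY_pos K (by omega) (by omega)]
      refine G.X_mul_of_ne (G.PX _) fun h => ?_
      have : j = 0 := congrArg (fun u => u.1.2) h
      omega
    rcases Nat.eq_zero_or_pos j with rfl | hj0
    · rw [splitY_zero, splitOverEdge_self, Finset.sum_singleton,
        splitX_pos K (by omega) (by omega)]
      refine G.Y_mul_of_ne (G.PY _) fun h => ?_
      have : 0 = i := congrArg (fun u => u.1.2) h
      omega
    · rw [splitX_pos K hi0 (by omega), splitY_pos K hj0 (by omega)]
      refine G.YX_ne _ _ fun h => hij ?_
      injection h
  YX_self f := by
    have G := (F.split e).family_lpa (K := K)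
    have hle : F.w f ≤ F.vw (F.s f) := w_le_vw rfl
    have hsub : ∑ i ∈ Finset.range (F.vw (F.s f)), F.splitY e K f i * F.splitX e K f i =
        ∑ i ∈ Finset.range (F.w f), F.splitY e K f i * F.splitX e K f i := by
      refine (Finset.sum_subset (Finset.range_subset_range.2 hle) fun i _ hi => ?_).symm
      rw [splitX_eq_zero K (by simpa using hi), mul_zero]
    rw [hsub]
    by_cases hf : f = e
    · subst hf
      rw [splitP, sum_splitOver]
      have hidx : F.splitIdx f (F.r f) = Finset.range (F.w f) := if_pos rfl
      have hterm : ∀ k : F.splitIdx f (F.r f), (F.split f).lpaVertex K ⟨(F.r f, k.1), k.2⟩ =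
          F.splitY f K f k.1 * F.splitX f K f k.1 := by
        rintro ⟨k, hk⟩
        have hk' := mem_splitIdx_range.1 hk
        rcases Nat.eq_zero_or_pos k with rfl | hk0
        · rw [splitY_zero_mul_splitX_zero, splitOverEdge_self, Finset.sum_singleton]
        · dsimp only
          rw [splitX_pos K hk0 hk', splitY_pos K hk0 hk']
          exact (lpa_up_mul_ghost K hsink hk0 hk').symm
      rw [Finset.sum_congr rfl fun k _ => hterm k,
        Finset.sum_attach _ fun k => F.splitY f K f k * F.splitX f K f k, hidx]
    · rw [hone f hf, Finset.sum_range_one, splitY_zero_mul_splitX_zero, sum_splitOverEdge hf,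
        splitP, sum_splitOver]
  YX_ne f f' hs hne := by
    refine Finset.sum_eq_zero fun i _ => ?_
    rcases Nat.eq_zero_or_pos i with rfl | hi0
    · exact splitY_zero_mul_splitX_zero_of_ne hne
    · by_cases hf : f = e
      · have hw := hone f' (by rw [← hf]; exact hne.symm)
        rw [splitX_eq_zero K (by omega), mul_zero]
      · rw [splitY_eq_zero K (by rw [hone f hf]; exact hi0), zero_mul]

variable (F e) in
open Classical in
/-- The image in `L_K(F, w)` of a vertex of the split graph. -/
noncomputable def unsplitP (u : (F.split e).V) : F.wLPA K :=
  if u.1.1 = F.r e then F.gh K e u.1.2 * F.ed K e u.1.2 else F.wlpaVertex K u.1.1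

variable (F e) in
/-- The image in `L_K(F, w)` of an edge of the split graph. -/
noncomputable def unsplitX : (F.split e).Edge → F.wLPA K
  | .copy f _ k hk => F.ed K f 0 * F.unsplitP e K ⟨(F.r f, k), hk⟩
  | .main => F.ed K e 0
  | .up k _ _ => F.gh K e k

variable (F e) in
/-- The image in `L_K(F, w)` of a ghost edge of the split graph. -/
noncomputable def unsplitY : (F.split e).Edge → F.wLPA K
  | .copy f _ k hk => F.unsplitP e K ⟨(F.r f, k), hk⟩ * F.gh K f 0
  | .main => F.gh K e 0
  | .up k _ _ => F.ed K e k

variable {K}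

theorem unsplitP_of_ne {y : F.V} (hy : y ≠ F.r e) :
    F.unsplitP e K ⟨(y, 0), zero_mem_splitIdx _⟩ = F.wlpaVertex K y := if_neg hy

theorem unsplitP_range {k : ℕ} (hk : k ∈ F.splitIdx e (F.r e)) :
    F.unsplitP e K ⟨(F.r e, k), hk⟩ = F.gh K e k * F.ed K e k := if_pos rfl

theorem vertex_mul_unsplitP (u : (F.split e).V) :
    F.wlpaVertex K u.1.1 * F.unsplitP e K u = F.unsplitP e K u := by
  have H := F.family_wlpa (K := K)
  rcases split_vertex_cases u with ⟨y, hy, rfl⟩ | ⟨k, hk, rfl⟩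
  · rw [unsplitP_of_ne hy, H.P_self]
  · rw [unsplitP_range, ← mul_assoc, H.PY_all]

theorem unsplitP_mul_vertex (u : (F.split e).V) :
    F.unsplitP e K u * F.wlpaVertex K u.1.1 = F.unsplitP e K u := by
  have H := F.family_wlpa (K := K)
  rcases split_vertex_cases u with ⟨y, hy, rfl⟩ | ⟨k, hk, rfl⟩
  · rw [unsplitP_of_ne hy, H.P_self]
  · rw [unsplitP_range, mul_assoc, H.XP_all]

theorem unsplitP_self (hone : ∀ f, f ≠ e → F.w f = 1) (u : (F.split e).V) :
    F.unsplitP e K u * F.unsplitP e K u = F.unsplitP e K u := by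
  have H := F.family_wlpa (K := K)
  rcases split_vertex_cases u with ⟨y, hy, rfl⟩ | ⟨k, hk, rfl⟩
  · rw [unsplitP_of_ne hy, H.P_self]
  · rw [unsplitP_range, mul_assoc, H.XYX (fun f _ hf => hone f hf) hk]

theorem unsplitP_ne (hone : ∀ f, f ≠ e → F.w f = 1) {u u' : (F.split e).V} (h : u ≠ u') :
    F.unsplitP e K u * F.unsplitP e K u' = 0 := by
  have H := F.family_wlpa (K := K)
  by_cases huu : u.1.1 = u'.1.1
  · rcases split_vertex_cases u with ⟨y, hy, rfl⟩ | ⟨k, hk, rfl⟩ <;>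
      rcases split_vertex_cases u' with ⟨y', hy', rfl⟩ | ⟨k', hk', rfl⟩
    · change y = y' at huu
      subst huu; exact absurd rfl h
    · exact absurd huu hy
    · exact absurd huu.symm hy'
    · rw [unsplitP_range, unsplitP_range, mul_assoc, ← mul_assoc (F.ed K e k),
        H.XY_ne_of_pos (fun f _ hf => hone f hf) hk hk', zero_mul, mul_zero]
      rintro rfl
      exact h rfl
  · rw [← unsplitP_mul_vertex u, mul_assoc, H.P_mul_of_ne (vertex_mul_unsplitP u') (Ne.symm huu),
      mul_zero]

theorem sum_unsplitP (y : F.V) : ∑ u ∈ F.splitOver e y, F.unsplitP e K u = F.wlpaVertex K y := by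
  have H := F.family_wlpa (K := K)
  by_cases hy : y = F.r e
  · subst hy
    have hidx : F.splitIdx e (F.r e) = Finset.range (F.w e) := if_pos rfl
    rw [sum_splitOver, ← H.sum_YX e, ← hidx]
    exact (Finset.sum_congr rfl fun k _ => unsplitP_range (K := K) k.2).trans
      (Finset.sum_attach _ fun k => F.gh K e k * F.ed K e k)
  · rw [Finset.sum_eq_single_of_mem ⟨(y, 0), zero_mem_splitIdx _⟩ (mem_splitOver.2 rfl),
      unsplitP_of_ne hy]
    intro u hu hne
    rw [mem_splitOver] at hu
    rcases split_vertex_cases u with ⟨y', hy', rfl⟩ | ⟨k, hk, rfl⟩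
    · change y' = y at hu
      subst hu; exact absurd rfl hne
    · exact absurd hu.symm hy

theorem sum_unsplitX (f : F.Edge) : ∑ g ∈ F.splitOverEdge e f, F.unsplitX e K g = F.ed K f 0 := by
  have H := F.family_wlpa (K := K)
  by_cases hf : f = e
  · subst hf; rw [splitOverEdge_self, Finset.sum_singleton]; rfl
  · rw [sum_splitOverEdge hf]
    change ∑ k ∈ (F.splitIdx e (F.r f)).attach,
      F.ed K f 0 * F.unsplitP e K ⟨(F.r f, k.1), k.2⟩ = _
    rw [← Finset.mul_sum, ← sum_splitOver (F.r f) (F.unsplitP e K), sum_unsplitP, H.XP_all]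

theorem sum_unsplitY (f : F.Edge) : ∑ g ∈ F.splitOverEdge e f, F.unsplitY e K g = F.gh K f 0 := by
  have H := F.family_wlpa (K := K)
  by_cases hf : f = e
  · subst hf; rw [splitOverEdge_self, Finset.sum_singleton]; rfl
  · rw [sum_splitOverEdge hf]
    change ∑ k ∈ (F.splitIdx e (F.r f)).attach,
      F.unsplitP e K ⟨(F.r f, k.1), k.2⟩ * F.gh K f 0 = _
    rw [← Finset.sum_mul, ← sum_splitOver (F.r f) (F.unsplitP e K), sum_unsplitP, H.PY_all]

theorem sum_unsplitX_mul_unsplitY (hone : ∀ f, f ≠ e → F.w f = 1) (f : F.Edge) :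
    ∑ g ∈ F.splitOverEdge e f, F.unsplitX e K g * F.unsplitY e K g =
      F.ed K f 0 * F.gh K f 0 := by
  by_cases hf : f = e
  · subst hf; rw [splitOverEdge_self, Finset.sum_singleton]; rfl
  · rw [← sum_unsplitX f, Finset.sum_mul, sum_splitOverEdge hf, sum_splitOverEdge hf]
    refine Finset.sum_congr rfl fun k _ => ?_
    change F.ed K f 0 * F.unsplitP e K _ * (F.unsplitP e K _ * F.gh K f 0) =
      F.ed K f 0 * F.unsplitP e K _ * F.gh K f 0
    rw [mul_assoc, ← mul_assoc (F.unsplitP e K _), unsplitP_self hone, ← mul_assoc]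

variable (K)

theorem unsplitY_mul_unsplitX_of_ne (hsink : ∀ f, F.s f ≠ F.r e)
    (hone : ∀ f, f ≠ e → F.w f = 1) {g g' : (F.split e).Edge} (hne : g ≠ g') :
    F.unsplitY e K g * F.unsplitX e K g' = 0 := by
  have H := F.family_wlpa (K := K)
  have hgX : ∀ f f', f ≠ f' → (f ≠ e ∨ f' ≠ e) → F.gh K f 0 * F.ed K f' 0 = 0 := by
    intro f f' h h'
    by_cases hs : F.s f' = F.s f
    · exact H.YX_ne_zero hs h (h'.imp (hone f) (hone f'))
    · exact H.Y_mul_of_ne (H.PX_all f' 0) hs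
  cases g with
  | copy f hf k hk =>
    cases g' with
    | copy f' hf' k' hk' =>
      change F.unsplitP e K _ * F.gh K f 0 * (F.ed K f' 0 * F.unsplitP e K _) = 0
      rw [mul_assoc, ← mul_assoc (F.gh K f 0)]
      by_cases h : f = f'
      · subst h
        rw [H.YX_self_of_one (hone f hf)]
        have := vertex_mul_unsplitP (K := K) (⟨(F.r f, k'), hk'⟩ : (F.split e).V)
        rw [this]
        refine unsplitP_ne hone fun h => hne ?_
        obtain rfl : k = k' := congrArg (fun u => u.1.2) h
        rfl
      · rw [hgX f f' h (Or.inl hf), zero_mul, mul_zero]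
    | main =>
      change F.unsplitP e K _ * F.gh K f 0 * F.ed K e 0 = 0
      rw [mul_assoc, hgX f e hf (Or.inl hf), mul_zero]
    | up k' hk' hke' =>
      change F.unsplitP e K _ * F.gh K f 0 * F.gh K e k' = 0
      rw [mul_assoc, H.Y_mul_of_ne (H.PY_all e k') (hsink f).symm, mul_zero]
  | main =>
    cases g' with
    | copy f' hf' k' hk' =>
      change F.gh K e 0 * (F.ed K f' 0 * F.unsplitP e K _) = 0
      rw [← mul_assoc, hgX e f' hf'.symm (Or.inr hf'), zero_mul]
    | main => exact absurd rfl hne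
    | up k' hk' hke' => exact H.Y_mul_of_ne (H.PY_all e k') (hsink e).symm
  | up k hk hke =>
    cases g' with
    | copy f' hf' k' hk' =>
      change F.ed K e k * (F.ed K f' 0 * F.unsplitP e K _) = 0
      rw [← mul_assoc, H.X_mul_of_ne (H.PX_all f' 0) (hsink f'), zero_mul]
    | main => exact H.X_mul_of_ne (H.PX_all e 0) (hsink e)
    | up k' hk' hke' =>
      refine H.XY_ne_of_pos (fun f _ hf => hone f hf) hke hke' ?_
      rintro rfl
      exact hne rfl

theorem family_unsplit (hsink : ∀ f, F.s f ≠ F.r e) (hone : ∀ f, f ≠ e → F.w f = 1) :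
    (F.split e).Family (F.unsplitP e K) (F.unsplitX e K) (F.unsplitY e K) where
  P_self := unsplitP_self hone
  P_ne _ _ h := unsplitP_ne hone h
  PX g := by
    have H := F.family_wlpa (K := K)
    cases g with
    | copy f hf k hk =>
      change F.unsplitP e K ⟨(F.s f, 0), _⟩ * (F.ed K f 0 * F.unsplitP e K _) = _
      rw [unsplitP_of_ne (hsink f), ← mul_assoc, H.PX_all]; rfl
    | main =>
      change F.unsplitP e K ⟨(F.s e, 0), _⟩ * F.ed K e 0 = F.ed K e 0
      rw [unsplitP_of_ne (hsink e), H.PX_all]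
    | up k hk hke =>
      change F.unsplitP e K ⟨(F.r e, k), _⟩ * F.gh K e k = F.gh K e k
      rw [unsplitP_range, H.YXY (fun f _ hf => hone f hf) hke]
  XP g := by
    have H := F.family_wlpa (K := K)
    cases g with
    | copy f hf k hk =>
      change F.ed K f 0 * F.unsplitP e K _ * F.unsplitP e K _ = _
      rw [mul_assoc, unsplitP_self hone]; rfl
    | main =>
      change F.ed K e 0 * F.unsplitP e K ⟨(F.r e, 0), _⟩ = F.ed K e 0
      rw [unsplitP_range, H.XYX (fun f _ hf => hone f hf) (F.w_pos e)]
    | up k hk hke =>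
      change F.gh K e k * F.unsplitP e K ⟨(F.s e, 0), _⟩ = F.gh K e k
      rw [unsplitP_of_ne (hsink e), H.YP_all]
  PY g := by
    have H := F.family_wlpa (K := K)
    cases g with
    | copy f hf k hk =>
      change F.unsplitP e K _ * (F.unsplitP e K _ * F.gh K f 0) = _
      rw [← mul_assoc, unsplitP_self hone]; rfl
    | main =>
      change F.unsplitP e K ⟨(F.r e, 0), _⟩ * F.gh K e 0 = F.gh K e 0
      rw [unsplitP_range, H.YXY (fun f _ hf => hone f hf) (F.w_pos e)]
    | up k hk hke =>
      change F.unsplitP e K ⟨(F.s e, 0), _⟩ * F.ed K e k = F.ed K e k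
      rw [unsplitP_of_ne (hsink e), H.PX_all]
  YP g := by
    have H := F.family_wlpa (K := K)
    cases g with
    | copy f hf k hk =>
      change F.unsplitP e K _ * F.gh K f 0 * F.unsplitP e K ⟨(F.s f, 0), _⟩ = _
      rw [unsplitP_of_ne (hsink f), mul_assoc, H.YP_all]; rfl
    | main =>
      change F.gh K e 0 * F.unsplitP e K ⟨(F.s e, 0), _⟩ = F.gh K e 0
      rw [unsplitP_of_ne (hsink e), H.YP_all]
    | up k hk hke =>
      change F.ed K e k * F.unsplitP e K ⟨(F.r e, k), _⟩ = F.ed K e k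
      rw [unsplitP_range, H.XYX (fun f _ hf => hone f hf) hke]
  YX_self g := by
    have H := F.family_wlpa (K := K)
    cases g with
    | copy f hf k hk =>
      change F.unsplitP e K _ * F.gh K f 0 * (F.ed K f 0 * F.unsplitP e K _) = F.unsplitP e K _
      have := vertex_mul_unsplitP (K := K) (⟨(F.r f, k), hk⟩ : (F.split e).V)
      rw [mul_assoc, ← mul_assoc (F.gh K f 0), H.YX_self_of_one (hone f hf), this,
        unsplitP_self hone]
    | main => exact (unsplitP_range _).symm
    | up k hk hke =>
      change F.ed K e k * F.gh K e k = F.unsplitP e K ⟨(F.s e, 0), _⟩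
      rw [unsplitP_of_ne (hsink e), H.XY_self_of_pos (fun f _ hf => hone f hf) hke hk]
  YX_ne _ _ h := unsplitY_mul_unsplitX_of_ne K hsink hone h
  XY u hu hfin := by
    have H := F.family_wlpa (K := K)
    rcases split_vertex_cases u with ⟨y, hy, rfl⟩ | ⟨k, hk, rfl⟩
    · rw [sum_split_out hy, unsplitP_of_ne hy,
        Finset.sum_congr rfl fun f _ => sum_unsplitX_mul_unsplitY hone f]
      refine H.XY_self y 0 ?_
      by_contra hvw
      refine hu (Set.eq_empty_of_forall_notMem fun g hg => ?_)
      obtain ⟨f, hf, -⟩ := (split_s_eq_iff hy).1 hg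
      have := (F.w_pos f).trans (w_le_vw hf)
      omega
    · rcases Nat.eq_zero_or_pos k with rfl | hk0
      · exfalso
        refine hu (Set.eq_empty_of_forall_notMem fun g hg => ?_)
        have h : (F.split e).s g = ⟨(F.r e, 0), _⟩ := hg
        cases g with
        | copy f hf k hk => exact absurd (congrArg (fun u => u.1.1) h) (hsink f)
        | main => exact absurd (congrArg (fun u => u.1.1) h) (hsink e)
        | up k' hk' hke' =>
          have : k' = 0 := congrArg (fun u => u.1.2) h
          omega
      · rw [sum_split_up hsink hk0 hk, unsplitP_range]
        rfl

/-- If `e` is the only weighted edge and ends in a sink, then splitting the range of `e` turns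
`L_K(F, w)` into the Leavitt path algebra of a directed graph. -/
theorem exists_split_iso (hsink : ∀ f, F.s f ≠ F.r e) (hone : ∀ f, f ≠ e → F.w f = 1) :
    ∃ φ : F.wLPA K →ₙₐ[K] (F.split e).LPA K, Function.Bijective φ ∧
      (∀ y, φ (F.wlpaVertex K y) = ∑ u ∈ F.splitOver e y, (F.split e).lpaVertex K u) ∧
      ∀ f, φ (F.ed K f 0) = ∑ g ∈ F.splitOverEdge e f, (F.split e).lpaEdge K g ∧
        φ (F.gh K f 0) = ∑ g ∈ F.splitOverEdge e f, (F.split e).lpaGhost K g := by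
  have G := (F.split e).family_lpa (K := K)
  have h1 := family_split K hsink hone
  have h2 := family_unsplit K hsink hone
  let φ := lift (K := K) h1
  let ψ := DirectedGraph.lift (K := K) h2
  have hψφ : ψ.comp φ = NonUnitalAlgHom.id K (F.wLPA K) := by
    apply hom_ext
    · intro y
      change ψ (φ (F.wlpaVertex K y)) = F.wlpaVertex K y
      rw [lift_vertex, splitP, map_sum, ← sum_unsplitP (e := e)]
      exact Finset.sum_congr rfl fun u _ => DirectedGraph.lift_vertex h2 u
    · intro f i hi
      change ψ (φ (F.ed K f i)) = F.ed K f i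
      rw [lift_ed]
      rcases Nat.eq_zero_or_pos i with rfl | hi0
      · rw [splitX_zero, map_sum, ← sum_unsplitX (e := e)]
        exact Finset.sum_congr rfl fun g _ => DirectedGraph.lift_edge h2 g
      · obtain rfl : f = e := by
          by_contra hne
          have := hone f hne; omega
        rw [splitX_pos K hi0 hi]
        exact DirectedGraph.lift_ghost h2 _
    · intro f i hi
      change ψ (φ (F.gh K f i)) = F.gh K f i
      rw [lift_gh]
      rcases Nat.eq_zero_or_pos i with rfl | hi0
      · rw [splitY_zero, map_sum, ← sum_unsplitY (e := e)]
        exact Finset.sum_congr rfl fun g _ => DirectedGraph.lift_ghost h2 g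
      · obtain rfl : f = e := by
          by_contra hne
          have := hone f hne; omega
        rw [splitY_pos K hi0 hi]
        exact DirectedGraph.lift_edge h2 _
  have hP : ∀ u, φ (F.unsplitP e K u) = (F.split e).lpaVertex K u := by
    intro u
    rcases split_vertex_cases u with ⟨y, hy, rfl⟩ | ⟨k, hk, rfl⟩
    · rw [unsplitP_of_ne hy, lift_vertex, splitP_of_ne hy]
    · rw [unsplitP_range, map_mul, lift_ed, lift_gh]
      rcases Nat.eq_zero_or_pos k with rfl | hk0
      · rw [splitY_zero_mul_splitX_zero, splitOverEdge_self, Finset.sum_singleton]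
      · rw [splitX_pos K hk0 hk, splitY_pos K hk0 hk]
        exact lpa_up_mul_ghost K hsink hk0 hk
  have hφψ : φ.comp ψ = NonUnitalAlgHom.id K ((F.split e).LPA K) := by
    apply DirectedGraph.hom_ext
    · intro u
      change φ (ψ ((F.split e).lpaVertex K u)) = (F.split e).lpaVertex K u
      rw [DirectedGraph.lift_vertex, hP]
    · intro g
      change φ (ψ ((F.split e).lpaEdge K g)) = (F.split e).lpaEdge K g
      rw [DirectedGraph.lift_edge]
      cases g with
      | copy f hf k hk =>
        change φ (F.ed K f 0 * F.unsplitP e K _) = _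
        have hmem : (.copy f hf k hk : (F.split e).Edge) ∈ F.splitOverEdge e f :=
          copy_mem_splitOverEdge.2 rfl
        rw [map_mul, hP, lift_ed, splitX_zero, Finset.sum_mul,
          Finset.sum_eq_single_of_mem _ hmem fun g hg hne => G.X_mul_of_ne (G.P_self _)
            fun h => hne (split_r_injOn hg hmem h.symm)]
        exact G.XP (.copy f hf k hk)
      | main =>
        change φ (F.ed K e 0) = _
        rw [lift_ed, splitX_zero, splitOverEdge_self, Finset.sum_singleton]
      | up k hk hke =>
        change φ (F.gh K e k) = _
        rw [lift_gh, splitY_pos K hk hke]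
    · intro g
      change φ (ψ ((F.split e).lpaGhost K g)) = (F.split e).lpaGhost K g
      rw [DirectedGraph.lift_ghost]
      cases g with
      | copy f hf k hk =>
        change φ (F.unsplitP e K _ * F.gh K f 0) = _
        have hmem : (.copy f hf k hk : (F.split e).Edge) ∈ F.splitOverEdge e f :=
          copy_mem_splitOverEdge.2 rfl
        rw [map_mul, hP, lift_gh, splitY_zero, Finset.mul_sum,
          Finset.sum_eq_single_of_mem _ hmem fun g hg hne => by
            rw [← G.PY g, ← mul_assoc,
              G.P_ne _ _ fun h => hne (split_r_injOn hg hmem h.symm), zero_mul]]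
        exact G.PY (.copy f hf k hk)
      | main =>
        change φ (F.gh K e 0) = _
        rw [lift_gh, splitY_zero, splitOverEdge_self, Finset.sum_singleton]
      | up k hk hke =>
        change φ (F.ed K e k) = _
        rw [lift_ed, splitX_pos K hk hke]
  refine ⟨φ, ⟨fun a b hab => ?_, fun b => ⟨ψ b, DFunLike.congr_fun hφψ b⟩⟩, lift_vertex h1,
    fun f => ⟨?_, ?_⟩⟩
  · have := congrArg ψ hab
    exact (DFunLike.congr_fun hψφ a).symm.trans (this.trans (DFunLike.congr_fun hψφ b))
  · rw [← splitX_zero]; exact lift_ed h1 f 0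
  · rw [← splitY_zero]; exact lift_gh h1 f 0

end Split

end WeightedGraph
end WLPA

namespace WLPA

/-! ### Hereditary subgraphs and replacement graphs -/

section Annihilator

variable {K X B : Type*} [Field K] [NonUnitalRing B] [Module K B]
  {r : FreeAlg K X → FreeAlg K X → Prop} (κ : RelQuot K r →ₙₐ[K] B)

theorem RelQuot.mul_map_eq_zero {a : B} [SMulCommClass K B B]
    (h : ∀ x, a * κ (RelQuot.mk r (letter K x)) = 0) (b : RelQuot K r) : a * κ b = 0 := by
  have hb : b ∈ Submodule.span K (Set.range fun p => RelQuot.mk (K := K) r (word K p)) := by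
    rw [RelQuot.span_word]; trivial
  induction hb using Submodule.span_induction with
  | zero => rw [map_zero, mul_zero]
  | add x y _ _ hx hy => rw [map_add, mul_add, hx, hy, add_zero]
  | smul k x _ hx => rw [map_smul, mul_smul_comm, hx, smul_zero]
  | mem x hx =>
    obtain ⟨p, rfl⟩ := hx
    dsimp only
    induction p using FreeSemigroup.recOnMul with
    | ih1 x => exact h x
    | ih2 x y hx hy => rw [word_mul, map_mul, map_mul, ← mul_assoc, hx, zero_mul]

theorem RelQuot.map_mul_eq_zero {a : B} [IsScalarTower K B B]
    (h : ∀ x, κ (RelQuot.mk r (letter K x)) * a = 0) (b : RelQuot K r) : κ b * a = 0 := by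
  have hb : b ∈ Submodule.span K (Set.range fun p => RelQuot.mk (K := K) r (word K p)) := by
    rw [RelQuot.span_word]; trivial
  induction hb using Submodule.span_induction with
  | zero => rw [map_zero, zero_mul]
  | add x y _ _ hx hy => rw [map_add, add_mul, hx, hy, add_zero]
  | smul k x _ hx => rw [map_smul, smul_mul_assoc, hx, smul_zero]
  | mem x hx =>
    obtain ⟨p, rfl⟩ := hx
    dsimp only
    induction p using FreeSemigroup.recOnMul with
    | ih1 x => exact h x
    | ih2 x y hx hy => rw [word_mul, map_mul, map_mul, mul_assoc, hy, mul_zero]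

end Annihilator

namespace WeightedGraph

/-- The weighted graph `E.sub H hH` as a reducible definition, so that its vertices and edges are
transparent for rewriting. -/
abbrev restrict (E : WeightedGraph.{u, v}) (H : Set E.V) (hH : E.IsHereditary H) :
    WeightedGraph.{u, v} where
  V := H
  Edge := {e : E.Edge // E.s e ∈ H}
  s e := ⟨E.s e, e.2⟩
  r e := ⟨E.r e, hH.range_mem e.2⟩
  w e := E.w e
  w_pos e := E.w_pos e
  rowFinite := (E.sub H hH).rowFinite

/-- The weighted graph `E.replace H G hG U` as a reducible definition. -/
abbrev replacement (E : WeightedGraph.{u, v}) (H : Set E.V) (G : DirectedGraph.{u, v})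
    (hG : G.RowFinite) (U : H → Finset G.V) : WeightedGraph.{u, max u v} where
  V := {x : E.V // x ∉ H} ⊕ G.V
  Edge := E.ReplEdge H G U
  s := ReplEdge.source
  r := ReplEdge.range
  w := ReplEdge.weight
  w_pos := (E.replace H G hG U).w_pos
  rowFinite := (E.replace H G hG U).rowFinite

theorem wlpaVertex_ne_zero {E : WeightedGraph.{u, v}} {K : Type*} [Field K] (x : E.V) :
    E.wlpaVertex K x ≠ 0 := by
  obtain ⟨Sp, hSp, -⟩ := exists_isSpecial (E := E) ∅ (by simp)
  exact (linearIndependent_elt K hSp).ne_zero ⟨.base x, trivial⟩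

section Sub

variable {E : WeightedGraph.{u, v}} {H : Set E.V} (hH : E.IsHereditary H) (K : Type*) [Field K]

theorem sum_sub_out {M : Type*} [AddCommMonoid M] (y : H) (φ : E.Edge → M) :
    ∑ e ∈ (E.restrict H hH).out y, φ e.1 = ∑ e ∈ E.out y, φ e := by
  refine Finset.sum_bij (fun e _ => e.1) (fun e he => ?_) (fun e _ f _ h => Subtype.ext h)
    (fun e he => ?_) (fun _ _ => rfl)
  · exact mem_out.2 (congrArg Subtype.val (mem_out.1 he))
  · rw [mem_out] at he
    exact ⟨⟨e, he ▸ y.2⟩, mem_out.2 (Subtype.ext he), rfl⟩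

theorem vw_sub (y : H) : (E.restrict H hH).vw y = E.vw y := by
  refine le_antisymm (Finset.sup_le fun e he => ?_) (Finset.sup_le fun e he => ?_)
  · exact w_le_vw (congrArg Subtype.val (mem_out.1 he))
  · rw [mem_out] at he
    exact w_le_vw (E := E.restrict H hH) (e := ⟨e, he ▸ y.2⟩) (Subtype.ext he)

theorem family_sub : (E.restrict H hH).Family (fun y => E.wlpaVertex K y.1) (fun e => E.ed K e.1)
    (fun e => E.gh K e.1) where
  X_zero e := family_wlpa.X_zero e.1
  Y_zero e := family_wlpa.Y_zero e.1
  P_self x := family_wlpa.P_self x.1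
  P_ne x y h := family_wlpa.P_ne x.1 y.1 fun h' => h (Subtype.ext h')
  PX e := family_wlpa.PX e.1
  XP e := family_wlpa.XP e.1
  PY e := family_wlpa.PY e.1
  YP e := family_wlpa.YP e.1
  XY_self x i hi := by
    rw [vw_sub] at hi
    rw [sum_sub_out hH x fun e => E.ed K e i * E.gh K e i]
    exact family_wlpa.XY_self x.1 i hi
  XY_ne x i j hi hj := by
    rw [vw_sub] at hi hj
    rw [sum_sub_out hH x fun e => E.ed K e i * E.gh K e j]
    exact family_wlpa.XY_ne x.1 i j hi hj
  YX_self e := by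
    rw [vw_sub]; exact family_wlpa.YX_self e.1
  YX_ne e f hs h := by
    rw [vw_sub]
    exact family_wlpa.YX_ne e.1 f.1 (congrArg Subtype.val hs) fun h' => h (Subtype.ext h')

/-- The canonical homomorphism `L_K(E_H, w_H) → L_K(E, w)`. -/
noncomputable def subHom : (E.restrict H hH).wLPA K →ₙₐ[K] E.wLPA K := lift (family_sub hH K)

variable {K} in
theorem vertex_mul_subHom {x : E.V} (hx : x ∉ H) (b : (E.restrict H hH).wLPA K) :
    E.wlpaVertex K x * subHom hH K b = 0 := by
  have F := family_wlpa (E := E) (K := K)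
  refine RelQuot.mul_map_eq_zero _ (fun l => ?_) b
  rcases l with y | ⟨e, i⟩ | ⟨e, i⟩
  · have := lift_vertex (K := K) (family_sub hH K) y
    rw [wlpaVertex] at this
    rw [subHom, this]
    exact F.P_ne _ _ fun h => hx (h ▸ y.2)
  · have := lift_ed (K := K) (family_sub hH K) e i
    rw [ed, edgeElt_fin] at this
    rw [subHom, this]
    exact F.P_mul_of_ne (F.PX_all e.1 i) fun h => hx (h ▸ e.2)
  · have := lift_gh (K := K) (family_sub hH K) e i
    rw [gh, ghostElt_fin] at this
    rw [subHom, this]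
    exact F.P_mul_of_ne (F.PY_all e.1 i) fun h => hx (h ▸ hH.range_mem e.2)

variable {K} in
theorem subHom_mul_vertex {x : E.V} (hx : x ∉ H) (b : (E.restrict H hH).wLPA K) :
    subHom hH K b * E.wlpaVertex K x = 0 := by
  have F := family_wlpa (E := E) (K := K)
  refine RelQuot.map_mul_eq_zero _ (fun l => ?_) b
  rcases l with y | ⟨e, i⟩ | ⟨e, i⟩
  · have := lift_vertex (K := K) (family_sub hH K) y
    rw [wlpaVertex] at this
    rw [subHom, this]
    exact F.P_ne _ _ fun h => hx (h ▸ y.2)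
  · have := lift_ed (K := K) (family_sub hH K) e i
    rw [ed, edgeElt_fin] at this
    rw [subHom, this]
    exact F.X_mul_of_ne (F.P_self x) fun h => hx (h ▸ hH.range_mem e.2)
  · have := lift_gh (K := K) (family_sub hH K) e i
    rw [gh, ghostElt_fin] at this
    rw [subHom, this]
    exact F.Y_mul_of_ne (F.P_self x) fun h => hx (h ▸ e.2)

end Sub

section Replace

variable {E : WeightedGraph.{u, v}} {H : Set E.V} {G : DirectedGraph.{u, v}} (hG : G.RowFinite)
  (U : H → Finset G.V) (K : Type*) [Field K]

open Classical in
/-- The edges of the replacement graph that replace an edge `e` outside `H`. -/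
noncomputable def replaceOver (e : E.Edge) : Finset (E.replacement H G hG U).Edge :=
  if hs : E.s e ∈ H then ∅ else
    if hr : E.r e ∈ H then (U ⟨E.r e, hr⟩).attach.image fun u => .copy e hs hr u
    else {.old e hs hr}

variable {hG U}

theorem replaceOver_old {e : E.Edge} (hs : E.s e ∉ H) (hr : E.r e ∉ H) :
    replaceOver hG U e = {.old e hs hr} := by
  rw [replaceOver, dif_neg hs, dif_neg hr]

theorem sum_replaceOver {M : Type*} [AddCommMonoid M] {e : E.Edge} (hs : E.s e ∉ H)
    (hr : E.r e ∈ H) (φ : (E.replacement H G hG U).Edge → M) :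
    ∑ g ∈ replaceOver hG U e, φ g = ∑ u ∈ (U ⟨E.r e, hr⟩).attach, φ (.copy e hs hr u) := by
  classical
  rw [replaceOver, dif_neg hs, dif_pos hr, Finset.sum_image]
  intro a _ b _ h
  injection h

theorem old_mem_replaceOver {e f : E.Edge} {hs hr} :
    (.old e hs hr : E.ReplEdge H G U) ∈ replaceOver hG U f ↔ e = f := by
  classical
  by_cases hs' : E.s f ∈ H
  · simp only [replaceOver, dif_pos hs', Finset.notMem_empty, false_iff]
    rintro rfl; exact hs hs'
  by_cases hr' : E.r f ∈ H
  · simp only [replaceOver, dif_neg hs', dif_pos hr', Finset.mem_image, Finset.mem_attach, true_and,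
      reduceCtorEq, exists_false, false_iff]
    rintro rfl; exact hr hr'
  · simp only [replaceOver, dif_neg hs', dif_neg hr', Finset.mem_singleton]
    constructor
    · intro h; injection h
    · rintro rfl; rfl

theorem copy_mem_replaceOver {e f : E.Edge} {hs hr u} :
    (.copy e hs hr u : E.ReplEdge H G U) ∈ replaceOver hG U f ↔ e = f := by
  classical
  by_cases hs' : E.s f ∈ H
  · simp only [replaceOver, dif_pos hs', Finset.notMem_empty, false_iff]
    rintro rfl; exact hs hs'
  by_cases hr' : E.r f ∈ H
  · simp only [replaceOver, dif_neg hs', dif_pos hr', Finset.mem_image, Finset.mem_attach, true_and]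
    constructor
    · rintro ⟨u', h⟩
      injection h with h
      exact h.symm
    · rintro rfl
      exact ⟨u, rfl⟩
  · simp only [replaceOver, dif_neg hs', dif_neg hr', Finset.mem_singleton, reduceCtorEq, false_iff]
    rintro rfl; exact hr' hr

theorem new_notMem_replaceOver {g : G.Edge} {f : E.Edge} :
    (.new g : E.ReplEdge H G U) ∉ replaceOver hG U f := by
  classical
  by_cases hs' : E.s f ∈ H
  · simp [replaceOver, hs']
  by_cases hr' : E.r f ∈ H
  · simp [replaceOver, hs', hr']
  · simp [replaceOver, hs', hr']

theorem replaceOver_disjoint {e f : E.Edge} {g : (E.replacement H G hG U).Edge}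
    (h : g ∈ replaceOver hG U e) (h' : g ∈ replaceOver hG U f) : e = f := by
  cases g with
  | old e₀ hs hr => exact (old_mem_replaceOver.1 h).symm.trans (old_mem_replaceOver.1 h')
  | copy e₀ hs hr u => exact (copy_mem_replaceOver.1 h).symm.trans (copy_mem_replaceOver.1 h')
  | new g => exact absurd h new_notMem_replaceOver

theorem replace_s_of_mem {e : E.Edge} (hs : E.s e ∉ H) {g : (E.replacement H G hG U).Edge}
    (h : g ∈ replaceOver hG U e) : (E.replacement H G hG U).s g = .inl ⟨E.s e, hs⟩ := by
  cases g with
  | old e₀ hs hr => obtain rfl := old_mem_replaceOver.1 h; rfl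
  | copy e₀ hs hr u => obtain rfl := copy_mem_replaceOver.1 h; rfl
  | new g => exact absurd h new_notMem_replaceOver

theorem replace_w_of_mem {e : E.Edge} {g : (E.replacement H G hG U).Edge}
    (h : g ∈ replaceOver hG U e) : (E.replacement H G hG U).w g = E.w e := by
  cases g with
  | old e₀ hs hr => obtain rfl := old_mem_replaceOver.1 h; rfl
  | copy e₀ hs hr u => obtain rfl := copy_mem_replaceOver.1 h; rfl
  | new g => exact absurd h new_notMem_replaceOver

/-- The edges that replace `e` are determined by their ranges. -/
theorem replace_r_injOn {e : E.Edge} {g g' : (E.replacement H G hG U).Edge}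
    (h : g ∈ replaceOver hG U e) (h' : g' ∈ replaceOver hG U e)
    (hr : (E.replacement H G hG U).r g = (E.replacement H G hG U).r g') : g = g' := by
  cases g with
  | old e₀ hs hr₀ =>
    obtain rfl := old_mem_replaceOver.1 h
    rw [replaceOver_old hs hr₀, Finset.mem_singleton] at h'
    exact h'.symm
  | copy e₀ hs hr₀ u =>
    obtain rfl := copy_mem_replaceOver.1 h
    cases g' with
    | old e₁ hs' hr' => exact absurd hr₀ (old_mem_replaceOver.1 h' ▸ hr')
    | copy e₁ hs' hr' u' =>
      obtain rfl := copy_mem_replaceOver.1 h'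
      have : u = u' := Subtype.ext (Sum.inr.inj hr)
      rw [this]
    | new g => exact absurd h' new_notMem_replaceOver
  | new g => exact absurd h new_notMem_replaceOver

theorem mem_replace_out_inl {x : E.V} (hx : x ∉ H) {g : (E.replacement H G hG U).Edge} :
    g ∈ (E.replacement H G hG U).out (.inl ⟨x, hx⟩) ↔ ∃ e ∈ E.out x, g ∈ replaceOver hG U e := by
  rw [mem_out]
  constructor
  · intro h
    cases g with
    | old e hs hr => exact ⟨e, mem_out.2 (congrArg Subtype.val (Sum.inl.inj h)), old_mem_replaceOver.2 rfl⟩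
    | copy e hs hr u => exact ⟨e, mem_out.2 (congrArg Subtype.val (Sum.inl.inj h)), copy_mem_replaceOver.2 rfl⟩
    | new g => cases h
  · rintro ⟨e, he, h⟩
    obtain rfl := mem_out.1 he
    exact replace_s_of_mem hx h

theorem sum_replace_out_inl {M : Type*} [AddCommMonoid M] {x : E.V} (hx : x ∉ H)
    (φ : (E.replacement H G hG U).Edge → M) :
    ∑ g ∈ (E.replacement H G hG U).out (.inl ⟨x, hx⟩), φ g =
      ∑ e ∈ E.out x, ∑ g ∈ replaceOver hG U e, φ g := by
  classical
  rw [← Finset.sum_biUnion]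
  · refine Finset.sum_congr ?_ fun _ _ => rfl
    ext g
    rw [mem_replace_out_inl, Finset.mem_biUnion]
  · intro f _ f' _ hne
    exact Finset.disjoint_left.2 fun g h h' => hne (replaceOver_disjoint h h')

theorem sum_replace_out_inr {M : Type*} [AddCommMonoid M] (u : G.V)
    (hfin : {g : G.Edge | G.s g = u}.Finite) (φ : (E.replacement H G hG U).Edge → M) :
    ∑ g ∈ (E.replacement H G hG U).out (.inr u), φ g = ∑ g ∈ hfin.toFinset, φ (.new g) := by
  symm
  refine Finset.sum_bij (fun g _ => .new g) (fun g hg => ?_) (fun g _ g' _ h => by injection h)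
    (fun g hg => ?_) (fun _ _ => rfl)
  · exact mem_out.2 (congrArg Sum.inr ((Set.Finite.mem_toFinset hfin).1 hg))
  · rw [mem_out] at hg
    cases g with
    | old e hs hr => cases hg
    | copy e hs hr u => cases hg
    | new g => exact ⟨g, (Set.Finite.mem_toFinset hfin).2 (Sum.inr.inj hg), rfl⟩

theorem vw_replace_inl (hU : ∀ y, (U y).Nonempty) {x : E.V} (hx : x ∉ H) :
    (E.replacement H G hG U).vw (.inl ⟨x, hx⟩) = E.vw x := by
  refine le_antisymm (Finset.sup_le fun g hg => ?_) (Finset.sup_le fun e he => ?_)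
  · obtain ⟨e, he, hge⟩ := (mem_replace_out_inl hx).1 hg
    rw [replace_w_of_mem hge]
    exact w_le_vw (mem_out.1 he)
  · obtain ⟨g, hg⟩ : ∃ g, g ∈ replaceOver hG U e := by
      have hs : E.s e ∉ H := by rwa [mem_out.1 he]
      by_cases hr : E.r e ∈ H
      · obtain ⟨u, hu⟩ := hU ⟨E.r e, hr⟩
        exact ⟨_, copy_mem_replaceOver (hs := hs) (hr := hr) (u := ⟨u, hu⟩).2 rfl⟩
      · exact ⟨_, old_mem_replaceOver (hs := hs) (hr := hr).2 rfl⟩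
    rw [← replace_w_of_mem hg]
    exact w_le_vw (mem_out.1 ((mem_replace_out_inl hx).2 ⟨e, he, hg⟩))

theorem eq_zero_of_lt_vw_replace_inr {u : G.V} {i : ℕ}
    (hi : i < (E.replacement H G hG U).vw (.inr u)) : i = 0 := by
  have : (E.replacement H G hG U).vw (.inr u) ≤ 1 := by
    refine Finset.sup_le fun g hg => ?_
    rw [mem_out] at hg
    cases g with
    | old e hs hr => cases hg
    | copy e hs hr u => cases hg
    | new g => exact le_rfl
  omega

variable (hG U)

/-- The edges of `G` form a family in the algebra of the replacement graph. -/
theorem family_new : G.Family (fun u => (E.replacement H G hG U).wlpaVertex K (.inr u))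
    (fun g => (E.replacement H G hG U).ed K (.new g) 0)
    (fun g => (E.replacement H G hG U).gh K (.new g) 0) := by
  have R := (E.replacement H G hG U).family_wlpa (K := K)
  refine
  { P_self := fun u => R.P_self _
    P_ne := fun u u' h => R.P_ne _ _ fun h' => h (Sum.inr.inj h')
    PX := fun g => R.PX_all (.new g) 0
    XP := fun g => R.XP_all (.new g) 0
    PY := fun g => R.PY_all (.new g) 0
    YP := fun g => R.YP_all (.new g) 0
    YX_self := fun g => R.YX_self_of_one (f := .new g) rfl
    YX_ne := fun g g' h => ?_
    XY := fun u hu hfin => ?_ }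
  · have hne : (.new g : (E.replacement H G hG U).Edge) ≠ .new g' := fun h' => h (by injection h')
    by_cases hs : (E.replacement H G hG U).s (.new g') = (E.replacement H G hG U).s (.new g)
    · exact R.YX_ne_zero hs hne (Or.inl rfl)
    · exact R.Y_mul_of_ne (R.PX_all (.new g') 0) hs
  · obtain ⟨g, hg⟩ := Set.nonempty_iff_ne_empty.2 hu
    have := R.sum_XY_zero (e := .new g)
    have hs : (E.replacement H G hG U).s (.new g) = .inr u := congrArg Sum.inr hg
    rw [hs] at this
    rw [← this]
    exact (sum_replace_out_inr u hfin fun g =>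
      (E.replacement H G hG U).ed K g 0 * (E.replacement H G hG U).gh K g 0).symm

/-- The canonical homomorphism from `L_K(G)` to the algebra of the replacement graph. -/
noncomputable def newHom : G.LPA K →ₙₐ[K] (E.replacement H G hG U).wLPA K :=
  DirectedGraph.lift (family_new hG U K)

variable {K}

variable {hG U} in
theorem newHom_vertex (u : G.V) : newHom hG U K (G.lpaVertex K u) =
    (E.replacement H G hG U).wlpaVertex K (.inr u) :=
  DirectedGraph.lift_vertex _ u

variable {hG U} in
theorem newHom_edge (g : G.Edge) : newHom hG U K (G.lpaEdge K g) =
    (E.replacement H G hG U).ed K (.new g) 0 :=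
  DirectedGraph.lift_edge _ g

variable {hG U} in
theorem newHom_ghost (g : G.Edge) : newHom hG U K (G.lpaGhost K g) =
    (E.replacement H G hG U).gh K (.new g) 0 :=
  DirectedGraph.lift_ghost _ g

theorem vertex_mul_newHom (x : {x : E.V // x ∉ H}) (b : G.LPA K) :
    (E.replacement H G hG U).wlpaVertex K (.inl x) * newHom hG U K b = 0 := by
  have R := (E.replacement H G hG U).family_wlpa (K := K)
  refine RelQuot.mul_map_eq_zero _ (fun l => ?_) b
  rcases l with u | g | g
  · have := DirectedGraph.lift_vertex (K := K) (family_new hG U K) u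
    rw [DirectedGraph.lpaVertex] at this
    rw [newHom, this]
    exact R.P_ne _ _ Sum.inl_ne_inr
  · have := DirectedGraph.lift_edge (K := K) (family_new hG U K) g
    rw [DirectedGraph.lpaEdge] at this
    rw [newHom, this]
    exact R.P_mul_of_ne (R.PX_all (.new g) 0) Sum.inr_ne_inl
  · have := DirectedGraph.lift_ghost (K := K) (family_new hG U K) g
    rw [DirectedGraph.lpaGhost] at this
    rw [newHom, this]
    exact R.P_mul_of_ne (R.PY_all (.new g) 0) Sum.inr_ne_inl

theorem newHom_mul_vertex (x : {x : E.V // x ∉ H}) (b : G.LPA K) :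
    newHom hG U K b * (E.replacement H G hG U).wlpaVertex K (.inl x) = 0 := by
  have R := (E.replacement H G hG U).family_wlpa (K := K)
  refine RelQuot.map_mul_eq_zero _ (fun l => ?_) b
  rcases l with u | g | g
  · have := DirectedGraph.lift_vertex (K := K) (family_new hG U K) u
    rw [DirectedGraph.lpaVertex] at this
    rw [newHom, this]
    exact R.P_ne _ _ Sum.inr_ne_inl
  · have := DirectedGraph.lift_edge (K := K) (family_new hG U K) g
    rw [DirectedGraph.lpaEdge] at this
    rw [newHom, this]
    exact R.X_mul_of_ne (R.P_self _) Sum.inl_ne_inr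
  · have := DirectedGraph.lift_ghost (K := K) (family_new hG U K) g
    rw [DirectedGraph.lpaGhost] at this
    rw [newHom, this]
    exact R.Y_mul_of_ne (R.P_self _) Sum.inl_ne_inr

/-! ### The homomorphism to the algebra of the replacement graph -/

section ToReplacement

variable {hH : E.IsHereditary H} (φ : (E.restrict H hH).wLPA K →ₙₐ[K] G.LPA K)

open Classical in
/-- The image of a vertex in the algebra of the replacement graph. -/
noncomputable def replP (x : E.V) : (E.replacement H G hG U).wLPA K :=
  if h : x ∈ H then newHom hG U K (φ ((E.restrict H hH).wlpaVertex K ⟨x, h⟩))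
  else (E.replacement H G hG U).wlpaVertex K (.inl ⟨x, h⟩)

open Classical in
/-- The image of an edge in the algebra of the replacement graph. -/
noncomputable def replX (e : E.Edge) (i : ℕ) : (E.replacement H G hG U).wLPA K :=
  if h : E.s e ∈ H then newHom hG U K (φ ((E.restrict H hH).ed K ⟨e, h⟩ i))
  else ∑ g ∈ replaceOver hG U e, (E.replacement H G hG U).ed K g i

open Classical in
/-- The image of a ghost edge in the algebra of the replacement graph. -/
noncomputable def replY (e : E.Edge) (i : ℕ) : (E.replacement H G hG U).wLPA K :=
  if h : E.s e ∈ H then newHom hG U K (φ ((E.restrict H hH).gh K ⟨e, h⟩ i))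
  else ∑ g ∈ replaceOver hG U e, (E.replacement H G hG U).gh K g i

variable {φ hG U}

theorem replP_of_mem {x : E.V} (h : x ∈ H) :
    replP hG U φ x = newHom hG U K (φ ((E.restrict H hH).wlpaVertex K ⟨x, h⟩)) := dif_pos h

theorem replP_of_notMem {x : E.V} (h : x ∉ H) :
    replP hG U φ x = (E.replacement H G hG U).wlpaVertex K (.inl ⟨x, h⟩) := dif_neg h

theorem replX_of_mem {e : E.Edge} (h : E.s e ∈ H) (i : ℕ) :
    replX hG U φ e i = newHom hG U K (φ ((E.restrict H hH).ed K ⟨e, h⟩ i)) := dif_pos h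

theorem replX_of_notMem {e : E.Edge} (h : E.s e ∉ H) (i : ℕ) :
    replX hG U φ e i = ∑ g ∈ replaceOver hG U e, (E.replacement H G hG U).ed K g i := dif_neg h

theorem replY_of_mem {e : E.Edge} (h : E.s e ∈ H) (i : ℕ) :
    replY hG U φ e i = newHom hG U K (φ ((E.restrict H hH).gh K ⟨e, h⟩ i)) := dif_pos h

theorem replY_of_notMem {e : E.Edge} (h : E.s e ∉ H) (i : ℕ) :
    replY hG U φ e i = ∑ g ∈ replaceOver hG U e, (E.replacement H G hG U).gh K g i := dif_neg h

/-- The image of the range of `e` is the sum of the ranges of the edges that replace `e`. -/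
theorem sum_vertex_replaceOver
    (hφ : ∀ y, φ ((E.restrict H hH).wlpaVertex K y) = ∑ u ∈ U y, G.lpaVertex K u) {e : E.Edge}
    (hs : E.s e ∉ H) : ∑ g ∈ replaceOver hG U e,
      (E.replacement H G hG U).wlpaVertex K ((E.replacement H G hG U).r g) =
        replP hG U φ (E.r e) := by
  by_cases hr : E.r e ∈ H
  · rw [replP_of_mem hr, sum_replaceOver hs hr, hφ, map_sum]
    exact (Finset.sum_congr rfl fun u _ => (newHom_vertex u.1).symm).trans
      (Finset.sum_attach _ fun u => newHom hG U K (G.lpaVertex K u))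
  · rw [replP_of_notMem hr, replaceOver_old hs hr, Finset.sum_singleton]
    rfl

/-- The copies of an edge have distinct ranges, so that a product of sums over them is a sum of
products. -/
theorem sum_ed_mul_sum {e : E.Edge} {i : ℕ}
    {Z : (E.replacement H G hG U).Edge → (E.replacement H G hG U).wLPA K}
    (hZ : ∀ g ∈ replaceOver hG U e,
      (E.replacement H G hG U).wlpaVertex K ((E.replacement H G hG U).r g) * Z g = Z g) :
    (∑ g ∈ replaceOver hG U e, (E.replacement H G hG U).ed K g i) *
      ∑ g ∈ replaceOver hG U e, Z g =
        ∑ g ∈ replaceOver hG U e, (E.replacement H G hG U).ed K g i * Z g := by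
  have R := (E.replacement H G hG U).family_wlpa (K := K)
  rw [Finset.sum_mul]
  refine Finset.sum_congr rfl fun g hg => ?_
  rw [Finset.mul_sum, Finset.sum_eq_single_of_mem g hg]
  intro g' hg' hne
  exact R.X_mul_of_ne (hZ g' hg') fun h => hne (replace_r_injOn hg' hg h)

theorem sum_out_replX_mul_replY_of_notMem {x : E.V} (hx : x ∉ H) (i j : ℕ) :
    ∑ e ∈ E.out x, replX hG U φ e i * replY hG U φ e j =
      ∑ g ∈ (E.replacement H G hG U).out (.inl ⟨x, hx⟩),
        (E.replacement H G hG U).ed K g i * (E.replacement H G hG U).gh K g j := by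
  have R := (E.replacement H G hG U).family_wlpa (K := K)
  rw [sum_replace_out_inl hx]
  refine Finset.sum_congr rfl fun e he => ?_
  have hs : E.s e ∉ H := by rwa [mem_out.1 he]
  rw [replX_of_notMem hs, replY_of_notMem hs]
  exact sum_ed_mul_sum fun g _ => R.PY_all g j

theorem sum_out_replX_mul_replY_of_mem {x : E.V} (hx : x ∈ H) (i j : ℕ) :
    ∑ e ∈ E.out x, replX hG U φ e i * replY hG U φ e j =
      newHom hG U K (φ (∑ e ∈ (E.restrict H hH).out ⟨x, hx⟩,
        (E.restrict H hH).ed K e i * (E.restrict H hH).gh K e j)) := by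
  rw [← sum_sub_out hH ⟨x, hx⟩ fun e => replX hG U φ e i * replY hG U φ e j, map_sum, map_sum]
  refine Finset.sum_congr rfl fun e _ => ?_
  rw [replX_of_mem e.2, replY_of_mem e.2, map_mul, map_mul]

theorem sum_replY_mul_replX (hU : ∀ y, (U y).Nonempty) {e f : E.Edge} (he : E.s e ∉ H)
    (hs : E.s f = E.s e) :
    ∑ i ∈ Finset.range (E.vw (E.s e)), replY hG U φ e i * replX hG U φ f i =
      ∑ g ∈ replaceOver hG U e, ∑ g' ∈ replaceOver hG U f,
        ∑ i ∈ Finset.range ((E.replacement H G hG U).vw ((E.replacement H G hG U).s g)),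
          (E.replacement H G hG U).gh K g i * (E.replacement H G hG U).ed K g' i := by
  have hf : E.s f ∉ H := by rwa [hs]
  simp only [replX_of_notMem hf, replY_of_notMem he, Finset.sum_mul_sum]
  rw [Finset.sum_comm]
  refine Finset.sum_congr rfl fun g hg => ?_
  have hvw : (E.replacement H G hG U).vw g.source = E.vw (E.s e) :=
    (congrArg _ (replace_s_of_mem he hg)).trans (vw_replace_inl hU he)
  rw [Finset.sum_comm, hvw]

/-- The images of the generators of `L_K(E, w)` in the algebra of the replacement graph satisfy the
defining relations of `L_K(E, w)`. -/
theorem family_repl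
    (hφ : ∀ y, φ ((E.restrict H hH).wlpaVertex K y) = ∑ u ∈ U y, G.lpaVertex K u)
    (hU : ∀ y, (U y).Nonempty) :
    E.Family (replP hG U φ) (replX hG U φ) (replY hG U φ) := by
  have R := (E.replacement H G hG U).family_wlpa (K := K)
  have S := (E.restrict H hH).family_wlpa (K := K)
  refine ⟨fun e i hi => ?_, fun e i hi => ?_, fun x => ?_, fun x y hxy => ?_, fun e i _ => ?_,
    fun e i _ => ?_, fun e i _ => ?_, fun e i _ => ?_, fun x i hi => ?_,
    fun x i j hi hj hij => ?_, fun e => ?_, fun e f hs hne => ?_⟩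
  · by_cases h : E.s e ∈ H
    · rw [replX_of_mem h, S.X_zero _ _ hi, map_zero, map_zero]
    · rw [replX_of_notMem h]
      exact Finset.sum_eq_zero fun g hg => R.X_zero g i (by rwa [replace_w_of_mem hg])
  · by_cases h : E.s e ∈ H
    · rw [replY_of_mem h, S.Y_zero _ _ hi, map_zero, map_zero]
    · rw [replY_of_notMem h]
      exact Finset.sum_eq_zero fun g hg => R.Y_zero g i (by rwa [replace_w_of_mem hg])
  · by_cases h : x ∈ H
    · rw [replP_of_mem h, ← map_mul, ← map_mul, S.P_self]
    · rw [replP_of_notMem h, R.P_self]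
  · by_cases hx : x ∈ H <;> by_cases hy : y ∈ H
    · rw [replP_of_mem hx, replP_of_mem hy, ← map_mul, ← map_mul,
        S.P_ne _ _ fun h => hxy (congrArg Subtype.val h), map_zero, map_zero]
    · rw [replP_of_mem hx, replP_of_notMem hy, newHom_mul_vertex]
    · rw [replP_of_notMem hx, replP_of_mem hy, vertex_mul_newHom]
    · rw [replP_of_notMem hx, replP_of_notMem hy]
      exact R.P_ne _ _ fun h => hxy (congrArg Subtype.val (Sum.inl.inj h))
  · by_cases h : E.s e ∈ H
    · rw [replX_of_mem h, replP_of_mem h, ← map_mul, ← map_mul]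
      exact congrArg _ (congrArg _ (S.PX_all ⟨e, h⟩ i))
    · rw [replX_of_notMem h, replP_of_notMem h, Finset.mul_sum]
      refine Finset.sum_congr rfl fun g hg => ?_
      rw [← replace_s_of_mem h hg, R.PX_all]
  · by_cases h : E.s e ∈ H
    · rw [replX_of_mem h, replP_of_mem (hH.range_mem h), ← map_mul, ← map_mul]
      exact congrArg _ (congrArg _ (S.XP_all ⟨e, h⟩ i))
    · rw [replX_of_notMem h, ← sum_vertex_replaceOver hφ h, sum_ed_mul_sum fun g _ => R.P_self _]
      exact Finset.sum_congr rfl fun g _ => R.XP_all g i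
  · by_cases h : E.s e ∈ H
    · rw [replY_of_mem h, replP_of_mem (hH.range_mem h), ← map_mul, ← map_mul]
      exact congrArg _ (congrArg _ (S.PY_all ⟨e, h⟩ i))
    · rw [replY_of_notMem h, ← sum_vertex_replaceOver hφ h, Finset.sum_mul_sum]
      refine Finset.sum_congr rfl fun g hg => ?_
      rw [Finset.sum_eq_single_of_mem g hg, R.PY_all]
      intro g' hg' hne
      exact R.P_mul_of_ne (R.PY_all g' i) fun h => hne (replace_r_injOn hg' hg h)
  · by_cases h : E.s e ∈ H
    · rw [replY_of_mem h, replP_of_mem h, ← map_mul, ← map_mul]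
      exact congrArg _ (congrArg _ (S.YP_all ⟨e, h⟩ i))
    · rw [replY_of_notMem h, replP_of_notMem h, Finset.sum_mul]
      refine Finset.sum_congr rfl fun g hg => ?_
      rw [← replace_s_of_mem h hg, R.YP_all]
  · by_cases h : x ∈ H
    · rw [sum_out_replX_mul_replY_of_mem h, replP_of_mem h, S.XY_self _ i (by rwa [vw_sub hH])]
    · rw [sum_out_replX_mul_replY_of_notMem h, replP_of_notMem h,
        R.XY_self _ i (by rwa [vw_replace_inl hU])]
  · by_cases h : x ∈ H
    · rw [sum_out_replX_mul_replY_of_mem h, S.XY_ne _ i j (by rwa [vw_sub hH]) (by rwa [vw_sub hH]) hij,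
        map_zero, map_zero]
    · rw [sum_out_replX_mul_replY_of_notMem h, R.XY_ne _ i j (by rwa [vw_replace_inl hU])
        (by rwa [vw_replace_inl hU]) hij]
  · by_cases h : E.s e ∈ H
    · rw [replP_of_mem (hH.range_mem h)]
      simp only [replX_of_mem h, replY_of_mem h, ← map_mul, ← map_sum]
      have := S.YX_self ⟨e, h⟩
      rw [vw_sub hH] at this
      exact congrArg _ (congrArg _ this)
    · rw [sum_replY_mul_replX hU h rfl, ← sum_vertex_replaceOver hφ h]
      refine Finset.sum_congr rfl fun g hg => ?_
      rw [Finset.sum_eq_single_of_mem g hg, R.YX_self]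
      intro g' hg' hne
      exact R.YX_ne g g' ((replace_s_of_mem h hg').trans (replace_s_of_mem h hg).symm) hne.symm
  · by_cases h : E.s e ∈ H
    · have hf : E.s f ∈ H := by rwa [hs]
      simp only [replX_of_mem hf, replY_of_mem h, ← map_mul, ← map_sum]
      have := S.YX_ne ⟨e, h⟩ ⟨f, hf⟩ (Subtype.ext hs) fun h' => hne (congrArg Subtype.val h')
      rw [vw_sub hH] at this
      exact (congrArg _ (congrArg _ this)).trans (by rw [map_zero, map_zero])
    · have hf : E.s f ∉ H := by rwa [hs]
      rw [sum_replY_mul_replX hU h hs]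
      refine Finset.sum_eq_zero fun g hg => Finset.sum_eq_zero fun g' hg' => ?_
      have hgs := replace_s_of_mem h hg
      have hgs' := replace_s_of_mem hf hg'
      simp only [hs] at hgs'
      exact R.YX_ne g g' (hgs'.trans hgs.symm) fun h' =>
        hne (replaceOver_disjoint hg (h' ▸ hg'))

end ToReplacement

end Replace

end WeightedGraph
end WLPA

namespace WLPA
namespace WeightedGraph

/-! ### The homomorphism from the algebra of the replacement graph -/

section FromReplacement

variable {E : WeightedGraph.{u, v}} {H : Set E.V} {G : DirectedGraph.{u, v}} {hG : G.RowFinite}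
  {U : H → Finset G.V} {K : Type*} [Field K] (χ : G.LPA K →ₙₐ[K] E.wLPA K)

/-- The image in `L_K(E, w)` of a vertex of the replacement graph, where `χ` is the given homomorphism
from `L_K(G)`. -/
noncomputable def backP : {x : E.V // x ∉ H} ⊕ G.V → E.wLPA K
  | .inl x => E.wlpaVertex K x
  | .inr u => χ (G.lpaVertex K u)

/-- The image in `L_K(E, w)` of an edge of the replacement graph. -/
noncomputable def backX : E.ReplEdge H G U → ℕ → E.wLPA K
  | .old e _ _, i => E.ed K e i
  | .copy e _ _ u, i => E.ed K e i * χ (G.lpaVertex K u)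
  | .new g, i => if i = 0 then χ (G.lpaEdge K g) else 0

/-- The image in `L_K(E, w)` of a ghost edge of the replacement graph. -/
noncomputable def backY : E.ReplEdge H G U → ℕ → E.wLPA K
  | .old e _ _, i => E.gh K e i
  | .copy e _ _ u, i => χ (G.lpaVertex K u) * E.gh K e i
  | .new g, i => if i = 0 then χ (G.lpaGhost K g) else 0

variable {χ}

theorem replEdge_cases (g : (E.replacement H G hG U).Edge) :
    (∃ e, E.s e ∉ H ∧ g ∈ replaceOver hG U e) ∨ ∃ g', g = .new g' := by
  cases g with
  | old e hs hr => exact Or.inl ⟨e, hs, old_mem_replaceOver.2 rfl⟩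
  | copy e hs hr u => exact Or.inl ⟨e, hs, copy_mem_replaceOver.2 rfl⟩
  | new g => exact Or.inr ⟨g, rfl⟩

theorem backX_of_mem {e : E.Edge} {g : (E.replacement H G hG U).Edge}
    (hg : g ∈ replaceOver hG U e) (i : ℕ) :
    backX χ g i = E.ed K e i * backP χ g.range := by
  cases g with
  | old e₀ hs hr =>
    obtain rfl := old_mem_replaceOver.1 hg
    exact (family_wlpa.XP_all e₀ i).symm
  | copy e₀ hs hr u =>
    obtain rfl := copy_mem_replaceOver.1 hg
    rfl
  | new g => exact absurd hg new_notMem_replaceOver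

theorem backY_of_mem {e : E.Edge} {g : (E.replacement H G hG U).Edge}
    (hg : g ∈ replaceOver hG U e) (i : ℕ) :
    backY χ g i = backP χ g.range * E.gh K e i := by
  cases g with
  | old e₀ hs hr =>
    obtain rfl := old_mem_replaceOver.1 hg
    exact (family_wlpa.PY_all e₀ i).symm
  | copy e₀ hs hr u =>
    obtain rfl := copy_mem_replaceOver.1 hg
    rfl
  | new g => exact absurd hg new_notMem_replaceOver

theorem sum_backP (hχU : ∀ y : H, ∑ u ∈ U y, χ (G.lpaVertex K u) = E.wlpaVertex K y) {e : E.Edge}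
    (hs : E.s e ∉ H) :
    ∑ g ∈ replaceOver hG U e, backP χ g.range = E.wlpaVertex K (E.r e) := by
  by_cases hr : E.r e ∈ H
  · rw [sum_replaceOver hs hr, ← hχU ⟨E.r e, hr⟩]
    exact Finset.sum_attach _ fun u => χ (G.lpaVertex K u)
  · rw [replaceOver_old hs hr, Finset.sum_singleton]
    rfl

theorem backP_self (p : {x : E.V // x ∉ H} ⊕ G.V) : backP χ p * backP χ p = backP χ p := by
  rcases p with x | u
  · exact family_wlpa.P_self _
  · simp only [backP, ← map_mul]
    rw [DirectedGraph.family_lpa.P_self]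

/-- The two hypotheses say that the image of `χ` annihilates the vertices outside `H`. -/
theorem backP_ne (hχ : ∀ x ∉ H, ∀ b, E.wlpaVertex K x * χ b = 0)
    (hχ' : ∀ x ∉ H, ∀ b, χ b * E.wlpaVertex K x = 0)
    {p q : {x : E.V // x ∉ H} ⊕ G.V} (h : p ≠ q) : backP χ p * backP χ q = 0 := by
  rcases p with x | u <;> rcases q with y | u'
  · exact family_wlpa.P_ne _ _ fun h' => h (congrArg _ (Subtype.ext h'))
  · exact hχ _ x.2 _
  · exact hχ' _ y.2 _
  · simp only [backP, ← map_mul]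
    rw [DirectedGraph.family_lpa.P_ne _ _ fun h' => h (congrArg _ h'), map_zero]

theorem sum_backX_mul_backY
    (hχU : ∀ y : H, ∑ u ∈ U y, χ (G.lpaVertex K u) = E.wlpaVertex K y) {e : E.Edge} (hs : E.s e ∉ H) (i j : ℕ) :
    ∑ g ∈ replaceOver hG U e, backX χ g i * backY χ g j = E.ed K e i * E.gh K e j := by
  have F := family_wlpa (E := E) (K := K)
  have : ∀ g ∈ replaceOver hG U e, backX χ g i * backY χ g j =
      E.ed K e i * backP χ g.range * E.gh K e j := fun g hg => by
    rw [backX_of_mem hg, backY_of_mem hg, mul_assoc, ← mul_assoc (backP χ g.range), backP_self,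
      ← mul_assoc]
  rw [Finset.sum_congr rfl this, ← Finset.sum_mul, ← Finset.mul_sum, sum_backP hχU hs, F.XP_all]

theorem sum_backY_mul_backX (hU : ∀ y, (U y).Nonempty) {e f : E.Edge} (hs : E.s e ∉ H)
    {g g' : (E.replacement H G hG U).Edge} (hg : g ∈ replaceOver hG U e)
    (hg' : g' ∈ replaceOver hG U f) :
    ∑ i ∈ Finset.range ((E.replacement H G hG U).vw ((E.replacement H G hG U).s g)),
      backY χ g i * backX χ g' i =
    backP χ g.range * (∑ i ∈ Finset.range (E.vw (E.s e)), E.gh K e i * E.ed K f i) *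
      backP χ g'.range := by
  rw [(congrArg _ (replace_s_of_mem hs hg)).trans (vw_replace_inl hU hs), Finset.mul_sum,
    Finset.sum_mul]
  refine Finset.sum_congr rfl fun i _ => ?_
  rw [backX_of_mem hg', backY_of_mem hg]
  simp only [mul_assoc]

section

variable (hχU : ∀ y : H, ∑ u ∈ U y, χ (G.lpaVertex K u) = E.wlpaVertex K y)
  (hχ : ∀ x ∉ H, ∀ b, E.wlpaVertex K x * χ b = 0)
  (hχ' : ∀ x ∉ H, ∀ b, χ b * E.wlpaVertex K x = 0)

include hχU hχ hχ'

theorem vertex_mul_backP {e : E.Edge} (hs : E.s e ∉ H) {g : (E.replacement H G hG U).Edge}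
    (hg : g ∈ replaceOver hG U e) :
    E.wlpaVertex K (E.r e) * backP χ g.range = backP χ g.range := by
  rw [← sum_backP (hG := hG) hχU hs, Finset.sum_mul, Finset.sum_eq_single_of_mem g hg, backP_self]
  intro g' hg' hne
  exact backP_ne hχ hχ' fun h => hne (replace_r_injOn hg' hg h)

/-- The images in `L_K(E, w)` of the generators satisfy the defining relations of the algebra of the
replacement graph. -/
theorem family_back (hU : ∀ y, (U y).Nonempty) :
    (E.replacement H G hG U).Family (backP χ) (backX χ) (backY χ) := by
  have F := family_wlpa (E := E) (K := K)
  have L := DirectedGraph.family_lpa (G := G) (K := K)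
  refine ⟨fun g i hi => ?_, fun g i hi => ?_, backP_self, fun p q => backP_ne hχ hχ',
    fun g i _ => ?_, fun g i _ => ?_, fun g i _ => ?_, fun g i _ => ?_, fun p i hi => ?_,
    fun p i j hi hj hij => ?_, fun g => ?_, fun g g' hs hne => ?_⟩
  · cases g with
    | old e hs hr => exact F.X_zero e i hi
    | copy e hs hr u => exact (congrArg (· * _) (F.X_zero e i hi)).trans (zero_mul _)
    | new g => exact if_neg (Nat.one_le_iff_ne_zero.1 hi)
  · cases g with
    | old e hs hr => exact F.Y_zero e i hi
    | copy e hs hr u => exact (congrArg (_ * ·) (F.Y_zero e i hi)).trans (mul_zero _)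
    | new g => exact if_neg (Nat.one_le_iff_ne_zero.1 hi)
  · cases g with
    | old e hs hr => exact F.PX_all e i
    | copy e hs hr u => exact (mul_assoc _ _ _).symm.trans (congrArg (· * _) (F.PX_all e i))
    | new g =>
      change χ (G.lpaVertex K (G.s g)) * (if i = 0 then _ else _) = if i = 0 then _ else _
      split_ifs
      · rw [← map_mul, L.PX]
      · rw [mul_zero]
  · obtain ⟨e, hs, hg⟩ | ⟨g, rfl⟩ := replEdge_cases g
    · rw [backX_of_mem hg, mul_assoc, backP_self]
    · change (if i = 0 then _ else _) * χ (G.lpaVertex K (G.r g)) = if i = 0 then _ else _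
      split_ifs
      · rw [← map_mul, L.XP]
      · rw [zero_mul]
  · obtain ⟨e, hs, hg⟩ | ⟨g, rfl⟩ := replEdge_cases g
    · rw [backY_of_mem hg, ← mul_assoc, backP_self]
    · change χ (G.lpaVertex K (G.r g)) * (if i = 0 then _ else _) = if i = 0 then _ else _
      split_ifs
      · rw [← map_mul, L.PY]
      · rw [mul_zero]
  · cases g with
    | old e hs hr => exact F.YP_all e i
    | copy e hs hr u => exact (mul_assoc _ _ _).trans (congrArg (_ * ·) (F.YP_all e i))
    | new g =>
      change (if i = 0 then _ else _) * χ (G.lpaVertex K (G.s g)) = if i = 0 then _ else _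
      split_ifs
      · rw [← map_mul, L.YP]
      · rw [zero_mul]
  · rcases p with ⟨x, hx⟩ | u
    · rw [sum_replace_out_inl hx]
      rw [vw_replace_inl hU] at hi
      refine (Finset.sum_congr rfl fun e he => ?_).trans (F.XY_self x i hi)
      exact sum_backX_mul_backY hχU (by rwa [mem_out.1 he]) i i
    · have hu : ¬ G.IsSink u := by
        intro hu
        have : (E.replacement H G hG U).vw (.inr u) = 0 := by
          refine Nat.le_zero.1 (Finset.sup_le fun g hg => ?_)
          rw [mem_out] at hg
          cases g with
          | old e hs hr => cases hg
          | copy e hs hr u => cases hg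
          | new g =>
            have : g ∈ {g : G.Edge | G.s g = u} := Sum.inr.inj hg
            rw [hu] at this
            exact this.elim
        omega
      obtain rfl := eq_zero_of_lt_vw_replace_inr hi
      rw [sum_replace_out_inr u (hG u)]
      change ∑ g ∈ (hG u).toFinset, χ (G.lpaEdge K g) * χ (G.lpaGhost K g) = χ (G.lpaVertex K u)
      rw [← L.XY u hu (hG u), map_sum]
      exact Finset.sum_congr rfl fun g _ => (map_mul χ _ _).symm
  · rcases p with ⟨x, hx⟩ | u
    · rw [sum_replace_out_inl hx]
      rw [vw_replace_inl hU] at hi hj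
      refine (Finset.sum_congr rfl fun e he => ?_).trans (F.XY_ne x i j hi hj hij)
      exact sum_backX_mul_backY hχU (by rwa [mem_out.1 he]) i j
    · exact absurd ((eq_zero_of_lt_vw_replace_inr hi).trans (eq_zero_of_lt_vw_replace_inr hj).symm)
        hij
  · obtain ⟨e, hs, hg⟩ | ⟨g, rfl⟩ := replEdge_cases g
    · rw [sum_backY_mul_backX hU hs hg hg, F.YX_self, mul_assoc,
        vertex_mul_backP hχU hχ hχ' hs hg, backP_self]
    · rw [Finset.sum_eq_single_of_mem 0
        (Finset.mem_range.2 (((E.replacement H G hG U).w_pos (.new g)).trans (w_le_vw rfl)))]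
      · change χ (G.lpaGhost K g) * χ (G.lpaEdge K g) = χ (G.lpaVertex K (G.r g))
        rw [← map_mul, L.YX_self]
      · intro i _ hi
        change _ * (if i = 0 then _ else _) = _
        rw [if_neg hi, mul_zero]
  · obtain ⟨e, he, hg⟩ | ⟨g, rfl⟩ := replEdge_cases g
    · obtain ⟨f, hf, hg'⟩ | ⟨g', rfl⟩ := replEdge_cases g'
      · rw [sum_backY_mul_backX hU he hg hg']
        by_cases hef : e = f
        · subst hef
          rw [F.YX_self, mul_assoc, vertex_mul_backP hχU hχ hχ' he hg']
          exact backP_ne hχ hχ' fun h => hne (replace_r_injOn hg hg' h)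
        · have hs' : E.s f = E.s e := congrArg Subtype.val (Sum.inl.inj
            ((replace_s_of_mem hf hg').symm.trans (hs.trans (replace_s_of_mem he hg))))
          rw [F.YX_ne e f hs' hef, mul_zero, zero_mul]
      · cases hs.trans (replace_s_of_mem he hg)
    · obtain ⟨f, hf, hg'⟩ | ⟨g', rfl⟩ := replEdge_cases g'
      · cases hs.symm.trans (replace_s_of_mem hf hg')
      · refine Finset.sum_eq_zero fun i _ => ?_
        change (if i = 0 then _ else _) * (if i = 0 then _ else _) = _
        split_ifs
        · rw [← map_mul, L.YX_ne g g' fun h => hne (congrArg _ h), map_zero]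
        · rw [zero_mul]

end

end FromReplacement

/-! ### The algebra of a replacement graph -/

section ReplacementIso

variable {E : WeightedGraph.{u, v}} {H : Set E.V} {hH : E.IsHereditary H}
  {G : DirectedGraph.{u, v}} (hG : G.RowFinite) {U : H → Finset G.V} {K : Type*} [Field K]
  {φ : (E.restrict H hH).wLPA K →ₙₐ[K] G.LPA K}

/-- An isomorphism from the algebra of a hereditary subgraph to an unweighted Leavitt path algebra
extends to an isomorphism to the algebra of the replacement graph. -/
theorem exists_replacement_iso (hφ : Function.Bijective φ)
    (hφU : ∀ y, φ ((E.restrict H hH).wlpaVertex K y) = ∑ u ∈ U y, G.lpaVertex K u) :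
    ∃ (Φ : E.wLPA K →ₙₐ[K] (E.replacement H G hG U).wLPA K)
      (Ψ : (E.replacement H G hG U).wLPA K →ₙₐ[K] E.wLPA K),
      Function.LeftInverse Ψ Φ ∧ Function.RightInverse Ψ Φ ∧
      (∀ x, Φ (E.wlpaVertex K x) = replP hG U φ x) ∧
      (∀ e i, Φ (E.ed K e i) = replX hG U φ e i) ∧
      ∀ e i, Φ (E.gh K e i) = replY hG U φ e i := by
  have F := family_wlpa (E := E) (K := K)
  have R := (E.replacement H G hG U).family_wlpa (K := K)
  have hU : ∀ y, (U y).Nonempty := by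
    intro y
    rw [Finset.nonempty_iff_ne_empty]
    intro h
    have := hφU y
    rw [h, Finset.sum_empty, ← map_zero φ] at this
    exact wlpaVertex_ne_zero _ (hφ.1 this)
  obtain ⟨φ', h₁, h₂⟩ := Function.bijective_iff_has_inverse.1 hφ
  let ψ : G.LPA K →ₙₐ[K] (E.restrict H hH).wLPA K := NonUnitalAlgHom.inverse φ φ' h₁ h₂
  have hψ₁ : ∀ a, ψ (φ a) = a := h₁
  have hψ₂ : ∀ a, φ (ψ a) = a := h₂
  let χ : G.LPA K →ₙₐ[K] E.wLPA K := (subHom hH K).comp ψ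
  have hχ : ∀ a, χ a = subHom hH K (ψ a) := fun _ => rfl
  have hχφ : ∀ a, χ (φ a) = subHom hH K a := fun a => by rw [hχ, hψ₁]
  have fam₁ := family_repl (hG := hG) hφU hU
  have hχU : ∀ y : H, ∑ u ∈ U y, χ (G.lpaVertex K u) = E.wlpaVertex K y := fun y => by
    rw [← map_sum, ← hφU, hχφ]
    exact lift_vertex (family_sub hH K) y
  have fam₂ := family_back (hG := hG) hχU (fun x hx b => vertex_mul_subHom hH hx _)
    (fun x hx b => subHom_mul_vertex hH hx _) hU
  -- Each of the two homomorphisms extends the given one between the subalgebras.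
  have hΦ : ∀ a, lift fam₁ (subHom hH K a) = newHom hG U K (φ a) := by
    suffices h : (lift fam₁).comp (subHom hH K) = (newHom hG U K).comp φ from DFunLike.congr_fun h
    refine hom_ext (fun y => ?_) (fun e i _ => ?_) fun e i _ => ?_
    · rw [NonUnitalAlgHom.comp_apply, NonUnitalAlgHom.comp_apply, subHom]
      rw [lift_vertex, lift_vertex, replP_of_mem y.2]
    · rw [NonUnitalAlgHom.comp_apply, NonUnitalAlgHom.comp_apply, subHom]
      rw [lift_ed, lift_ed, replX_of_mem e.2]
    · rw [NonUnitalAlgHom.comp_apply, NonUnitalAlgHom.comp_apply, subHom]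
      rw [lift_gh, lift_gh, replY_of_mem e.2]
  have hΨ : ∀ a, lift fam₂ (newHom hG U K a) = χ a := by
    suffices h : (lift fam₂).comp (newHom hG U K) = χ from DFunLike.congr_fun h
    refine DirectedGraph.hom_ext (fun u => ?_) (fun g => ?_) fun g => ?_
    · rw [NonUnitalAlgHom.comp_apply]
      rw [newHom_vertex, lift_vertex]; rfl
    · rw [NonUnitalAlgHom.comp_apply]
      rw [newHom_edge, lift_ed, backX, if_pos rfl]
    · rw [NonUnitalAlgHom.comp_apply]
      rw [newHom_ghost, lift_gh, backY, if_pos rfl]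
  refine ⟨lift fam₁, lift fam₂, ?_, ?_, lift_vertex fam₁, lift_ed fam₁, lift_gh fam₁⟩
  · suffices h : (lift fam₂).comp (lift fam₁) = NonUnitalAlgHom.id K _ from DFunLike.congr_fun h
    refine hom_ext (fun x => ?_) (fun e i _ => ?_) fun e i _ => ?_
    · rw [NonUnitalAlgHom.comp_apply]
      rw [lift_vertex]
      by_cases h : x ∈ H
      · rw [replP_of_mem h, hΨ, hχφ]
        exact lift_vertex (family_sub hH K) ⟨x, h⟩
      · rw [replP_of_notMem h, lift_vertex]; rfl
    · rw [NonUnitalAlgHom.comp_apply]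
      rw [lift_ed]
      by_cases h : E.s e ∈ H
      · rw [replX_of_mem h, hΨ, hχφ]
        exact lift_ed (family_sub hH K) ⟨e, h⟩ i
      · rw [replX_of_notMem h, map_sum]
        refine (Finset.sum_congr rfl fun g hg =>
          (lift_ed fam₂ g i).trans (backX_of_mem hg i)).trans ?_
        rw [← Finset.mul_sum, sum_backP hχU h]
        exact F.XP_all e i
    · rw [NonUnitalAlgHom.comp_apply]
      rw [lift_gh]
      by_cases h : E.s e ∈ H
      · rw [replY_of_mem h, hΨ, hχφ]
        exact lift_gh (family_sub hH K) ⟨e, h⟩ i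
      · rw [replY_of_notMem h, map_sum]
        refine (Finset.sum_congr rfl fun g hg =>
          (lift_gh fam₂ g i).trans (backY_of_mem hg i)).trans ?_
        rw [← Finset.sum_mul, sum_backP hχU h]
        exact F.PY_all e i
  · suffices h : (lift fam₁).comp (lift fam₂) = NonUnitalAlgHom.id K _ from DFunLike.congr_fun h
    refine hom_ext (fun p => ?_) (fun g i hi => ?_) fun g i hi => ?_
    · rw [NonUnitalAlgHom.comp_apply]
      rw [lift_vertex]
      rcases p with x | u
      · exact (lift_vertex fam₁ x.1).trans (replP_of_notMem x.2)
      · change lift fam₁ (subHom hH K (ψ _)) = _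
        rw [hΦ, hψ₂, newHom_vertex]; rfl
    · rw [NonUnitalAlgHom.comp_apply]
      rw [lift_ed]
      cases g with
      | old e hs hr =>
        refine (lift_ed fam₁ e i).trans ?_
        rw [replX_of_notMem hs, replaceOver_old hs hr, Finset.sum_singleton]; rfl
      | copy e hs hr u =>
        change lift fam₁ (_ * subHom hH K (ψ _)) = _
        rw [map_mul, hΦ, hψ₂, newHom_vertex, lift_ed, replX_of_notMem hs, Finset.sum_mul,
          Finset.sum_eq_single_of_mem (.copy e hs hr u) (copy_mem_replaceOver.2 rfl)]
        · exact R.XP_all (.copy e hs hr u) i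
        · intro g hg hne
          exact R.X_mul_of_ne (R.P_self _) fun h =>
            hne (replace_r_injOn hg (copy_mem_replaceOver.2 rfl) h.symm)
      | new g =>
        obtain rfl : i = 0 := Nat.lt_one_iff.1 hi
        change lift fam₁ (subHom hH K (ψ _)) = _
        rw [hΦ, hψ₂, newHom_edge]; rfl
    · rw [NonUnitalAlgHom.comp_apply]
      rw [lift_gh]
      cases g with
      | old e hs hr =>
        refine (lift_gh fam₁ e i).trans ?_
        rw [replY_of_notMem hs, replaceOver_old hs hr, Finset.sum_singleton]; rfl
      | copy e hs hr u =>
        change lift fam₁ (subHom hH K (ψ _) * _) = _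
        rw [map_mul, hΦ, hψ₂, newHom_vertex, lift_gh, replY_of_notMem hs, Finset.mul_sum,
          Finset.sum_eq_single_of_mem (.copy e hs hr u) (copy_mem_replaceOver.2 rfl)]
        · exact R.PY_all (.copy e hs hr u) i
        · intro g hg hne
          exact R.P_mul_of_ne (R.PY_all g i) fun h =>
            hne (replace_r_injOn hg (copy_mem_replaceOver.2 rfl) h)
      | new g =>
        obtain rfl : i = 0 := Nat.lt_one_iff.1 hi
        change lift fam₁ (subHom hH K (ψ _)) = _
        rw [hΦ, hψ₂, newHom_ghost]; rfl

/-- The isomorphism of `exists_replacement_iso` respects the degrees of the vertices and of the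
edges of weight one if the given one maps these edges to sums of edges. -/
theorem exists_homogeneous_replacement_iso (hφ : Function.Bijective φ)
    (hφU : ∀ y, φ ((E.restrict H hH).wlpaVertex K y) = ∑ u ∈ U y, G.lpaVertex K u)
    (T : (E.restrict H hH).Edge → Finset G.Edge)
    (hφX : ∀ f, φ ((E.restrict H hH).ed K f 0) = ∑ g ∈ T f, G.lpaEdge K g)
    (hφY : ∀ f, φ ((E.restrict H hH).gh K f 0) = ∑ g ∈ T f, G.lpaGhost K g) :
    ∃ (Φ : E.wLPA K →ₙₐ[K] (E.replacement H G hG U).wLPA K)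
      (Ψ : (E.replacement H G hG U).wLPA K →ₙₐ[K] E.wLPA K),
      Function.LeftInverse Ψ Φ ∧ Function.RightInverse Ψ Φ ∧
      (∀ x, Φ (E.wlpaVertex K x) ∈ (E.replacement H G hG U).component K 0) ∧
      (∀ e, Φ (E.ed K e 0) ∈ (E.replacement H G hG U).component K (Finsupp.single 0 1)) ∧
      ∀ e, Φ (E.gh K e 0) ∈ (E.replacement H G hG U).component K (-Finsupp.single 0 1) := by
  obtain ⟨Φ, Ψ, h₁, h₂, hP, hX, hY⟩ := exists_replacement_iso hG hφ hφU
  refine ⟨Φ, Ψ, h₁, h₂, fun x => ?_, fun e => ?_, fun e => ?_⟩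
  · rw [hP]
    by_cases h : x ∈ H
    · rw [replP_of_mem h, hφU, map_sum]
      exact sum_mem fun u _ => by rw [newHom_vertex]; exact vertex_mem_component _
    · rw [replP_of_notMem h]
      exact vertex_mem_component _
  · rw [hX]
    by_cases h : E.s e ∈ H
    · rw [replX_of_mem h, hφX, map_sum]
      exact sum_mem fun u _ => by rw [newHom_edge]; exact ed_mem_component _ _
    · rw [replX_of_notMem h]
      exact sum_mem fun g _ => ed_mem_component _ _
  · rw [hY]
    by_cases h : E.s e ∈ H
    · rw [replY_of_mem h, hφY, map_sum]
      exact sum_mem fun u _ => by rw [newHom_ghost]; exact gh_mem_component _ _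
    · rw [replY_of_notMem h]
      exact sum_mem fun g _ => gh_mem_component _ _

end ReplacementIso

end WeightedGraph
end WLPA

namespace WLPA
namespace WeightedGraph

/-! ### Removing a weighted edge -/

namespace Controlled

variable {E : WeightedGraph.{u, v}} (hE : E.Controlled)
include hE

/-- A weighted edge ends in a sink, so that a path to a vertex that is not a sink only uses edges of
weight one. -/
theorem dReach_of_geq {x : E.V} {f : E.Edge} (h : E.Geq x (E.s f)) : E.DReach x (E.s f) := by
  have key : ∀ y, E.Geq x y → E.DReach x y ∨ ∃ g, 1 < E.w g ∧ y = E.r g := by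
    intro y h
    induction h with
    | refl => exact Or.inl .refl
    | tail _ hg ih =>
      obtain ⟨g, rfl, rfl⟩ := hg
      rcases ih with ih | ⟨g', hg', h⟩
      · by_cases hg : 1 < E.w g
        · exact Or.inr ⟨g, hg, rfl⟩
        · exact Or.inl (ih.tail (.real g (w_eq_one_of_not hg)))
      · exact absurd h (hE.sink g' hg' g)
  rcases key _ h with h | ⟨g, hg, h⟩
  · exact h
  · exact absurd h (hE.sink g hg f)

/-- Among the weighted edges there is one from which no other weighted edge can be reached, because
no weighted edge starts on a closed path. -/
theorem exists_last_weighted (h : ∃ e, 1 < E.w e) :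
    ∃ e, 1 < E.w e ∧ ∀ f, 1 < E.w f → E.Geq (E.s e) (E.s f) → f = e := by
  have := hE.finite_V
  have := finite_edge (E := E)
  let W := {e : E.Edge // 1 < E.w e}
  let R : W → W → Prop := fun f e => Relation.TransGen E.DStep (E.s e.1) (E.s f.1)
  have hirr : Std.Irrefl R := ⟨fun e he => by
    have h1 := (hE.w_eq_one_of_isCyc (hE.isCyc_of_transGen he)).1
    have h2 := e.2
    omega⟩
  have htrans : IsTrans W R := ⟨fun _ _ _ h h' => Relation.TransGen.trans h' h⟩
  obtain ⟨e, he⟩ := h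
  obtain ⟨e, -, hmin⟩ := (Finite.wellFounded_of_trans_of_irrefl R).has_min Set.univ ⟨⟨e, he⟩, trivial⟩
  refine ⟨e.1, e.2, fun f hf hef => ?_⟩
  rcases Relation.reflTransGen_iff_eq_or_transGen.1 (hE.dReach_of_geq hef) with h | h
  · exact hE.source_inj _ _ hf e.2 h
  · exact absurd h (hmin ⟨f, hf⟩ trivial)

/-- The weighted edges of the graph obtained from splitting the range of `e` in the hereditary
subgraph on `H` are those of `E` except `e`. -/
theorem exists_bijOn_weightedEdges {H : Set E.V} (hH : E.IsHereditary H) {e : E.Edge}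
    (he : 1 < E.w e) (hes : E.s e ∈ H) (hlast : ∀ f, 1 < E.w f → E.s f ∈ H → f = e)
    (hG : ((E.restrict H hH).split ⟨e, hes⟩).RowFinite) :
    ∃ π, Set.BijOn π (E.replacement H ((E.restrict H hH).split ⟨e, hes⟩) hG
      ((E.restrict H hH).splitOver ⟨e, hes⟩)).weightedEdges (E.weightedEdges \ {e}) := by
  let π : E.ReplEdge H ((E.restrict H hH).split ⟨e, hes⟩) ((E.restrict H hH).splitOver ⟨e, hes⟩) →
      E.Edge
    | .old f _ _ => f
    | .copy f _ _ _ => f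
    | .new _ => e
  have hnew : ∀ g, (.new g : ReplEdge _ _ _ _) ∉
      (E.replacement H ((E.restrict H hH).split ⟨e, hes⟩) hG
        ((E.restrict H hH).splitOver ⟨e, hes⟩)).weightedEdges := fun g hg => lt_irrefl 1 hg
  refine ⟨π, fun g hg => ?_, fun g hg g' hg' h => ?_, fun f hf => ?_⟩
  · cases g with
    | old f hs hr => exact ⟨hg, fun (h : f = e) => hs (h ▸ hes)⟩
    | copy f hs hr u => exact ⟨hg, fun (h : f = e) => hs (h ▸ hes)⟩
    | new g => exact absurd hg (hnew g)
  · cases g with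
    | old f hs hr =>
      cases g' with
      | old f' hs' hr' =>
        obtain rfl : f = f' := h
        rfl
      | copy f' hs' hr' u' =>
        obtain rfl : f = f' := h
        exact absurd hr' hr
      | new g' => exact absurd hg' (hnew g')
    | copy f hs hr u =>
      cases g' with
      | old f' hs' hr' =>
        obtain rfl : f = f' := h
        exact absurd hr hr'
      | copy f' hs' hr' u' =>
        obtain rfl : f = f' := h
        -- The range of `f` is not split, since it differs from the range of `e`.
        have hne : (⟨E.r f, hr⟩ : H) ≠ ⟨E.r e, hH.range_mem hes⟩ := fun h => hs (by
          rwa [hE.range_inj f e hg he (congrArg Subtype.val h)])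
        have key : ∀ u ∈ (E.restrict H hH).splitOver ⟨e, hes⟩ ⟨E.r f, hr⟩,
            u.1 = (⟨E.r f, hr⟩, 0) := by
          intro u hu
          have h1 := mem_splitOver.1 hu
          refine Prod.ext h1 ?_
          have h2 := u.2
          rw [splitIdx, if_neg (by rw [h1]; exact hne)] at h2
          exact Finset.mem_singleton.1 h2
        have : u = u' := Subtype.ext (Subtype.ext ((key _ u.2).trans (key _ u'.2).symm))
        rw [this]
      | new g' => exact absurd hg' (hnew g')
    | new g => exact absurd hg (hnew g)
  · have hs : E.s f ∉ H := fun h => hf.2 (hlast f hf.1 h)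
    by_cases hr : E.r f ∈ H
    · exact ⟨.copy f hs hr ⟨⟨(⟨E.r f, hr⟩, 0), zero_mem_splitIdx _⟩, mem_splitOver.2 rfl⟩, hf.1, rfl⟩
    · exact ⟨.old f hs hr, hf.1, rfl⟩

end Controlled

end WeightedGraph
end WLPA

open WLPA WeightedGraph in
theorem proposition5p5 {K : Type*} [Field K] (E : WLPA.WeightedGraph.{u, v})
    (hfin : E.LocallyFinite K)
    (hB : E.weightedEdges = E.weightedEdgesB)
    (hsink : ∀ e ∈ E.weightedEdges, E.IsSink (E.r e))
    (hw : ¬ E.IsUnweighted) :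
    ∃ E' : WLPA.WeightedGraph.{u, max u v},
      Nonempty E'.V ∧
      WLPA.WeightedGraph.IsReplacementGraph K E E' ∧
      (E.weightedEdges.Finite ∧ E'.weightedEdges.Finite ∧
        E'.weightedEdges.ncard + 1 = E.weightedEdges.ncard) ∧
      WLPA.AlgIso K (E'.wLPA K) (E.wLPA K) ∧
      E'.LocallyFinite K := by
  have hE : E.Controlled := by
    refine controlled_of_locallyFinite hfin (fun e he => ?_) fun e he f hf => ?_
    · have he' : e ∈ E.weightedEdgesB := hB ▸ he
      by_contra! h
      refine he'.2 ⟨he, Set.ext fun f => ⟨fun hf => ?_, fun hf => ?_⟩⟩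
      · by_contra hfe
        exact h f hfe hf
      · rw [Set.mem_singleton_iff.1 hf]; rfl
    · have : f ∈ {g : E.Edge | E.s g = E.r e} := hf
      rw [hsink e he] at this
      exact this
  have := hE.finite_V
  have := WeightedGraph.finite_edge (E := E)
  obtain ⟨e, he, hlast⟩ := hE.exists_last_weighted (by
    by_contra! h
    exact hw fun e => le_antisymm (h e) (E.w_pos e))
  -- All edges that start in `H` except `e` have weight one, so that the range of `e` can be split in
  -- the subgraph on `H`.
  let H : Set E.V := {y | E.Geq (E.s e) y}
  have hH : E.IsHereditary H := fun x hx y hxy => Relation.ReflTransGen.trans hx hxy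
  have hes : E.s e ∈ H := Relation.ReflTransGen.refl
  have hsink' : ∀ f, (E.restrict H hH).s f ≠ (E.restrict H hH).r ⟨e, hes⟩ := fun f h =>
    hE.sink e he f.1 (congrArg Subtype.val h)
  obtain ⟨φ, hφ, hφU, hφe⟩ := exists_split_iso K hsink' fun f hf =>
    w_eq_one_of_not fun hf1 => hf (Subtype.ext (hlast f.1 hf1 f.2))
  have hG := split_rowFinite hsink'
  obtain ⟨Φ, Ψ, h₁, h₂, hP, hX, hY⟩ := exists_homogeneous_replacement_iso hG hφ hφU _
    (fun f => (hφe f).1) fun f => (hφe f).2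
  obtain ⟨π, hπ⟩ := hE.exists_bijOn_weightedEdges hH he hes hlast hG
  refine ⟨E.replace H ((E.restrict H hH).split ⟨e, hes⟩) hG
    ((E.restrict H hH).splitOver ⟨e, hes⟩), ?_, ?_, ⟨Set.toFinite _, ?_, ?_⟩, ?_, ?_⟩
  · exact ⟨.inr ⟨(⟨E.s e, hes⟩, 0), zero_mem_splitIdx _⟩⟩
  · exact ⟨H, hH, _, hG, φ, _, hφ, hφU, rfl⟩
  · exact hπ.finite_iff_finite.2 (Set.toFinite _)
  · have h := hπ.injOn.ncard_image
    rw [hπ.image_eq] at h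
    exact (congrArg (· + 1) h.symm).trans
      (Set.ncard_sdiff_singleton_add_one he (Set.toFinite _))
  · exact ⟨Ψ, h₂.injective, h₁.surjective⟩
  · exact hE.locallyFinite_of_surjective Φ h₂.surjective hP (fun f _ => hX f) fun f _ => hY f
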